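/- **Setting.** Let $t_1>0$ and let $\vec X:S^2\times[0,t_1)\to\mathbb R^3$ be a smooth family of (strictly) convex embeddings of the 2-sphere with outward unit normal $\vec n$. At each point let $r_1\ge r_2>0$ be the radii of curvature of $\vec X_t(S^2)$ (the reciprocals of the principal curvatures, which are all positive), and set $\psi=\tfrac12(r_1+r_2)$, $|\sigma|=\tfrac12(r_1-r_2)$. Write $f_t=(\psi,|\sigma|):S^2\to\{(\psi,|\sigma|):0\le|\sigma|<\psi\}$ for the radii of curvature map at time $t$. Let $\mathcal K,\mathcal H$ be real functions on $\{0\le|\sigma|<\psi\}$ that are $C^2$ up to the boundary $|\sigma|=0$; ordered subscripts denote partial derivatives with respect to $\psi$ and $|\sigma|$ (one-sided at $|\sigma|=0$), so $\mathcal K_{10}=\partial\mathcal K/\partial\psi$, $\mathcal K_{01}=\partial\mathcal K/\partial|\sigma|$, etc. Let $\{F,G\}=F_{10}G_{01}-F_{01}G_{10}$ be the Poisson bracket and $\mathcal I=|\sigma|\,\mathcal K$. Assume that $\vec X$ is a classical curvature flow with speed $\mathcal K$, i.e. $$\Big(\frac{\partial\vec X}{\partial t}\Big)^{\perp}=-\mathcal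 K(\psi,|\sigma|)\,\vec n ,$$ and that it is parabolic, i.e. $-\mathcal K_{10}>|\mathcal K_{01}|$ at $f_t(p)$ for all $(p,t)\in S^2\times[0,t_1)$. Put $\mathrm{Hess}_F(d\mathcal H)=F_{20}\mathcal H_{01}^2-2F_{11}\mathcal H_{01}\mathcal H_{10}+F_{02}\mathcal H_{10}^2$ for $F=\mathcal H,\mathcal K$, and $$A=(\mathcal H_{10}^2+\mathcal H_{01}^2)\{\mathcal H,\mathcal K\}-|\sigma|\big(\mathcal K_{10}\,\mathrm{Hess}_{\mathcal H}(d\mathcal H)-\mathcal H_{10}\,\mathrm{Hess}_{\mathcal K}(d\mathcal H)\big),$$ $$B=-2\mathcal H_{10}\mathcal H_{01}\{\mathcal H,\mathcal K\}+|\sigma|\big(\mathcal K_{01}\,\mathrm{Hess}_{\mathcal H}(d\mathcal H)-\mathcal H_{01}\,\mathrm{Hess}_{\mathcal K}(d\mathcal H)\big).$$ **Main Theorem.** If $\{\mathcal H,\mathcal I\}\ge 0$ and $A\ge|B|$ at $f_t(p)$ for all $(p,t)\in S^2\times[0,t_1)$, then $\max_{S^2}\mathcal H\circ f_0$ is attained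 and $$\mathcal H\circ f_t\le\max_{S^2}\mathcal H\circ f_0\qquad\text{on } S^2\text{ for all }t\in[0,t_1).$$ If instead $\{\mathcal H,\mathcal I\}\le 0$ and $A\le-|B|$ at all these points, then $\min_{S^2}\mathcal H\circ f_0$ is attained and $$\mathcal H\circ f_t\ge\min_{S^2}\mathcal H\circ f_0\qquad\text{on } S^2\text{ for all }t\in[0,t_1).$$ -/

import Mathlib

open Set
open scoped Manifold ContDiff

noncomputable section

namespace CurvatureFlow

/-- Euclidean 3-space. -/
abbrev E3 : Type := EuclideanSpace ℝ (Fin 3)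

/-- The unit 2-sphere, with Mathlib's smooth manifold structure. -/
abbrev S2 : Type := Metric.sphere (0 : E3) 1

/-- `dAt Y p` is the differential at `p` of a map `Y : S² → ℝ³`. -/
def dAt (Y : S2 → E3) (p : S2) : TangentSpace (𝓡 2) p →L[ℝ] E3 :=
  mfderiv (𝓡 2) 𝓘(ℝ, E3) Y p

/-- `κ` is a principal curvature at `p` of the surface `Y` with unit normal field `ν`:
`dν(v) = κ dY(v)` for some nonzero tangent vector `v` (an eigenvalue of the Weingarten map, with
the sign for which a round sphere with outward normal has positive curvatures). -/
def IsPrincipalCurvature (Y ν : S2 → E3) (p : S2) (κ : ℝ) : Prop :=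
  ∃ v : TangentSpace (𝓡 2) p, v ≠ 0 ∧ dAt ν p v = κ • dAt Y p v

/-- The radii of curvature at `p`: the reciprocals of the principal curvatures. -/
def radiiOfCurvature (Y ν : S2 → E3) (p : S2) : Set ℝ :=
  {ρ | ∃ κ, IsPrincipalCurvature Y ν p κ ∧ ρ = κ⁻¹}

/-- The larger radius of curvature `r₁`. -/
def r₁ (Y ν : S2 → E3) (p : S2) : ℝ := sSup (radiiOfCurvature Y ν p)

/-- The smaller radius of curvature `r₂`. -/
def r₂ (Y ν : S2 → E3) (p : S2) : ℝ := sInf (radiiOfCurvature Y ν p)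

/-- The radii of curvature map `f = (ψ, |σ|) = ((r₁ + r₂) / 2, (r₁ - r₂) / 2)`. -/
def rocMap (Y ν : S2 → E3) (p : S2) : ℝ × ℝ :=
  ((r₁ Y ν p + r₂ Y ν p) / 2, (r₁ Y ν p - r₂ Y ν p) / 2)

/-- `Y` is a convex embedding of the sphere (an injective immersion of a compact manifold) with
outward unit normal field `ν`. Convexity is in the strict sense in which the radii of curvature
are defined and the Gauss map gives local coordinates: all principal curvatures are positive with
respect to `ν`. (Smoothness is imposed separately.) -/
structure IsConvexEmbedding (Y ν : S2 → E3) : Prop where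
  injective : Function.Injective Y
  immersion : ∀ p, Function.Injective (dAt Y p)
  unit : ∀ p, ‖ν p‖ = 1
  normal : ∀ p v, inner ℝ (ν p) (dAt Y p v) = 0
  pos_curvature : ∀ p κ, IsPrincipalCurvature Y ν p κ → 0 < κ

/-- A classical curvature flow on `[0, t₁)` with speed `K(ψ, |σ|)`: a smooth one-parameter family
of convex embeddings `X t` of the sphere, with smooth outward unit normal `n t`, such that the
normal part of `∂X/∂t` is `-K(ψ, |σ|) n`. -/
structure IsClassicalCurvatureFlow (K : ℝ × ℝ → ℝ) (t₁ : ℝ) (X n : ℝ → S2 → E3) : Prop where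
  smooth : ContMDiffOn (𝓘(ℝ, ℝ).prod (𝓡 2)) 𝓘(ℝ, E3) ∞
    (fun q : ℝ × S2 => X q.1 q.2) (Ico 0 t₁ ×ˢ univ)
  smooth_normal : ContMDiffOn (𝓘(ℝ, ℝ).prod (𝓡 2)) 𝓘(ℝ, E3) ∞
    (fun q : ℝ × S2 => n q.1 q.2) (Ico 0 t₁ ×ˢ univ)
  convex : ∀ t ∈ Ico 0 t₁, IsConvexEmbedding (X t) (n t)
  evolution : ∀ t ∈ Ico 0 t₁, ∀ p,
    inner ℝ (derivWithin (fun τ => X τ p) (Ico 0 t₁) t) (n t p) • n t p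
      = -K (rocMap (X t) (n t) p) • n t p

/-- The part `0 ≤ |σ| < ψ` (that is, `r₁ ≥ r₂ > 0`) of radii of curvature space in which the
radii of curvature of convex surfaces lie. The boundary `|σ| = 0` (umbilic points) is included. -/
def rocRegion : Set (ℝ × ℝ) := {q | 0 ≤ q.2 ∧ q.2 < q.1}

/-- `∂F/∂ψ` (one-sided where necessary, i.e. relative to `rocRegion`). -/
def d10 (F : ℝ × ℝ → ℝ) (q : ℝ × ℝ) : ℝ := fderivWithin ℝ F rocRegion q (1, 0)

/-- `∂F/∂|σ|`; at `|σ| = 0` this is the one-sided derivative. -/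
def d01 (F : ℝ × ℝ → ℝ) (q : ℝ × ℝ) : ℝ := fderivWithin ℝ F rocRegion q (0, 1)

def d20 (F : ℝ × ℝ → ℝ) : ℝ × ℝ → ℝ := d10 (d10 F)

def d11 (F : ℝ × ℝ → ℝ) : ℝ × ℝ → ℝ := d10 (d01 F)

def d02 (F : ℝ × ℝ → ℝ) : ℝ × ℝ → ℝ := d01 (d01 F)

/-- The Poisson bracket `{F, G}` for the canonical coordinates `(ψ, |σ|)`. -/
def poisson (F G : ℝ × ℝ → ℝ) (q : ℝ × ℝ) : ℝ := d10 F q * d01 G q - d01 F q * d10 G q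

/-- `I = |σ| K`. -/
def conserved (K : ℝ × ℝ → ℝ) (q : ℝ × ℝ) : ℝ := q.2 * K q

/-- `Hess_F(dH) = F₂₀ H₀₁² - 2 F₁₁ H₀₁ H₁₀ + F₀₂ H₁₀²`. -/
def hessOn (F H : ℝ × ℝ → ℝ) (q : ℝ × ℝ) : ℝ :=
  d20 F q * d01 H q ^ 2 - 2 * d11 F q * d01 H q * d10 H q + d02 F q * d10 H q ^ 2

def coeffA (H K : ℝ × ℝ → ℝ) (q : ℝ × ℝ) : ℝ :=
  (d10 H q ^ 2 + d01 H q ^ 2) * poisson H K q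
    - q.2 * (d10 K q * hessOn H H q - d10 H q * hessOn K H q)

def coeffB (H K : ℝ × ℝ → ℝ) (q : ℝ × ℝ) : ℝ :=
  -2 * d10 H q * d01 H q * poisson H K q
    + q.2 * (d01 K q * hessOn H H q - d01 H q * hessOn K H q)

/-- Parabolicity of the flow: `-K₁₀ > |K₀₁|` at all radii of curvature that occur. -/
def IsParabolicFlow (K : ℝ × ℝ → ℝ) (t₁ : ℝ) (X n : ℝ → S2 → E3) : Prop :=
  ∀ t ∈ Ico 0 t₁, ∀ p,
    |d01 K (rocMap (X t) (n t) p)| < -d10 K (rocMap (X t) (n t) p)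

end CurvatureFlow

end

/-! The proof is a maximum principle in which the surfaces are parametrized by their normal
direction. For `t > 0` a piece of the flow is described by the support function `h(t, z) = ⟨X, z⟩`,
where `X` is the point at time `t` with unit normal `z / ‖z‖`. Its spatial gradient is `X`; for unit
`z` the eigenvalues of its Hessian on the plane orthogonal to `z` are the radii of curvature; and
the flow becomes the scalar equation `h_t = -‖z‖ K` (`exists_supportFunction`). Hence the time
derivatives of the Hessian entries at a fixed normal `n` are the second derivatives of `-‖z‖ K`
along lines `z = n + x u` and `z = n + x v` (the gnomonic parametrization), with `u, v, n`
orthonormal.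

At a non-umbilic spatial maximum of `H ∘ f`, let `u, v` diagonalize the Hessian of `h`. Along both
axes the first derivative of `H ∘ f` vanishes and the second is nonpositive, while `h_uuvv = h_vvuu`
relates the second derivatives of `ψ` and `|σ|`. Eliminating with this relation, minus the time
derivative of `H ∘ f` becomes a sum of nonnegative terms: the two second order inequalities with
weights `-(K₁₀ ± K₀₁) / 2`, squares divided by `2|σ|` times `A - B` and `A + B`, and `{H, I}`
(`evolution_nonpos_of_nonumbilic`).

At an umbilic point `|σ|` is the square root of a function vanishing there and has only one-sided
expansions. Comparing the two sides shows that either the first derivatives of the Hessian entries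
vanish along both axes, where the second order argument survives with an inequality for the fourth
derivative relation, or `K₀₁ = H₀₁ = 0`. In the second case, unless `dH = 0`, dividing `A ≥ 0` by
the distance to the umbilic and passing to the limit supplies the missing inequality
(`evolution_nonpos_umbilic`).

In both cases `H ∘ f` has, backwards in time at fixed normal, a first order expansion with
nonnegative slope (`exists_backward_expansion`). This excludes a maximum of `H ∘ f - ε t` at a
positive time (`le_initial_max`). The statement for minima is the one for maxima applied to `-H`,
because `{H, I}`, `A` and `B` are odd in `H`. -/

namespace CurvatureFlow

/-! ### Taylor expansions with Peano remainder along a filter. -/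

section Peano

open Filter Asymptotics Topology

/-- Second order Taylor formula with Peano remainder on a convex set. -/
theorem taylor_two_isLittleO {E : Type*} [NormedAddCommGroup E] [NormedSpace ℝ E] {s : Set E}
    (hs : Convex ℝ s) {x₀ : E} (hx₀ : x₀ ∈ s) {f : E → ℝ} {f' : E → E →L[ℝ] ℝ}
    {f'' : E →L[ℝ] E →L[ℝ] ℝ} (hf : ∀ x ∈ s, HasFDerivWithinAt f (f' x) s x)
    (hf' : HasFDerivWithinAt f' f'' s x₀) (hsymm : ∀ v w, f'' v w = f'' w v) :
    (fun x => f x - (f x₀ + f' x₀ (x - x₀) + (1 / 2) * f'' (x - x₀) (x - x₀)))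
      =o[𝓝[s] x₀] fun x => ‖x - x₀‖ ^ 2 := by
  set g : E → ℝ := fun x => f x - (f x₀ + f' x₀ (x - x₀) + (1 / 2) * f'' (x - x₀) (x - x₀))
    with hg
  have hgd : ∀ x ∈ s, HasFDerivWithinAt g (f' x - f' x₀ - f'' (x - x₀)) s x := by
    intro x hx
    have h1 : HasFDerivWithinAt (fun y : E => y - x₀) (ContinuousLinearMap.id ℝ E) s x :=
      (hasFDerivWithinAt_id x s).sub_const x₀
    have h2 := (f' x₀).hasFDerivAt.comp_hasFDerivWithinAt x h1
    have h3 := f''.hasFDerivAt.comp_hasFDerivWithinAt x h1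
    have h4 := h3.clm_apply h1
    have h5 := (hf x hx).sub ((h2.const_add (f x₀)).add (h4.const_mul (1 / 2 : ℝ)))
    refine h5.congr_fderiv ?_
    ext v
    simp
    rw [← map_sub, hsymm v (x - x₀)]
    simp
    ring
  -- By differentiability of `f'` at `x₀`, the derivative of the remainder `g` is `o(‖x - x₀‖)`. The
  -- mean value inequality on `s` intersected with a ball gains one more power.
  have ho := hasFDerivWithinAt_iff_isLittleO.1 hf'
  rw [isLittleO_iff] at ho ⊢
  intro ε hε
  obtain ⟨δ, hδ, hb⟩ := Metric.eventually_nhds_iff_ball.1 (eventually_nhdsWithin_iff.1 (ho hε))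
  refine eventually_nhdsWithin_iff.2 (Metric.eventually_nhds_iff_ball.2 ⟨δ, hδ, fun x hx hxs => ?_⟩)
  have hconv : Convex ℝ (s ∩ Metric.closedBall x₀ ‖x - x₀‖) :=
    hs.inter (convex_closedBall _ _)
  have := hconv.norm_image_sub_le_of_norm_hasFDerivWithin_le (f := g)
    (f' := fun x => f' x - f' x₀ - f'' (x - x₀)) (C := ε * ‖x - x₀‖) (x := x₀) (y := x)
    (fun y hy => (hgd y hy.1).mono inter_subset_left) (fun y hy => ?_)
    ⟨hx₀, by simp⟩ ⟨hxs, by simp [dist_eq_norm]⟩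
  · have hg0 : g x₀ = 0 := by simp [hg]
    rw [hg0, sub_zero] at this
    rw [Real.norm_of_nonneg (by positivity : (0 : ℝ) ≤ ‖x - x₀‖ ^ 2)]
    calc ‖g x‖ ≤ _ := this
      _ = _ := by ring
  · have hy2 : ‖y - x₀‖ ≤ ‖x - x₀‖ := by simpa [dist_eq_norm] using hy.2
    refine (hb y ?_ hy.1).trans (by gcongr)
    simp only [Metric.mem_ball, dist_eq_norm] at hx ⊢
    exact hy2.trans_lt hx

/-- First order expansion `g x = g₀ + g₁ x + o(x)` along `l`. -/
def Peano1 (l : Filter ℝ) (g : ℝ → ℝ) (g₀ g₁ : ℝ) : Prop :=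
  ∃ ε : ℝ → ℝ, Tendsto ε l (𝓝 0) ∧ ∀ᶠ x in l, g x = g₀ + g₁ * x + ε x * x

/-- Second order expansion `g x = g₀ + g₁ x + g₂ x² / 2 + o(x²)` along `l`. -/
def Peano2 (l : Filter ℝ) (g : ℝ → ℝ) (g₀ g₁ g₂ : ℝ) : Prop :=
  ∃ ε : ℝ → ℝ, Tendsto ε l (𝓝 0) ∧ ∀ᶠ x in l, g x = g₀ + g₁ * x + g₂ / 2 * x ^ 2 + ε x * x ^ 2

variable {l : Filter ℝ} {g k : ℝ → ℝ} {g₀ g₁ g₂ k₀ k₁ k₂ : ℝ}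

theorem Peano1.mono {l' : Filter ℝ} (h : Peano1 l g g₀ g₁) (hl : l' ≤ l) : Peano1 l' g g₀ g₁ :=
  let ⟨ε, h1, h2⟩ := h; ⟨ε, h1.mono_left hl, hl h2⟩

theorem Peano2.mono {l' : Filter ℝ} (h : Peano2 l g g₀ g₁ g₂) (hl : l' ≤ l) :
    Peano2 l' g g₀ g₁ g₂ :=
  let ⟨ε, h1, h2⟩ := h; ⟨ε, h1.mono_left hl, hl h2⟩

theorem Peano1.congr (h : Peano1 l g g₀ g₁) (he : ∀ᶠ x in l, g x = k x) : Peano1 l k g₀ g₁ := by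
  obtain ⟨ε, h1, h2⟩ := h
  exact ⟨ε, h1, by filter_upwards [h2, he] with x a b; rw [← b, a]⟩

theorem Peano2.congr (h : Peano2 l g g₀ g₁ g₂) (he : ∀ᶠ x in l, g x = k x) :
    Peano2 l k g₀ g₁ g₂ := by
  obtain ⟨ε, h1, h2⟩ := h
  exact ⟨ε, h1, by filter_upwards [h2, he] with x a b; rw [← b, a]⟩

theorem Peano2.peano1 (hl : l ≤ 𝓝 0) (h : Peano2 l g g₀ g₁ g₂) : Peano1 l g g₀ g₁ := by
  obtain ⟨ε, h1, h2⟩ := h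
  have hx : Tendsto (fun x : ℝ => x) l (𝓝 0) := hl
  refine ⟨fun x => (g₂ / 2 + ε x) * x, ?_, by filter_upwards [h2] with x h; rw [h]; ring⟩
  simpa using (h1.const_add (g₂ / 2)).mul hx

theorem Peano1.tendsto (hl : l ≤ 𝓝 0) (h : Peano1 l g g₀ g₁) : Tendsto g l (𝓝 g₀) := by
  obtain ⟨ε, h1, h2⟩ := h
  have hx : Tendsto (fun x : ℝ => x) l (𝓝 0) := hl
  have : Tendsto (fun x => g₀ + g₁ * x + ε x * x) l (𝓝 (g₀ + g₁ * 0 + 0 * 0)) :=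
    ((hx.const_mul g₁).const_add g₀).add (h1.mul hx)
  simp only [mul_zero, add_zero] at this
  exact this.congr' (by filter_upwards [h2] with x h using h.symm)

theorem Peano1.add (hg : Peano1 l g g₀ g₁) (hk : Peano1 l k k₀ k₁) :
    Peano1 l (fun x => g x + k x) (g₀ + k₀) (g₁ + k₁) := by
  obtain ⟨ε, h1, h2⟩ := hg
  obtain ⟨η, h3, h4⟩ := hk
  exact ⟨fun x => ε x + η x, by simpa using h1.add h3,
    by filter_upwards [h2, h4] with x a b; rw [a, b]; ring⟩

theorem Peano1.const_mul (c : ℝ) (hg : Peano1 l g g₀ g₁) :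
    Peano1 l (fun x => c * g x) (c * g₀) (c * g₁) := by
  obtain ⟨ε, h1, h2⟩ := hg
  exact ⟨fun x => c * ε x, by simpa using h1.const_mul c,
    by filter_upwards [h2] with x a; rw [a]; ring⟩

theorem Peano1.mul (hl : l ≤ 𝓝 0) (hg : Peano1 l g g₀ g₁) (hk : Peano1 l k k₀ k₁) :
    Peano1 l (fun x => g x * k x) (g₀ * k₀) (g₁ * k₀ + g₀ * k₁) := by
  have hkt := hk.tendsto hl
  obtain ⟨ε, h1, h2⟩ := hg
  obtain ⟨η, h3, h4⟩ := hk
  have hx : Tendsto (fun x : ℝ => x) l (𝓝 0) := hl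
  refine ⟨fun x => g₁ * (k₁ + η x) * x + g₀ * η x + ε x * k x, ?_, ?_⟩
  · simpa using ((((h3.const_add k₁).const_mul g₁).mul hx).add (h3.const_mul g₀)).add (h1.mul hkt)
  · filter_upwards [h2, h4] with x a b
    rw [a, b]; ring

theorem Peano2.add (hg : Peano2 l g g₀ g₁ g₂) (hk : Peano2 l k k₀ k₁ k₂) :
    Peano2 l (fun x => g x + k x) (g₀ + k₀) (g₁ + k₁) (g₂ + k₂) := by
  obtain ⟨ε, h1, h2⟩ := hg
  obtain ⟨η, h3, h4⟩ := hk
  exact ⟨fun x => ε x + η x, by simpa using h1.add h3,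
    by filter_upwards [h2, h4] with x a b; rw [a, b]; ring⟩

theorem Peano2.const_mul (c : ℝ) (hg : Peano2 l g g₀ g₁ g₂) :
    Peano2 l (fun x => c * g x) (c * g₀) (c * g₁) (c * g₂) := by
  obtain ⟨ε, h1, h2⟩ := hg
  exact ⟨fun x => c * ε x, by simpa using h1.const_mul c,
    by filter_upwards [h2] with x a; rw [a]; ring⟩

theorem Peano2.const (l : Filter ℝ) (c : ℝ) : Peano2 l (fun _ => c) c 0 0 :=
  ⟨fun _ => 0, tendsto_const_nhds, by simp⟩

theorem Peano2.sub (hg : Peano2 l g g₀ g₁ g₂) (hk : Peano2 l k k₀ k₁ k₂) :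
    Peano2 l (fun x => g x - k x) (g₀ - k₀) (g₁ - k₁) (g₂ - k₂) := by
  simpa [sub_eq_add_neg] using hg.add (hk.const_mul (-1))

theorem Peano2.mul (hl : l ≤ 𝓝 0) (hg : Peano2 l g g₀ g₁ g₂) (hk : Peano2 l k k₀ k₁ k₂) :
    Peano2 l (fun x => g x * k x) (g₀ * k₀) (g₁ * k₀ + g₀ * k₁)
      (g₂ * k₀ + 2 * g₁ * k₁ + g₀ * k₂) := by
  have hkt := (hk.peano1 hl).tendsto hl
  obtain ⟨ε, h1, h2⟩ := hg
  obtain ⟨η, h3, h4⟩ := hk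
  have hx : Tendsto (fun x : ℝ => x) l (𝓝 0) := hl
  refine ⟨fun x => (g₁ * (k₂ / 2 + η x) + g₂ / 2 * (k₁ + k₂ / 2 * x + η x * x)) * x + g₀ * η x
    + ε x * k x, ?_, ?_⟩
  · have e1 : Tendsto (fun x => g₁ * (k₂ / 2 + η x) + g₂ / 2 * (k₁ + k₂ / 2 * x + η x * x)) l
        (𝓝 (g₁ * (k₂ / 2 + 0) + g₂ / 2 * (k₁ + k₂ / 2 * 0 + 0 * 0))) :=
      ((h3.const_add _).const_mul _).add
        ((((hx.const_mul _).const_add _).add (h3.mul hx)).const_mul _)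
    simpa using ((e1.mul hx).add (h3.const_mul g₀)).add (h1.mul hkt)
  · filter_upwards [h2, h4] with x a b
    rw [a, b]; ring

/-- At an umbilic point `|σ|` may have a corner along a line, so the two half-lines are expanded
separately; reflection turns the left one into a right one. -/
theorem Peano1.comp_neg (h : Peano1 (𝓝 0) g g₀ g₁) :
    Peano1 (𝓝[>] 0) (fun x => g (-x)) g₀ (-g₁) := by
  obtain ⟨ε, h1, h2⟩ := h
  have hx : Tendsto (fun x : ℝ => -x) (𝓝[>] 0) (𝓝 0) := by
    have := (continuous_neg (G := ℝ)).tendsto 0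
    rw [neg_zero] at this
    exact this.mono_left nhdsWithin_le_nhds
  refine ⟨fun x => -ε (-x), by simpa using (h1.comp hx).neg, ?_⟩
  filter_upwards [hx.eventually h2] with x h
  rw [h]; ring

theorem Peano2.comp_neg (h : Peano2 (𝓝 0) g g₀ g₁ g₂) :
    Peano2 (𝓝[>] 0) (fun x => g (-x)) g₀ (-g₁) g₂ := by
  obtain ⟨ε, h1, h2⟩ := h
  have hx : Tendsto (fun x : ℝ => -x) (𝓝[>] 0) (𝓝 0) := by
    have := (continuous_neg (G := ℝ)).tendsto 0
    rw [neg_zero] at this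
    exact this.mono_left nhdsWithin_le_nhds
  refine ⟨fun x => ε (-x), h1.comp hx, ?_⟩
  filter_upwards [hx.eventually h2] with x h
  rw [h]; ring

theorem nhdsGT_le_nhds_zero : 𝓝[>] (0 : ℝ) ≤ 𝓝 0 := nhdsWithin_le_nhds

theorem Peano1.slope_tendsto (h : Peano1 (𝓝[>] 0) g g₀ g₁) :
    Tendsto (fun x => (g x - g₀) / x) (𝓝[>] 0) (𝓝 g₁) := by
  obtain ⟨ε, h1, h2⟩ := h
  have : Tendsto (fun x => g₁ + ε x) (𝓝[>] 0) (𝓝 (g₁ + 0)) := h1.const_add g₁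
  rw [add_zero] at this
  refine this.congr' ?_
  filter_upwards [h2, self_mem_nhdsWithin] with x h hx
  have : x ≠ 0 := ne_of_gt hx
  rw [h]; field_simp; ring

theorem Peano1.of_slope_tendsto (h : Tendsto (fun x => (g x - g₀) / x) (𝓝[>] 0) (𝓝 g₁)) :
    Peano1 (𝓝[>] 0) g g₀ g₁ := by
  refine ⟨fun x => (g x - g₀) / x - g₁, by simpa using h.sub_const g₁, ?_⟩
  filter_upwards [self_mem_nhdsWithin] with x hx
  have : x ≠ 0 := ne_of_gt hx
  field_simp; ring

theorem Peano2.quotient_tendsto (h : Peano2 (𝓝[>] 0) g g₀ g₁ g₂) :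
    Tendsto (fun x => (g x - g₀ - g₁ * x) / x ^ 2) (𝓝[>] 0) (𝓝 (g₂ / 2)) := by
  obtain ⟨ε, h1, h2⟩ := h
  have : Tendsto (fun x => g₂ / 2 + ε x) (𝓝[>] 0) (𝓝 (g₂ / 2 + 0)) := h1.const_add _
  rw [add_zero] at this
  refine this.congr' ?_
  filter_upwards [h2, self_mem_nhdsWithin] with x h hx
  have : x ≠ 0 := ne_of_gt hx
  rw [h]; field_simp; ring

theorem Peano2.of_quotient_tendsto
    (h : Tendsto (fun x => (g x - g₀ - g₁ * x) / x ^ 2) (𝓝[>] 0) (𝓝 (g₂ / 2))) :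
    Peano2 (𝓝[>] 0) g g₀ g₁ g₂ := by
  refine ⟨fun x => (g x - g₀ - g₁ * x) / x ^ 2 - g₂ / 2, by simpa using h.sub_const (g₂ / 2), ?_⟩
  filter_upwards [self_mem_nhdsWithin] with x hx
  have : x ≠ 0 := ne_of_gt hx
  field_simp; ring

theorem Peano1.unique (h : Peano1 (𝓝[>] 0) g g₀ g₁) (h' : Peano1 (𝓝[>] 0) g g₀ k₁) : g₁ = k₁ :=
  tendsto_nhds_unique h.slope_tendsto h'.slope_tendsto

theorem Peano1.unique_zero (h : Peano1 (𝓝[>] 0) g g₀ g₁) (h' : Peano1 (𝓝[>] 0) g k₀ k₁) :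
    g₀ = k₀ :=
  tendsto_nhds_unique (h.tendsto nhdsGT_le_nhds_zero) (h'.tendsto nhdsGT_le_nhds_zero)

theorem Peano2.unique (h : Peano2 (𝓝[>] 0) g g₀ g₁ g₂) (h' : Peano2 (𝓝[>] 0) g k₀ k₁ k₂) :
    g₀ = k₀ ∧ g₁ = k₁ ∧ g₂ = k₂ := by
  have hl := nhdsGT_le_nhds_zero
  obtain rfl := (h.peano1 hl).unique_zero (h'.peano1 hl)
  obtain rfl := (h.peano1 hl).unique (h'.peano1 hl)
  refine ⟨rfl, rfl, ?_⟩
  linarith [tendsto_nhds_unique h.quotient_tendsto h'.quotient_tendsto]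

theorem Peano1.nonpos_of_le (h : Peano1 (𝓝[>] 0) g g₀ g₁) (hle : ∀ᶠ x in 𝓝[>] 0, g x ≤ g₀) :
    g₁ ≤ 0 := by
  refine le_of_tendsto h.slope_tendsto ?_
  filter_upwards [hle, self_mem_nhdsWithin] with x h hx
  exact div_nonpos_of_nonpos_of_nonneg (by linarith) (le_of_lt hx)

theorem Peano2.nonpos_of_le (h : Peano2 (𝓝[>] 0) g g₀ 0 g₂) (hle : ∀ᶠ x in 𝓝[>] 0, g x ≤ g₀) :
    g₂ ≤ 0 := by
  have : g₂ / 2 ≤ 0 := by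
    refine le_of_tendsto h.quotient_tendsto ?_
    filter_upwards [hle] with x h
    exact div_nonpos_of_nonpos_of_nonneg (by linarith) (sq_nonneg x)
  linarith

/-- The square root of a function with positive limit has a second order expansion. -/
theorem Peano2.sqrt {s : ℝ → ℝ} {s₀ s₁ s₂ : ℝ} (hl : l ≤ 𝓝 0) (hs₀ : 0 < s₀)
    (hs : ∀ᶠ x in l, 0 ≤ s x)
    (h : Peano2 l (fun x => s x ^ 2) (s₀ * s₀) (s₁ * s₀ + s₀ * s₁)
      (s₂ * s₀ + 2 * s₁ * s₁ + s₀ * s₂)) :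
    Peano2 l s s₀ s₁ s₂ := by
  have hx : Tendsto (fun x : ℝ => x) l (𝓝 0) := hl
  -- `P` is the expected expansion; the remainder is controlled through `s - P = (s² - P²) / (s +
  -- P)`, whose denominator tends to `2 s₀ > 0`.
  set P : ℝ → ℝ := fun x => s₀ + s₁ * x + s₂ / 2 * x ^ 2 with hP
  have hPt : Tendsto P l (𝓝 s₀) := by
    have : Tendsto P l (𝓝 (s₀ + s₁ * 0 + s₂ / 2 * 0 ^ 2)) :=
      ((hx.const_mul _).const_add _).add ((hx.pow 2).const_mul _)
    simpa using this
  have hst : Tendsto s l (𝓝 s₀) := by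
    have h1 := ((h.peano1 hl).tendsto hl).sqrt
    rw [Real.sqrt_mul_self hs₀.le] at h1
    refine h1.congr' ?_
    filter_upwards [hs] with x hx using Real.sqrt_sq hx
  obtain ⟨ε, h1, h2⟩ := h
  refine ⟨fun x => (ε x - s₁ * s₂ * x - s₂ ^ 2 / 4 * x ^ 2) / (s x + P x), ?_, ?_⟩
  · have e1 : Tendsto (fun x => ε x - s₁ * s₂ * x - s₂ ^ 2 / 4 * x ^ 2) l
        (𝓝 (0 - s₁ * s₂ * 0 - s₂ ^ 2 / 4 * 0 ^ 2)) :=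
      (h1.sub (hx.const_mul _)).sub ((hx.pow 2).const_mul _)
    have e2 := e1.div (hst.add hPt) (by positivity)
    rw [show (0 - s₁ * s₂ * 0 - s₂ ^ 2 / 4 * 0 ^ 2) / (s₀ + s₀) = (0 : ℝ) by ring] at e2
    exact e2
  · have hpos : ∀ᶠ x in l, 0 < P x := hPt.eventually (lt_mem_nhds hs₀)
    filter_upwards [hs, h2, hpos] with x a b c
    have : s x + P x ≠ 0 := by positivity
    field_simp
    simp only [hP] at c ⊢
    linear_combination 8 * b

theorem Peano2.of_hasDerivAt {g' : ℝ → ℝ} {g₂ : ℝ} (h : ∀ᶠ x in 𝓝 0, HasDerivAt g (g' x) x)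
    (h' : HasDerivAt g' g₂ 0) : Peano2 (𝓝 0) g (g 0) (g' 0) g₂ := by
  obtain ⟨δ, hδ, hb⟩ := Metric.eventually_nhds_iff_ball.1 h
  have key := taylor_two_isLittleO (convex_ball (0 : ℝ) δ) (Metric.mem_ball_self hδ)
    (f := g) (f' := fun x => g' x • ContinuousLinearMap.id ℝ ℝ)
    (f'' := ContinuousLinearMap.toSpanSingleton ℝ (g₂ • ContinuousLinearMap.id ℝ ℝ))
    (fun x hx => by
      refine (hb x hx).hasFDerivAt.hasFDerivWithinAt.congr_fderiv ?_
      ext; simp)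
    (HasDerivAt.smul_const h' (ContinuousLinearMap.id ℝ ℝ)).hasFDerivAt.hasFDerivWithinAt
    (by intro v w; simp; ring)
  rw [(Metric.isOpen_ball).nhdsWithin_eq (Metric.mem_ball_self hδ)] at key
  simp only [sub_zero, Real.norm_eq_abs, sq_abs] at key
  obtain ⟨ε, h1, h2⟩ := isLittleO_iff_exists_eq_mul.1 key
  refine ⟨ε, h1, ?_⟩
  filter_upwards [h2] with x hx
  simp at hx
  linarith

end Peano

/-! ### Calculus on the region `0 ≤ |σ| < ψ`, including its boundary. -/

section Region

open Filter Asymptotics Topology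

theorem convex_rocRegion : Convex ℝ rocRegion := by
  intro p hp q hq a b ha hb hab
  simp only [rocRegion, mem_ofPred_eq, Prod.smul_fst, Prod.smul_snd, Prod.fst_add, Prod.snd_add,
    smul_eq_mul] at *
  refine ⟨add_nonneg (mul_nonneg ha hp.1) (mul_nonneg hb hq.1), ?_⟩
  rcases ha.eq_or_lt with rfl | ha
  · have : b = 1 := by linarith
    subst this; linarith [hq.2]
  · nlinarith [mul_lt_mul_of_pos_left hp.2 ha, mul_le_mul_of_nonneg_left hq.2.le hb]

theorem isOpen_interior_part : IsOpen {q : ℝ × ℝ | 0 < q.2 ∧ q.2 < q.1} :=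
  (isOpen_lt continuous_const continuous_snd).inter (isOpen_lt continuous_snd continuous_fst)

theorem mem_interior_rocRegion {q : ℝ × ℝ} (h : 0 < q.2 ∧ q.2 < q.1) :
    q ∈ interior rocRegion :=
  mem_interior.2 ⟨_, fun _ hp => ⟨le_of_lt hp.1, hp.2⟩, isOpen_interior_part, h⟩

theorem interior_rocRegion_nonempty : (interior rocRegion).Nonempty :=
  ⟨(2, 1), mem_interior_rocRegion (by norm_num)⟩

theorem uniqueDiffOn_rocRegion : UniqueDiffOn ℝ rocRegion :=
  uniqueDiffOn_convex convex_rocRegion interior_rocRegion_nonempty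

/-- This is what makes one-sided second derivatives symmetric on the boundary `|σ| = 0`. -/
theorem rocRegion_subset_closure_interior : rocRegion ⊆ closure (interior rocRegion) := by
  rw [convex_rocRegion.closure_interior_eq_closure_of_nonempty_interior interior_rocRegion_nonempty]
  exact subset_closure

theorem fderivWithin_apply_eq (F : ℝ × ℝ → ℝ) (q : ℝ × ℝ) (v : ℝ × ℝ) :
    fderivWithin ℝ F rocRegion q v = d10 F q * v.1 + d01 F q * v.2 := by
  have : v = v.1 • ((1, 0) : ℝ × ℝ) + v.2 • ((0, 1) : ℝ × ℝ) := by ext <;> simp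
  conv_lhs => rw [this]
  rw [map_add, map_smul, map_smul, smul_eq_mul, smul_eq_mul, d10, d01]
  ring

theorem contDiffOn_fderivWithin_apply {F : ℝ × ℝ → ℝ} (hF : ContDiffOn ℝ 2 F rocRegion) (v : ℝ × ℝ) :
    ContDiffOn ℝ 1 (fun q => fderivWithin ℝ F rocRegion q v) rocRegion :=
  (hF.fderivWithin uniqueDiffOn_rocRegion (by norm_num)).clm_apply contDiffOn_const

theorem contDiffOn_d10 {F : ℝ × ℝ → ℝ} (hF : ContDiffOn ℝ 2 F rocRegion) :
    ContDiffOn ℝ 1 (d10 F) rocRegion := contDiffOn_fderivWithin_apply hF _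

theorem contDiffOn_d01 {F : ℝ × ℝ → ℝ} (hF : ContDiffOn ℝ 2 F rocRegion) :
    ContDiffOn ℝ 1 (d01 F) rocRegion := contDiffOn_fderivWithin_apply hF _

theorem continuousOn_d_of_contDiffOn_one {F : ℝ × ℝ → ℝ} (hF : ContDiffOn ℝ 1 F rocRegion) :
    ContinuousOn (d10 F) rocRegion ∧ ContinuousOn (d01 F) rocRegion :=
  ⟨(hF.continuousOn_fderivWithin uniqueDiffOn_rocRegion le_rfl).clm_apply continuousOn_const,
    (hF.continuousOn_fderivWithin uniqueDiffOn_rocRegion le_rfl).clm_apply continuousOn_const⟩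

theorem fderivWithin_fderivWithin_apply {F : ℝ × ℝ → ℝ} (hF : ContDiffOn ℝ 2 F rocRegion)
    {q : ℝ × ℝ} (hq : q ∈ rocRegion) (v w : ℝ × ℝ) :
    fderivWithin ℝ (fderivWithin ℝ F rocRegion) rocRegion q v w
      = fderivWithin ℝ (fun p => fderivWithin ℝ F rocRegion p w) rocRegion q v := by
  have h := ((hF.fderivWithin (m := 1) uniqueDiffOn_rocRegion (by norm_num)).differentiableOn
    one_ne_zero) q hq
  have h2 := h.hasFDerivWithinAt.clm_apply
    (hasFDerivWithinAt_const (𝕜 := ℝ) w q rocRegion)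
  rw [h2.fderivWithin (uniqueDiffOn_rocRegion q hq)]
  simp

theorem hess_symm {F : ℝ × ℝ → ℝ} (hF : ContDiffOn ℝ 2 F rocRegion)
    {q : ℝ × ℝ} (hq : q ∈ rocRegion) (v w : ℝ × ℝ) :
    fderivWithin ℝ (fderivWithin ℝ F rocRegion) rocRegion q v w
      = fderivWithin ℝ (fderivWithin ℝ F rocRegion) rocRegion q w v :=
  (hF q hq).isSymmSndFDerivWithinAt (by simp) uniqueDiffOn_rocRegion
    (rocRegion_subset_closure_interior hq) hq v w

theorem hess_apply {F : ℝ × ℝ → ℝ} (hF : ContDiffOn ℝ 2 F rocRegion)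
    {q : ℝ × ℝ} (hq : q ∈ rocRegion) (v : ℝ × ℝ) :
    fderivWithin ℝ (fderivWithin ℝ F rocRegion) rocRegion q v v
      = d20 F q * v.1 ^ 2 + 2 * d11 F q * v.1 * v.2 + d02 F q * v.2 ^ 2 := by
  have hv : v = v.1 • ((1, 0) : ℝ × ℝ) + v.2 • ((0, 1) : ℝ × ℝ) := by ext <;> simp
  have h1 : d20 F q = fderivWithin ℝ (fderivWithin ℝ F rocRegion) rocRegion q (1, 0) (1, 0) :=
    (fderivWithin_fderivWithin_apply hF hq _ _).symm
  have h2 : d11 F q = fderivWithin ℝ (fderivWithin ℝ F rocRegion) rocRegion q (1, 0) (0, 1) :=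
    (fderivWithin_fderivWithin_apply hF hq _ _).symm
  have h3 : d02 F q = fderivWithin ℝ (fderivWithin ℝ F rocRegion) rocRegion q (0, 1) (0, 1) :=
    (fderivWithin_fderivWithin_apply hF hq _ _).symm
  rw [h1, h2, h3]
  conv_lhs => rw [hv]
  simp only [map_add, map_smul, add_apply, smul_apply,
    smul_eq_mul, hess_symm hF hq (0, 1) (1, 0)]
  ring

theorem taylor_rocRegion {F : ℝ × ℝ → ℝ} (hF : ContDiffOn ℝ 2 F rocRegion)
    {q₀ : ℝ × ℝ} (hq : q₀ ∈ rocRegion) :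
    (fun q : ℝ × ℝ => F q - (F q₀ + (d10 F q₀ * (q.1 - q₀.1) + d01 F q₀ * (q.2 - q₀.2))
      + (1 / 2) * (d20 F q₀ * (q.1 - q₀.1) ^ 2 + 2 * d11 F q₀ * (q.1 - q₀.1) * (q.2 - q₀.2)
        + d02 F q₀ * (q.2 - q₀.2) ^ 2)))
      =o[𝓝[rocRegion] q₀] fun q => ‖q - q₀‖ ^ 2 := by
  have h1 := taylor_two_isLittleO convex_rocRegion hq (f := F)
    (f' := fderivWithin ℝ F rocRegion)
    (f'' := fderivWithin ℝ (fderivWithin ℝ F rocRegion) rocRegion q₀)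
    (fun x hx => (hF.differentiableOn two_ne_zero x hx).hasFDerivWithinAt)
    (((hF.fderivWithin (m := 1) uniqueDiffOn_rocRegion (by norm_num)).differentiableOn
      one_ne_zero) q₀ hq).hasFDerivWithinAt (hess_symm hF hq)
  simpa only [fderivWithin_apply_eq F, hess_apply hF hq, Prod.fst_sub, Prod.snd_sub] using h1

variable {l : Filter ℝ} {ψ s : ℝ → ℝ} {ψ₀ ψ₁ ψ₂ s₀ s₁ s₂ : ℝ}

theorem tendsto_roc (hl : l ≤ 𝓝 0) (hψ : Peano1 l ψ ψ₀ ψ₁) (hs : Peano1 l s s₀ s₁)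
    (hR : ∀ᶠ x in l, (ψ x, s x) ∈ rocRegion) :
    Tendsto (fun x => (ψ x, s x)) l (𝓝[rocRegion] (ψ₀, s₀)) :=
  tendsto_nhdsWithin_iff.2 ⟨(hψ.tendsto hl).prodMk_nhds (hs.tendsto hl), hR⟩

theorem Peano1.isBigO (hψ : Peano1 l ψ ψ₀ ψ₁) :
    (fun x => ψ x - ψ₀) =O[l] fun x => x := by
  obtain ⟨ε, h1, h2⟩ := hψ
  have h3 : Tendsto (fun x => ψ₁ + ε x) l (𝓝 (ψ₁ + 0)) := h1.const_add _
  have := (h3.isBigO_one ℝ).mul (isBigO_refl (fun x : ℝ => x) l)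
  simp only [one_mul] at this
  refine this.congr' ?_ EventuallyEq.rfl
  filter_upwards [h2] with x hx
  rw [hx]; ring

theorem isBigO_roc (hψ : Peano1 l ψ ψ₀ ψ₁) (hs : Peano1 l s s₀ s₁) :
    (fun x => ((ψ x, s x) : ℝ × ℝ) - (ψ₀, s₀)) =O[l] fun x => x :=
  (hψ.isBigO).prod_left (hs.isBigO)

/-- First order chain rule along a curve in radii of curvature space. -/
theorem Peano1.comp_roc (hl : l ≤ 𝓝 0) {F : ℝ × ℝ → ℝ} (hF : ContDiffOn ℝ 1 F rocRegion)
    (hq : (ψ₀, s₀) ∈ rocRegion) (hψ : Peano1 l ψ ψ₀ ψ₁) (hs : Peano1 l s s₀ s₁)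
    (hR : ∀ᶠ x in l, (ψ x, s x) ∈ rocRegion) :
    Peano1 l (fun x => F (ψ x, s x)) (F (ψ₀, s₀))
      (d10 F (ψ₀, s₀) * ψ₁ + d01 F (ψ₀, s₀) * s₁) := by
  have h1 := hasFDerivWithinAt_iff_isLittleO.1
    (hF.differentiableOn one_ne_zero _ hq).hasFDerivWithinAt
  have h2 := (h1.comp_tendsto (tendsto_roc hl hψ hs hR)).trans_isBigO (isBigO_roc hψ hs)
  obtain ⟨η, h3, h4⟩ := isLittleO_iff_exists_eq_mul.1 h2
  obtain ⟨ε, e1, e2⟩ := hψ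
  obtain ⟨δ, e3, e4⟩ := hs
  refine ⟨fun x => η x + d10 F (ψ₀, s₀) * ε x + d01 F (ψ₀, s₀) * δ x, ?_, ?_⟩
  · simpa using (h3.add (e1.const_mul _)).add (e3.const_mul _)
  · filter_upwards [h4, e2, e4] with x a b c
    simp only [Function.comp_apply, fderivWithin_apply_eq, Pi.mul_apply, Prod.fst_sub,
      Prod.snd_sub] at a
    rw [eq_add_of_sub_eq (eq_add_of_sub_eq a), b, c]
    ring

/-- Second order Taylor expansion along a curve in radii of curvature space. -/
theorem taylor_along (hl : l ≤ 𝓝 0) {F : ℝ × ℝ → ℝ} (hF : ContDiffOn ℝ 2 F rocRegion)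
    (hq : (ψ₀, s₀) ∈ rocRegion) (hψ : Peano1 l ψ ψ₀ ψ₁) (hs : Peano1 l s s₀ s₁)
    (hR : ∀ᶠ x in l, (ψ x, s x) ∈ rocRegion) :
    ∃ η : ℝ → ℝ, Tendsto η l (𝓝 0) ∧ ∀ᶠ x in l, F (ψ x, s x) = F (ψ₀, s₀)
      + d10 F (ψ₀, s₀) * (ψ x - ψ₀) + d01 F (ψ₀, s₀) * (s x - s₀)
      + 1 / 2 * (d20 F (ψ₀, s₀) * (ψ x - ψ₀) ^ 2 + 2 * d11 F (ψ₀, s₀) * (ψ x - ψ₀) * (s x - s₀)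
        + d02 F (ψ₀, s₀) * (s x - s₀) ^ 2) + η x * x ^ 2 := by
  have h2 := ((taylor_rocRegion hF hq).comp_tendsto (tendsto_roc hl hψ hs hR)).trans_isBigO
    ((isBigO_roc hψ hs).norm_left.pow 2)
  obtain ⟨η, h3, h4⟩ := isLittleO_iff_exists_eq_mul.1 h2
  refine ⟨η, h3, ?_⟩
  filter_upwards [h4] with x a
  simp only [Function.comp_apply, Pi.mul_apply] at a
  linear_combination a

theorem Peano2.comp_roc (hl : l ≤ 𝓝 0) {F : ℝ × ℝ → ℝ} (hF : ContDiffOn ℝ 2 F rocRegion)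
    (hq : (ψ₀, s₀) ∈ rocRegion) (hψ : Peano2 l ψ ψ₀ ψ₁ ψ₂) (hs : Peano2 l s s₀ s₁ s₂)
    (hR : ∀ᶠ x in l, (ψ x, s x) ∈ rocRegion) :
    Peano2 l (fun x => F (ψ x, s x)) (F (ψ₀, s₀))
      (d10 F (ψ₀, s₀) * ψ₁ + d01 F (ψ₀, s₀) * s₁)
      (d10 F (ψ₀, s₀) * ψ₂ + d01 F (ψ₀, s₀) * s₂ + (d20 F (ψ₀, s₀) * ψ₁ ^ 2
        + 2 * d11 F (ψ₀, s₀) * ψ₁ * s₁ + d02 F (ψ₀, s₀) * s₁ ^ 2)) := by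
  obtain ⟨η, h1, h2⟩ := taylor_along hl hF hq (hψ.peano1 hl) (hs.peano1 hl) hR
  have hδ := hψ.sub (Peano2.const l ψ₀)
  have hσ := hs.sub (Peano2.const l s₀)
  have hη : Peano2 l (fun x => η x * x ^ 2) 0 0 0 := ⟨η, h1, by simp⟩
  have key := (((((Peano2.const l (F (ψ₀, s₀))).add (hδ.const_mul (d10 F (ψ₀, s₀)))).add
    (hσ.const_mul (d01 F (ψ₀, s₀)))).add (((((hδ.mul hl hδ).const_mul (d20 F (ψ₀, s₀))).add
    ((hδ.mul hl hσ).const_mul (2 * d11 F (ψ₀, s₀)))).add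
    ((hσ.mul hl hσ).const_mul (d02 F (ψ₀, s₀)))).const_mul (1 / 2))).add hη)
  have key2 := key.congr (k := fun x => F (ψ x, s x)) (by
    filter_upwards [h2] with x hx
    rw [hx]; ring)
  convert key2 using 1 <;> ring

/-- Second order expansion when the transverse derivative vanishes. -/
theorem Peano2.comp_roc_of_d01_eq_zero (hl : l ≤ 𝓝 0) {F : ℝ × ℝ → ℝ}
    (hF : ContDiffOn ℝ 2 F rocRegion) (hq : (ψ₀, s₀) ∈ rocRegion) (h0 : d01 F (ψ₀, s₀) = 0)
    (hψ : Peano2 l ψ ψ₀ 0 ψ₂) (hs : Peano1 l s s₀ s₁)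
    (hR : ∀ᶠ x in l, (ψ x, s x) ∈ rocRegion) :
    Peano2 l (fun x => F (ψ x, s x)) (F (ψ₀, s₀)) 0
      (d10 F (ψ₀, s₀) * ψ₂ + d02 F (ψ₀, s₀) * s₁ ^ 2) := by
  -- Since `F₀₁ = 0` and `ψ - ψ₀ = O(x²)`, only `F₁₀ (ψ - ψ₀)` and `F₀₂ (s - s₀)²` contribute at
  -- order `x²`; hence a first order expansion of `s` is enough.
  obtain ⟨η, h1, h2⟩ := taylor_along hl hF hq (hψ.peano1 hl) hs hR
  obtain ⟨ε, h3, h4⟩ := hψ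
  obtain ⟨δ, h5, h6⟩ := hs
  have hx : Tendsto (fun x : ℝ => x) l (𝓝 0) := hl
  have hA : Tendsto (fun x => (ψ₂ / 2 + ε x) * x) l (𝓝 0) := by
    simpa using (h3.const_add (ψ₂ / 2)).mul hx
  have hB : Tendsto (fun x => s₁ + δ x) l (𝓝 s₁) := by simpa using h5.const_add s₁
  refine ⟨fun x => η x + d10 F (ψ₀, s₀) * ε x + 1 / 2 * (d20 F (ψ₀, s₀) * ((ψ₂ / 2 + ε x) * x) ^ 2
    + 2 * d11 F (ψ₀, s₀) * (((ψ₂ / 2 + ε x) * x) * (s₁ + δ x))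
    + d02 F (ψ₀, s₀) * (2 * s₁ * δ x + δ x * δ x)), ?_, ?_⟩
  · have := (h1.add (h3.const_mul (d10 F (ψ₀, s₀)))).add
      (((((hA.pow 2).const_mul (d20 F (ψ₀, s₀))).add
      ((hA.mul hB).const_mul (2 * d11 F (ψ₀, s₀)))).add
      (((h5.const_mul (2 * s₁)).add (h5.mul h5)).const_mul (d02 F (ψ₀, s₀)))).const_mul (1 / 2))
    simpa using this
  · filter_upwards [h2, h4, h6] with x a b c
    rw [a, b, c, h0]; ring

end Region

/-! ### The algebraic identities behind the sign of the evolution. -/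

section Algebra

/-- The left side of the conclusion is the time derivative of `H` once `K` has been differentiated
along both axes, and `hC` is the relation coming from `h_uuvv = h_vvuu`. The first order conditions
make the derivatives of `(ψ, |σ|)` along the axes multiples of `(-H₀₁, H₁₀)`, which turns the
quadratic terms into `Hess_H(dH)` and `Hess_K(dH)`. -/
theorem evolution_nonpos_of_nonumbilic {H10 H01 H20 H11 H02 K10 K01 K20 K11 K02 K0 s ψx ψy sx sy
    ψxx ψyy sxx syy : ℝ} (hs : 0 < s) (hpar : |K01| < -K10)
    (hx : H10 * ψx + H01 * sx = 0) (hy : H10 * ψy + H01 * sy = 0)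
    (hxx : H10 * ψxx + H01 * sxx + (H20 * ψx ^ 2 + 2 * H11 * ψx * sx + H02 * sx ^ 2) ≤ 0)
    (hyy : H10 * ψyy + H01 * syy + (H20 * ψy ^ 2 + 2 * H11 * ψy * sy + H02 * sy ^ 2) ≤ 0)
    (hC : ψxx - ψyy - sxx - syy = -2 * s - ((ψy + sy) ^ 2 + (ψx - sx) ^ 2) / s)
    (hI : 0 ≤ H10 * (K0 + s * K01) - H01 * (s * K10))
    (hAB : |-2 * H10 * H01 * (H10 * K01 - H01 * K10)
        + s * (K01 * (H20 * H01 ^ 2 - 2 * H11 * H01 * H10 + H02 * H10 ^ 2)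
          - H01 * (K20 * H01 ^ 2 - 2 * K11 * H01 * H10 + K02 * H10 ^ 2))|
      ≤ (H10 ^ 2 + H01 ^ 2) * (H10 * K01 - H01 * K10)
        - s * (K10 * (H20 * H01 ^ 2 - 2 * H11 * H01 * H10 + H02 * H10 ^ 2)
          - H10 * (K20 * H01 ^ 2 - 2 * K11 * H01 * H10 + K02 * H10 ^ 2))) :
    H10 * (-((K10 * ψxx + K01 * sxx + (K20 * ψx ^ 2 + 2 * K11 * ψx * sx + K02 * sx ^ 2))
        + (K10 * ψyy + K01 * syy + (K20 * ψy ^ 2 + 2 * K11 * ψy * sy + K02 * sy ^ 2))) / 2 - K0)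
      + H01 * (-((K10 * ψxx + K01 * sxx + (K20 * ψx ^ 2 + 2 * K11 * ψx * sx + K02 * sx ^ 2))
        - (K10 * ψyy + K01 * syy + (K20 * ψy ^ 2 + 2 * K11 * ψy * sy + K02 * sy ^ 2))) / 2) ≤ 0 := by
  by_cases h0 : H10 ^ 2 + H01 ^ 2 = 0
  · have e1 : H10 = 0 := by nlinarith [sq_nonneg H10, sq_nonneg H01]
    have e2 : H01 = 0 := by nlinarith [sq_nonneg H10, sq_nonneg H01]
    simp [e1, e2]
  have hN : 0 < H10 ^ 2 + H01 ^ 2 := lt_of_le_of_ne (by positivity) (Ne.symm h0)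
  obtain ⟨u, hu1, hu2⟩ : ∃ u, ψx = -(u * H01) ∧ sx = u * H10 :=
    ⟨(H10 * sx - H01 * ψx) / (H10 ^ 2 + H01 ^ 2), by field_simp; linear_combination H10 * hx,
      by field_simp; linear_combination H01 * hx⟩
  obtain ⟨v, hv1, hv2⟩ : ∃ v, ψy = -(v * H01) ∧ sy = v * H10 :=
    ⟨(H10 * sy - H01 * ψy) / (H10 ^ 2 + H01 ^ 2), by field_simp; linear_combination H10 * hy,
      by field_simp; linear_combination H01 * hy⟩
  have hψ : ψxx = ψyy + sxx + syy - 2 * s - ((ψy + sy) ^ 2 + (ψx - sx) ^ 2) / s := by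
    linear_combination hC
  subst hu1 hu2 hv1 hv2 hψ
  obtain ⟨hA1, hA2⟩ := abs_le.1 hAB
  obtain ⟨hp1, hp2⟩ := abs_lt.1 hpar
  -- Minus the evolution is exactly the sum of `t1`, `t2`, `t3`, `t4` and `{H, I}`: parabolicity
  -- weights the two second order conditions, while `A - B` and `A + B` absorb the terms in `u²` and
  -- `v²`.
  have t1 := mul_nonneg (show 0 ≤ -(K10 + K01) / 2 by linarith) (neg_nonneg.2 hxx)
  have t2 := mul_nonneg (show 0 ≤ -(K10 - K01) / 2 by linarith) (neg_nonneg.2 hyy)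
  have t3 := mul_nonneg (show 0 ≤ u ^ 2 / (2 * s) by positivity) (sub_nonneg.2 hA2)
  have t4 := mul_nonneg (show 0 ≤ v ^ 2 / (2 * s) by positivity)
    (show 0 ≤ _ - _ from sub_nonneg.2 hA1)
  have key := add_nonneg (add_nonneg (add_nonneg (add_nonneg t1 t2) t3) t4) hI
  rw [← neg_nonneg]
  refine key.trans (le_of_eq ?_)
  field_simp
  ring

/-- The analogue when the first derivatives vanish: the fourth derivative relation is now the
inequality `hC`, and its defect is multiplied by `{H, K} ≥ 0`. The sign of the absolute value
decides which axis gets which of the weights `-(K₁₀ ± K₀₁) / 2`. -/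
theorem evolution_nonpos_of_umbilic {H10 H01 K10 K01 K0 ψxx ψyy sxx syy : ℝ}
    (hpar : |K01| < -K10) (hxx : H10 * ψxx + H01 * sxx ≤ 0) (hyy : H10 * ψyy + H01 * syy ≤ 0)
    (hC : |ψxx - ψyy| ≤ sxx + syy) (hI : 0 ≤ H10 * K0) (hP : 0 ≤ H10 * K01 - H01 * K10) :
    H10 * (-((K10 * ψxx + K01 * sxx) + (K10 * ψyy + K01 * syy)) / 2 - K0)
      - H01 * |(K10 * ψxx + K01 * sxx) - (K10 * ψyy + K01 * syy)| / 2 ≤ 0 := by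
  obtain ⟨hp1, hp2⟩ := abs_lt.1 hpar
  obtain ⟨hC1, hC2⟩ := abs_le.1 hC
  have t1 := mul_nonneg (show 0 ≤ -(K10 + K01) / 2 by linarith) (neg_nonneg.2 hxx)
  have t2 := mul_nonneg (show 0 ≤ -(K10 - K01) / 2 by linarith) (neg_nonneg.2 hyy)
  have t3 := mul_nonneg (show 0 ≤ -(K10 + K01) / 2 by linarith) (neg_nonneg.2 hyy)
  have t4 := mul_nonneg (show 0 ≤ -(K10 - K01) / 2 by linarith) (neg_nonneg.2 hxx)
  have t5 := mul_nonneg hP (show 0 ≤ sxx + syy - (ψxx - ψyy) by linarith)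
  have t6 := mul_nonneg hP (show 0 ≤ sxx + syy + (ψxx - ψyy) by linarith)
  rcases abs_cases ((K10 * ψxx + K01 * sxx) - (K10 * ψyy + K01 * syy)) with ⟨h, -⟩ | ⟨h, -⟩
  · rw [h]; linarith
  · rw [h]; linarith

end Algebra

/-! ### Expansions of `ψ` and `|σ|` along a gnomonic line. -/

section Axis

open Filter Asymptotics Topology

/-- Mean radius of curvature along a line of the gnomonic parametrization, in terms of the
Hessian entries `a`, `c` of the support function. -/
noncomputable def axisPsi (a c : ℝ → ℝ) (x : ℝ) : ℝ := √(1 + x ^ 2) / 2 * ((1 + x ^ 2) * a x + c x)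

/-- Half the difference of the radii of curvature along a line of the gnomonic parametrization. -/
noncomputable def axisSigma (a b c : ℝ → ℝ) (x : ℝ) : ℝ :=
  √(1 + x ^ 2) / 2 * √(((1 + x ^ 2) * a x - c x) ^ 2 + 4 * (1 + x ^ 2) * b x ^ 2)

noncomputable def axisRoc (a b c : ℝ → ℝ) (x : ℝ) : ℝ × ℝ := (axisPsi a c x, axisSigma a b c x)

variable {l : Filter ℝ} {a b c w : ℝ → ℝ} {a₀ a₁ a₂ b₀ b₁ b₂ c₀ c₁ c₂ w₀ w₁ w₂ : ℝ}

theorem peano2_one_add_sq : Peano2 l (fun x => 1 + x ^ 2) 1 0 2 :=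
  ⟨fun _ => 0, tendsto_const_nhds, by filter_upwards with x; ring⟩

theorem peano2_sqrt_one_add_sq (hl : l ≤ 𝓝 0) : Peano2 l (fun x => √(1 + x ^ 2)) 1 0 1 := by
  refine Peano2.sqrt hl one_pos (by filter_upwards with x using Real.sqrt_nonneg _) ?_
  have := (peano2_one_add_sq (l := l)).congr (k := fun x => √(1 + x ^ 2) ^ 2)
    (by filter_upwards with x; rw [Real.sq_sqrt (by positivity)])
  convert this using 1 <;> norm_num

theorem Peano2.axisPsi (hl : l ≤ 𝓝 0) (ha : Peano2 l a a₀ a₁ a₂) (hc : Peano2 l c c₀ c₁ c₂) :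
    Peano2 l (axisPsi a c) ((a₀ + c₀) / 2) ((a₁ + c₁) / 2)
      ((a₂ + c₂) / 2 + (3 * a₀ + c₀) / 2) := by
  have := ((peano2_sqrt_one_add_sq hl).const_mul (1 / 2)).mul hl
    ((peano2_one_add_sq.mul hl ha).add hc)
  have h2 := this.congr (k := CurvatureFlow.axisPsi a c)
    (by filter_upwards with x; rw [CurvatureFlow.axisPsi]; ring)
  convert h2 using 1 <;> ring

theorem axisSigma_nonneg (x : ℝ) : 0 ≤ axisSigma a b c x :=
  mul_nonneg (by positivity) (Real.sqrt_nonneg _)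

theorem axisSigma_sq (x : ℝ) : axisSigma a b c x ^ 2
    = 1 / 4 * ((1 + x ^ 2) * (((1 + x ^ 2) * a x - c x) * ((1 + x ^ 2) * a x - c x)
      + 4 * ((1 + x ^ 2) * (b x * b x)))) := by
  rw [axisSigma, mul_pow, div_pow, Real.sq_sqrt (by positivity), Real.sq_sqrt (by positivity)]
  ring

/-- The sign `τ` lets one lemma serve both axes, on which `a` and `c` exchange roles as the larger
and the smaller entry. -/
theorem Peano2.axisSigma_of_nonumbilic (hl : l ≤ 𝓝 0) (ha : Peano2 l a a₀ a₁ a₂)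
    (hb : Peano2 l b 0 b₁ b₂) (hc : Peano2 l c c₀ c₁ c₂) {τ : ℝ} (hτ : τ ^ 2 = 1)
    (hpos : 0 < τ * (a₀ - c₀)) :
    Peano2 l (axisSigma a b c) (τ * ((a₀ - c₀) / 2)) (τ * ((a₁ - c₁) / 2))
      (τ * ((a₂ - c₂) / 2 + (3 * a₀ - c₀) / 2 + 2 * b₁ ^ 2 / (a₀ - c₀))) := by
  have hne : a₀ - c₀ ≠ 0 := by rintro h; simp [h] at hpos
  refine Peano2.sqrt hl (by linarith) (by filter_upwards with x using axisSigma_nonneg x) ?_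
  have hρ := peano2_one_add_sq (l := l)
  have hd := (hρ.mul hl ha).sub hc
  have := (hρ.mul hl ((hd.mul hl hd).add ((hρ.mul hl (hb.mul hl hb)).const_mul 4))).const_mul (1 / 4)
  have h2 := this.congr (k := fun x => axisSigma a b c x ^ 2)
    (by filter_upwards with x; rw [axisSigma_sq])
  convert h2 using 1
  · linear_combination (a₀ - c₀) ^ 2 / 4 * hτ
  · linear_combination (a₁ - c₁) * (a₀ - c₀) / 2 * hτ
  · field_simp
    linear_combination (((a₂ - c₂) + (3 * a₀ - c₀)) * (a₀ - c₀) + 4 * b₁ ^ 2 + (a₁ - c₁) ^ 2) * 8 * hτ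

theorem sqrt_mul_eq_sqrt_mul_sq {u y : ℝ} (hy : 0 ≤ y) : √u * y = √(u * y ^ 2) := by
  rw [Real.sqrt_mul' _ (sq_nonneg y), Real.sqrt_sq hy]

/-- The radicand is `x²` times a function with a limit, so `|σ|` leaves zero with a one-sided slope.
-/
theorem Peano1.axisSigma_of_umbilic (ha : Peano1 (𝓝[>] 0) a a₀ a₁)
    (hb : Peano1 (𝓝[>] 0) b 0 b₁) (hc : Peano1 (𝓝[>] 0) c a₀ c₁) :
    Peano1 (𝓝[>] 0) (axisSigma a b c) 0 (√((a₁ - c₁) ^ 2 + 4 * b₁ ^ 2) / 2) := by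
  have hx : Tendsto (fun x : ℝ => x) (𝓝[>] 0) (𝓝 0) := nhdsGT_le_nhds_zero
  have hat := ha.tendsto nhdsGT_le_nhds_zero
  refine Peano1.of_slope_tendsto ?_
  have h1 : Tendsto (fun x => (a x - a₀) / x - (c x - a₀) / x + x * a x) (𝓝[>] 0)
      (𝓝 (a₁ - c₁ + 0 * a₀)) := (ha.slope_tendsto.sub hc.slope_tendsto).add (hx.mul hat)
  have h2 : Tendsto (fun x : ℝ => 1 + x ^ 2) (𝓝[>] 0) (𝓝 (1 + 0 ^ 2)) := (hx.pow 2).const_add 1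
  have h3 := (h2.sqrt.div_const 2).mul (((h1.pow 2).add
    ((h2.const_mul 4).mul (hb.slope_tendsto.pow 2))).sqrt)
  convert h3.congr' ?_ using 2
  · norm_num; ring
  · filter_upwards [self_mem_nhdsWithin] with x hx
    have hx' : (0 : ℝ) < x := hx
    simp only [axisSigma, sub_zero]
    rw [mul_div_assoc]
    congr 1
    rw [eq_div_iff hx'.ne', sqrt_mul_eq_sqrt_mul_sq hx'.le]
    congr 1
    field_simp
    ring

/-- Here the radicand is `x⁴` times a function with a limit; the term `2 a₀` comes from the factor
`1 + x²` in front of `a`. -/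
theorem Peano2.axisSigma_of_umbilic (ha : Peano2 (𝓝[>] 0) a a₀ a₁ a₂)
    (hb : Peano2 (𝓝[>] 0) b 0 0 b₂) (hc : Peano2 (𝓝[>] 0) c a₀ a₁ c₂) :
    Peano2 (𝓝[>] 0) (axisSigma a b c) 0 0 (√((a₂ - c₂ + 2 * a₀) ^ 2 + 4 * b₂ ^ 2) / 2) := by
  have hx : Tendsto (fun x : ℝ => x) (𝓝[>] 0) (𝓝 0) := nhdsGT_le_nhds_zero
  have hat := (ha.peano1 nhdsGT_le_nhds_zero).tendsto nhdsGT_le_nhds_zero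
  refine Peano2.of_quotient_tendsto ?_
  have h1 := ((ha.quotient_tendsto.sub hc.quotient_tendsto).add hat)
  have h2 : Tendsto (fun x : ℝ => 1 + x ^ 2) (𝓝[>] 0) (𝓝 (1 + 0 ^ 2)) := (hx.pow 2).const_add 1
  have h3 := (h2.sqrt.div_const 2).mul (((h1.pow 2).add
    ((h2.const_mul 4).mul (hb.quotient_tendsto.pow 2))).sqrt)
  convert h3.congr' ?_ using 2
  · have : (a₂ / 2 - c₂ / 2 + a₀) ^ 2 + 4 * (1 + 0 ^ 2) * (b₂ / 2) ^ 2
      = ((a₂ - c₂ + 2 * a₀) ^ 2 + 4 * b₂ ^ 2) / 2 ^ 2 := by ring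
    rw [this, Real.sqrt_div (by positivity), Real.sqrt_sq (by norm_num)]
    norm_num; ring
  · filter_upwards [self_mem_nhdsWithin] with x hx
    have hx' : (0 : ℝ) < x := hx
    simp only [axisSigma, sub_zero, zero_mul]
    rw [mul_div_assoc]
    congr 1
    have hx2 : 0 < x ^ 2 := by positivity
    rw [eq_div_iff hx2.ne']
    rw [sqrt_mul_eq_sqrt_mul_sq hx2.le]
    congr 1
    field_simp
    ring

end Axis

/-! ### The sign of the evolution at a spatial maximum. -/

section MaxAxis

open Filter Asymptotics Topology

/-- The data along a line through a spatial maximum of `H ∘ f`, in the gnomonic parametrization: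
`a`, `b`, `c` are the Hessian entries of the support function and `w` its time derivative. -/
structure IsMaxAxis (K H : ℝ × ℝ → ℝ) (q₀ : ℝ × ℝ) (l : Filter ℝ) (a b c w : ℝ → ℝ) : Prop where
  region : ∀ᶠ x in l, axisRoc a b c x ∈ rocRegion
  speed : ∀ᶠ x in l, w x = -(√(1 + x ^ 2) * K (axisRoc a b c x))
  le_max : ∀ᶠ x in l, H (axisRoc a b c x) ≤ H q₀
  coeffA_nonneg : ∀ᶠ x in l, 0 ≤ coeffA H K (axisRoc a b c x)

variable {K H : ℝ × ℝ → ℝ} {l : Filter ℝ} {a b c w : ℝ → ℝ}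
  {ψ₀ s₀ ψ₁ s₁ w₀ w₁ w₂ k₁ k₂ h₂ : ℝ}

theorem IsMaxAxis.mono {q₀ : ℝ × ℝ} {l' : Filter ℝ} (h : IsMaxAxis K H q₀ l a b c w)
    (hl : l' ≤ l) : IsMaxAxis K H q₀ l' a b c w :=
  ⟨hl h.region, hl h.speed, hl h.le_max, hl h.coeffA_nonneg⟩

theorem axisRoc_comp_neg (x : ℝ) :
    axisRoc (fun y => a (-y)) (fun y => b (-y)) (fun y => c (-y)) x = axisRoc a b c (-x) := by
  simp [axisRoc, axisPsi, axisSigma]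

theorem IsMaxAxis.comp_neg {q₀ : ℝ × ℝ} (h : IsMaxAxis K H q₀ (𝓝 0) a b c w) :
    IsMaxAxis K H q₀ (𝓝[>] 0) (fun y => a (-y)) (fun y => b (-y)) (fun y => c (-y))
      (fun y => w (-y)) := by
  have hx : Tendsto (fun x : ℝ => -x) (𝓝[>] 0) (𝓝 0) := by
    have := (continuous_neg (G := ℝ)).tendsto 0
    rw [neg_zero] at this
    exact this.mono_left nhdsWithin_le_nhds
  refine ⟨?_, ?_, ?_, ?_⟩ <;> simp only [axisRoc_comp_neg]
  · exact hx.eventually h.region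
  · filter_upwards [hx.eventually h.speed] with x h
    rw [h, neg_sq]
  · exact hx.eventually h.le_max
  · exact hx.eventually h.coeffA_nonneg

theorem IsMaxAxis.first_order (hK : ContDiffOn ℝ 2 K rocRegion) (hH : ContDiffOn ℝ 2 H rocRegion)
    (hq : (ψ₀, s₀) ∈ rocRegion) (h : IsMaxAxis K H (ψ₀, s₀) (𝓝[>] 0) a b c w)
    (hψ : Peano1 (𝓝[>] 0) (axisPsi a c) ψ₀ ψ₁) (hs : Peano1 (𝓝[>] 0) (axisSigma a b c) s₀ s₁)
    (hw : Peano1 (𝓝[>] 0) w w₀ w₁) :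
    w₁ = -(d10 K (ψ₀, s₀) * ψ₁ + d01 K (ψ₀, s₀) * s₁) ∧
      d10 H (ψ₀, s₀) * ψ₁ + d01 H (ψ₀, s₀) * s₁ ≤ 0 := by
  have hl := nhdsGT_le_nhds_zero
  have e1 := Peano1.comp_roc hl (hK.of_le one_le_two) hq hψ hs h.region
  have e2 := Peano1.comp_roc hl (hH.of_le one_le_two) hq hψ hs h.region
  refine ⟨?_, e2.nonpos_of_le h.le_max⟩
  have e3 := ((((peano2_sqrt_one_add_sq hl).peano1 hl).mul hl e1).const_mul (-1)).congr (k := w)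
    (by filter_upwards [h.speed] with x hx; rw [hx, axisRoc]; ring)
  have e0 := e3.unique_zero hw
  subst e0
  rw [← e3.unique hw]; ring

/-- The zeroth order term `K q₀` is due to `√(1 + x²)`, whose second derivative at `0` is `1`; its
linear term vanishes. -/
theorem IsMaxAxis.second_order {q₀ : ℝ × ℝ} (h : IsMaxAxis K H q₀ (𝓝[>] 0) a b c w)
    (hKp : Peano2 (𝓝[>] 0) (fun x => K (axisPsi a c x, axisSigma a b c x)) (K q₀) k₁ k₂)
    (hHp : Peano2 (𝓝[>] 0) (fun x => H (axisPsi a c x, axisSigma a b c x)) (H q₀) 0 h₂)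
    (hw : Peano2 (𝓝[>] 0) w w₀ w₁ w₂) : w₂ = -(k₂ + K q₀) ∧ h₂ ≤ 0 := by
  have hl := nhdsGT_le_nhds_zero
  refine ⟨?_, hHp.nonpos_of_le h.le_max⟩
  have e3 := (((peano2_sqrt_one_add_sq hl).mul hl hKp).const_mul (-1)).congr (k := w)
    (by filter_upwards [h.speed] with x hx; rw [hx, axisRoc]; ring)
  rw [← (e3.unique hw).2.2]; ring

theorem IsMaxAxis.nonumbilic {ψ₂ s₂ : ℝ} (hK : ContDiffOn ℝ 2 K rocRegion)
    (hH : ContDiffOn ℝ 2 H rocRegion)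
    (hq : (ψ₀, s₀) ∈ rocRegion) (h : IsMaxAxis K H (ψ₀, s₀) (𝓝 0) a b c w)
    (hψ : Peano2 (𝓝 0) (axisPsi a c) ψ₀ ψ₁ ψ₂) (hs : Peano2 (𝓝 0) (axisSigma a b c) s₀ s₁ s₂)
    (hw : Peano2 (𝓝 0) w w₀ w₁ w₂) :
    d10 H (ψ₀, s₀) * ψ₁ + d01 H (ψ₀, s₀) * s₁ = 0 ∧
    d10 H (ψ₀, s₀) * ψ₂ + d01 H (ψ₀, s₀) * s₂ + (d20 H (ψ₀, s₀) * ψ₁ ^ 2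
        + 2 * d11 H (ψ₀, s₀) * ψ₁ * s₁ + d02 H (ψ₀, s₀) * s₁ ^ 2) ≤ 0 ∧
    w₂ = -((d10 K (ψ₀, s₀) * ψ₂ + d01 K (ψ₀, s₀) * s₂ + (d20 K (ψ₀, s₀) * ψ₁ ^ 2
        + 2 * d11 K (ψ₀, s₀) * ψ₁ * s₁ + d02 K (ψ₀, s₀) * s₁ ^ 2)) + K (ψ₀, s₀)) := by
  have hl := nhdsGT_le_nhds_zero
  have hz : d10 H (ψ₀, s₀) * ψ₁ + d01 H (ψ₀, s₀) * s₁ = 0 := by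
    have e := Peano1.comp_roc le_rfl (hH.of_le one_le_two) hq (hψ.peano1 le_rfl)
      (hs.peano1 le_rfl) h.region
    have e1 := (e.mono hl).nonpos_of_le (hl h.le_max)
    have hx : Tendsto (fun x : ℝ => -x) (𝓝[>] 0) (𝓝 0) := by
      have := (continuous_neg (G := ℝ)).tendsto 0
      rw [neg_zero] at this
      exact this.mono_left nhdsWithin_le_nhds
    have e2 := e.comp_neg.nonpos_of_le (hx.eventually h.le_max)
    linarith
  have hKp := Peano2.comp_roc le_rfl hK hq hψ hs h.region
  have hHp := Peano2.comp_roc le_rfl hH hq hψ hs h.region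
  rw [hz] at hHp
  obtain ⟨h1, h2⟩ := (h.mono hl).second_order (hKp.mono hl) (hHp.mono hl) (hw.mono hl)
  exact ⟨hz, h2, h1⟩

/-- The sign of the evolution of `H` at a spatial maximum which is not umbilic. -/
theorem evolution_nonpos_nonumbilic (hK : ContDiffOn ℝ 2 K rocRegion)
    (hH : ContDiffOn ℝ 2 H rocRegion) {a b c w a' b' c' w' : ℝ → ℝ}
    {a₀ c₀ a₁ b₁ c₁ c₁' a₂ b₂ c₂ b₂' a₂' w₀ wx wy wxx wyy : ℝ}
    (hac : c₀ < a₀)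
    (hq : ((a₀ + c₀) / 2, (a₀ - c₀) / 2) ∈ rocRegion)
    (hx : IsMaxAxis K H ((a₀ + c₀) / 2, (a₀ - c₀) / 2) (𝓝 0) a b c w)
    (hy : IsMaxAxis K H ((a₀ + c₀) / 2, (a₀ - c₀) / 2) (𝓝 0) a' b' c' w')
    (ha : Peano2 (𝓝 0) a a₀ a₁ a₂) (hb : Peano2 (𝓝 0) b 0 b₁ b₂) (hc : Peano2 (𝓝 0) c c₀ c₁ c₂)
    (ha' : Peano2 (𝓝 0) a' c₀ c₁' a₂') (hb' : Peano2 (𝓝 0) b' 0 c₁ b₂')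
    (hc' : Peano2 (𝓝 0) c' a₀ b₁ c₂)
    (hw : Peano2 (𝓝 0) w w₀ wx wxx) (hw' : Peano2 (𝓝 0) w' w₀ wy wyy)
    (hpar : |d01 K ((a₀ + c₀) / 2, (a₀ - c₀) / 2)| < -d10 K ((a₀ + c₀) / 2, (a₀ - c₀) / 2))
    (hI : 0 ≤ d10 H ((a₀ + c₀) / 2, (a₀ - c₀) / 2) * (K ((a₀ + c₀) / 2, (a₀ - c₀) / 2)
        + (a₀ - c₀) / 2 * d01 K ((a₀ + c₀) / 2, (a₀ - c₀) / 2))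
      - d01 H ((a₀ + c₀) / 2, (a₀ - c₀) / 2) * ((a₀ - c₀) / 2 *
          d10 K ((a₀ + c₀) / 2, (a₀ - c₀) / 2)))
    (hAB : |coeffB H K ((a₀ + c₀) / 2, (a₀ - c₀) / 2)|
      ≤ coeffA H K ((a₀ + c₀) / 2, (a₀ - c₀) / 2)) :
    d10 H ((a₀ + c₀) / 2, (a₀ - c₀) / 2) * ((wxx + wyy) / 2)
      + d01 H ((a₀ + c₀) / 2, (a₀ - c₀) / 2) * ((wxx - wyy) / 2) ≤ 0 := by
  have hψ := ha.axisPsi le_rfl hc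
  -- The first axis carries the larger entry `a₀` in the role of `a`, the second the smaller entry
  -- `c₀`; hence the opposite signs `τ`.
  have hs := ha.axisSigma_of_nonumbilic le_rfl hb hc (τ := 1) (by norm_num) (by linarith)
  have hψ' := ha'.axisPsi le_rfl hc'
  have hs' := ha'.axisSigma_of_nonumbilic le_rfl hb' hc' (τ := -1) (by norm_num) (by linarith)
  rw [one_mul] at hs
  rw [add_comm c₀ a₀] at hψ'
  rw [show -1 * ((c₀ - a₀) / 2) = (a₀ - c₀) / 2 by ring] at hs'
  obtain ⟨e1, e2, e3⟩ := hx.nonumbilic hK hH hq hψ hs hw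
  obtain ⟨f1, f2, f3⟩ := hy.nonumbilic hK hH hq hψ' hs' hw'
  have hac0 : a₀ - c₀ ≠ 0 := by linarith
  have hca0 : c₀ - a₀ ≠ 0 := by linarith
  -- The coefficient `c₂`, the mixed fourth derivative of `h`, occurs in the expansions along both
  -- axes and cancels in the relation proved here; `b₁` and `c₁` are shared third derivatives.
  have key := evolution_nonpos_of_nonumbilic (by linarith : 0 < (a₀ - c₀) / 2) hpar e1 f1 e2 f2
    (by
      rw [show c₀ - a₀ = -(a₀ - c₀) by ring]
      field_simp
      ring) hI hAB
  rw [e3, f3]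
  refine le_trans (le_of_eq ?_) key
  ring

theorem coeffA_eq_of_snd_eq_zero (K H : ℝ × ℝ → ℝ) (ψ : ℝ) :
    coeffA H K (ψ, 0) = (d10 H (ψ, 0) ^ 2 + d01 H (ψ, 0) ^ 2) *
      (d10 H (ψ, 0) * d01 K (ψ, 0) - d01 H (ψ, 0) * d10 K (ψ, 0)) := by
  simp [coeffA, poisson]

/-- At `|σ| = 0` the coefficient `A` reduces to `|dH|² {H, K}`. -/
theorem poisson_nonneg_of_coeffA_nonneg {ψ : ℝ} (h : 0 ≤ coeffA H K (ψ, 0)) :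
    0 ≤ d10 H (ψ, 0) * d01 K (ψ, 0) - d01 H (ψ, 0) * d10 K (ψ, 0) := by
  rw [coeffA_eq_of_snd_eq_zero] at h
  by_cases h0 : d10 H (ψ, 0) ^ 2 + d01 H (ψ, 0) ^ 2 = 0
  · have e1 : d10 H (ψ, 0) = 0 := by nlinarith [sq_nonneg (d10 H (ψ, 0)), sq_nonneg (d01 H (ψ, 0))]
    have e2 : d01 H (ψ, 0) = 0 := by nlinarith [sq_nonneg (d10 H (ψ, 0)), sq_nonneg (d01 H (ψ, 0))]
    simp [e1, e2]
  · have hN : 0 < d10 H (ψ, 0) ^ 2 + d01 H (ψ, 0) ^ 2 := lt_of_le_of_ne (by positivity) (Ne.symm h0)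
    exact nonneg_of_mul_nonneg_right h hN

/-- The limit of the condition `0 ≤ A` at an isolated umbilic point at which the transverse
derivatives of `H` and `K` vanish. -/
theorem hess_condition_of_umbilic (hK : ContDiffOn ℝ 2 K rocRegion)
    (hH : ContDiffOn ℝ 2 H rocRegion) {ψ s : ℝ → ℝ} {m : ℝ} (hm : 0 < m)
    (hq : (ψ₀, 0) ∈ rocRegion) (hψ : Peano1 (𝓝[>] 0) ψ ψ₀ 0) (hs : Peano1 (𝓝[>] 0) s 0 m)
    (hR : ∀ᶠ x in 𝓝[>] 0, (ψ x, s x) ∈ rocRegion)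
    (hA : ∀ᶠ x in 𝓝[>] 0, 0 ≤ coeffA H K (ψ x, s x))
    (hH01 : d01 H (ψ₀, 0) = 0) (hK01 : d01 K (ψ₀, 0) = 0) (hH10 : d10 H (ψ₀, 0) ≠ 0) :
    0 ≤ d10 H (ψ₀, 0) * d02 K (ψ₀, 0) - d10 K (ψ₀, 0) * d02 H (ψ₀, 0) := by
  have hl := nhdsGT_le_nhds_zero
  have ht := tendsto_roc hl hψ hs hR
  have hc : ∀ {F : ℝ × ℝ → ℝ}, ContinuousOn F rocRegion →
      Tendsto (fun x => F (ψ x, s x)) (𝓝[>] 0) (𝓝 (F (ψ₀, 0))) :=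
    fun hF => (hF _ hq).tendsto.comp ht
  have p1 := Peano1.comp_roc hl (contDiffOn_d01 hH) hq hψ hs hR
  have p2 := Peano1.comp_roc hl (contDiffOn_d01 hK) hq hψ hs hR
  rw [hH01, mul_zero, zero_add] at p1
  rw [hK01, mul_zero, zero_add] at p2
  have q1 := p1.slope_tendsto
  have q2 := p2.slope_tendsto
  have q3 := hs.slope_tendsto
  simp only [sub_zero] at q1 q2 q3
  have cH10 := hc (contDiffOn_d10 hH).continuousOn
  have cH01 := hc (contDiffOn_d01 hH).continuousOn
  have cK10 := hc (contDiffOn_d10 hK).continuousOn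
  have cK01 := hc (contDiffOn_d01 hK).continuousOn
  have cH20 := hc (continuousOn_d_of_contDiffOn_one (contDiffOn_d10 hH)).1
  have cH11 := hc (continuousOn_d_of_contDiffOn_one (contDiffOn_d01 hH)).1
  have cH02 := hc (continuousOn_d_of_contDiffOn_one (contDiffOn_d01 hH)).2
  have cK20 := hc (continuousOn_d_of_contDiffOn_one (contDiffOn_d10 hK)).1
  have cK11 := hc (continuousOn_d_of_contDiffOn_one (contDiffOn_d01 hK)).1
  have cK02 := hc (continuousOn_d_of_contDiffOn_one (contDiffOn_d01 hK)).2
  have hhH := ((cH20.mul (cH01.pow 2)).sub (((cH11.const_mul 2).mul cH01).mul cH10)).add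
    (cH02.mul (cH10.pow 2))
  have hhK := ((cK20.mul (cH01.pow 2)).sub (((cK11.const_mul 2).mul cH01).mul cH10)).add
    (cK02.mul (cH10.pow 2))
  -- The limit of `A / x`. As `H₀₁` and `K₀₁` vanish at the umbilic, `H₀₁ / x → m H₀₂`, `K₀₁ / x → m
  -- K₀₂` and `|σ| / x → m`, so the limit is `2 m H₁₀²` times the expression sought.
  have hlim := (((cH10.pow 2).add (cH01.pow 2)).mul ((cH10.mul q2).sub (q1.mul cK10))).sub
    (q3.mul ((cK10.mul hhH).sub (cH10.mul hhK)))
  have hnn := ge_of_tendsto (b := (0 : ℝ)) hlim (by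
    filter_upwards [hA, self_mem_nhdsWithin] with x hx hx0
    have hx0' : (0 : ℝ) < x := hx0
    refine le_trans (div_nonneg hx hx0'.le) (le_of_eq ?_)
    simp only [coeffA, poisson, hessOn, d20, d11, d02]
    field_simp)
  rw [hH01] at hnn
  have hpos : 0 < 2 * m * d10 H (ψ₀, 0) ^ 2 := by positivity
  refine (mul_nonneg_iff_of_pos_left hpos).1 ?_
  refine hnn.trans (le_of_eq ?_)
  simp only [d02]
  ring

/-- First order information along a line through an umbilic maximum. -/
theorem IsMaxAxis.umbilic_first_order (hK : ContDiffOn ℝ 2 K rocRegion)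
    (hH : ContDiffOn ℝ 2 H rocRegion) {a₀ a₁ a₂ b₁ b₂ c₁ c₂ : ℝ} (hq : (a₀, 0) ∈ rocRegion)
    (h : IsMaxAxis K H (a₀, 0) (𝓝 0) a b c w) (ha : Peano2 (𝓝 0) a a₀ a₁ a₂)
    (hb : Peano2 (𝓝 0) b 0 b₁ b₂) (hc : Peano2 (𝓝 0) c a₀ c₁ c₂) (hw : Peano2 (𝓝 0) w w₀ w₁ w₂) :
    d01 K (a₀, 0) * (√((a₁ - c₁) ^ 2 + 4 * b₁ ^ 2) / 2) = 0 ∧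
    d10 H (a₀, 0) * ((a₁ + c₁) / 2) + d01 H (a₀, 0) * (√((a₁ - c₁) ^ 2 + 4 * b₁ ^ 2) / 2) ≤ 0 ∧
    -(d10 H (a₀, 0) * ((a₁ + c₁) / 2)) + d01 H (a₀, 0) * (√((a₁ - c₁) ^ 2 + 4 * b₁ ^ 2) / 2)
      ≤ 0 := by
  have hl := nhdsGT_le_nhds_zero
  have hψ := (ha.axisPsi le_rfl hc)
  rw [add_self_div_two] at hψ
  have hs := Peano1.axisSigma_of_umbilic ((ha.peano1 le_rfl).mono hl) ((hb.peano1 le_rfl).mono hl)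
    ((hc.peano1 le_rfl).mono hl)
  have hψ' := ha.comp_neg.axisPsi hl hc.comp_neg
  rw [add_self_div_two] at hψ'
  have hs' := Peano1.axisSigma_of_umbilic (ha.comp_neg.peano1 hl) (hb.comp_neg.peano1 hl)
    (hc.comp_neg.peano1 hl)
  -- The function `w` is differentiable through `0`, whereas `|σ|` increases with the same slope in
  -- both directions; adding the two one-sided derivatives of `w` leaves `K₀₁` times that slope
  -- equal to zero.
  obtain ⟨e1, e2⟩ := (h.mono hl).first_order hK hH hq ((hψ.peano1 le_rfl).mono hl) hs
    ((hw.peano1 le_rfl).mono hl)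
  obtain ⟨f1, f2⟩ := h.comp_neg.first_order hK hH hq (hψ'.peano1 hl) hs' (hw.comp_neg.peano1 hl)
  rw [show (-a₁ - -c₁) ^ 2 + 4 * (-b₁) ^ 2 = (a₁ - c₁) ^ 2 + 4 * b₁ ^ 2 by ring] at f1 f2
  exact ⟨by linarith, e2, by linarith⟩

/-- The sign of the evolution of `H` at an umbilic maximum at which all first derivatives of the
radii of curvature vanish. -/
theorem evolution_nonpos_umbilic_of_first_order_eq_zero (hK : ContDiffOn ℝ 2 K rocRegion)
    (hH : ContDiffOn ℝ 2 H rocRegion) {a b c w a' b' c' w' : ℝ → ℝ}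
    {a₀ a₁ b₁ c₁ c₁' a₂ b₂ c₂ b₂' a₂' w₀ wx wy wxx wyy : ℝ}
    (hq : (a₀, 0) ∈ rocRegion)
    (hx : IsMaxAxis K H (a₀, 0) (𝓝 0) a b c w)
    (hy : IsMaxAxis K H (a₀, 0) (𝓝 0) a' b' c' w')
    (ha : Peano2 (𝓝 0) a a₀ a₁ a₂) (hb : Peano2 (𝓝 0) b 0 b₁ b₂) (hc : Peano2 (𝓝 0) c a₀ c₁ c₂)
    (ha' : Peano2 (𝓝 0) a' a₀ c₁' a₂') (hb' : Peano2 (𝓝 0) b' 0 c₁ b₂')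
    (hc' : Peano2 (𝓝 0) c' a₀ b₁ c₂)
    (hw : Peano2 (𝓝 0) w w₀ wx wxx) (hw' : Peano2 (𝓝 0) w' w₀ wy wyy)
    (hpar : |d01 K (a₀, 0)| < -d10 K (a₀, 0))
    (hI : 0 ≤ d10 H (a₀, 0) * K (a₀, 0)) (hA : 0 ≤ coeffA H K (a₀, 0))
    (h1 : √((a₁ - c₁) ^ 2 + 4 * b₁ ^ 2) = 0) (h2 : √((c₁' - b₁) ^ 2 + 4 * c₁ ^ 2) = 0) :
    d10 H (a₀, 0) * ((wxx + wyy) / 2) - d01 H (a₀, 0) * (|wxx - wyy| / 2) ≤ 0 := by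
  have hl := nhdsGT_le_nhds_zero
  have hP := poisson_nonneg_of_coeffA_nonneg hA
  have hψ := (ha.axisPsi le_rfl hc).mono hl
  have hψ' := (ha'.axisPsi le_rfl hc').mono hl
  rw [add_self_div_two] at hψ hψ'
  have h1' : (a₁ - c₁) ^ 2 + 4 * b₁ ^ 2 = 0 := by
    have := h1
    rwa [Real.sqrt_eq_zero (by positivity)] at this
  have h2' : (c₁' - b₁) ^ 2 + 4 * c₁ ^ 2 = 0 := by
    have := h2
    rwa [Real.sqrt_eq_zero (by positivity)] at this
  have z1 : b₁ = 0 := by nlinarith [sq_nonneg (a₁ - c₁), sq_nonneg b₁]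
  have z2 : c₁ = 0 := by nlinarith [sq_nonneg (c₁' - b₁), sq_nonneg c₁]
  subst z1 z2
  have z3 : a₁ = 0 := by nlinarith
  have z4 : c₁' = 0 := by nlinarith
  subst z3 z4
  have hs := Peano2.axisSigma_of_umbilic (ha.mono hl) (hb.mono hl) (hc.mono hl)
  have hs' := Peano2.axisSigma_of_umbilic (ha'.mono hl) (hb'.mono hl) (hc'.mono hl)
  have hKx := Peano2.comp_roc hl hK hq hψ hs (hl hx.region)
  have hHx := Peano2.comp_roc hl hH hq hψ hs (hl hx.region)
  have hKy := Peano2.comp_roc hl hK hq hψ' hs' (hl hy.region)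
  have hHy := Peano2.comp_roc hl hH hq hψ' hs' (hl hy.region)
  simp only [add_zero, zero_div, mul_zero, ne_eq, OfNat.ofNat_ne_zero, not_false_eq_true,
    zero_pow] at hKx hHx hKy hHy
  obtain ⟨u1, u2⟩ := (hx.mono hl).second_order hKx hHx (hw.mono hl)
  obtain ⟨v1, v2⟩ := (hy.mono hl).second_order hKy hHy (hw'.mono hl)
  have abs_le : ∀ u v : ℝ, |u| ≤ √(u ^ 2 + 4 * v ^ 2) := fun u v =>
    Real.abs_le_sqrt (by nlinarith [sq_nonneg v])
  have l1 := abs_le (a₂ - c₂ + 2 * a₀) b₂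
  have l2 := abs_le (a₂' - c₂ + 2 * a₀) b₂'
  -- In the difference of the second derivatives of `ψ` the shared `c₂` cancels, as do the terms in
  -- `a₀`; the bounds `l1`, `l2` then give the inequality form of the fourth derivative relation.
  have key := evolution_nonpos_of_umbilic hpar u2 v2 (by
    rw [_root_.abs_le]
    obtain ⟨m1, m2⟩ := _root_.abs_le.1 l1
    obtain ⟨n1, n2⟩ := _root_.abs_le.1 l2
    constructor <;> linarith) hI hP
  rw [u1, v1]
  refine le_trans (le_of_eq ?_) key
  rw [show ∀ u v k : ℝ, -(u + k) - -(v + k) = -(u - v) by intros; ring, abs_neg]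
  ring

/-- The sign of the evolution of `H` at a spatial maximum which is umbilic. -/
theorem evolution_nonpos_umbilic (hK : ContDiffOn ℝ 2 K rocRegion)
    (hH : ContDiffOn ℝ 2 H rocRegion) {a b c w a' b' c' w' : ℝ → ℝ}
    {a₀ a₁ b₁ c₁ c₁' a₂ b₂ c₂ b₂' a₂' w₀ wx wy wxx wyy : ℝ}
    (hq : (a₀, 0) ∈ rocRegion)
    (hx : IsMaxAxis K H (a₀, 0) (𝓝 0) a b c w)
    (hy : IsMaxAxis K H (a₀, 0) (𝓝 0) a' b' c' w')
    (ha : Peano2 (𝓝 0) a a₀ a₁ a₂) (hb : Peano2 (𝓝 0) b 0 b₁ b₂) (hc : Peano2 (𝓝 0) c a₀ c₁ c₂)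
    (ha' : Peano2 (𝓝 0) a' a₀ c₁' a₂') (hb' : Peano2 (𝓝 0) b' 0 c₁ b₂')
    (hc' : Peano2 (𝓝 0) c' a₀ b₁ c₂)
    (hw : Peano2 (𝓝 0) w w₀ wx wxx) (hw' : Peano2 (𝓝 0) w' w₀ wy wyy)
    (hpar : |d01 K (a₀, 0)| < -d10 K (a₀, 0))
    (hI : 0 ≤ d10 H (a₀, 0) * K (a₀, 0)) (hA : 0 ≤ coeffA H K (a₀, 0)) :
    d10 H (a₀, 0) * ((wxx + wyy) / 2) - d01 H (a₀, 0) * (|wxx - wyy| / 2) ≤ 0 := by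
  have hl := nhdsGT_le_nhds_zero
  have hP := poisson_nonneg_of_coeffA_nonneg hA
  have hK10 : 0 < -d10 K (a₀, 0) := (abs_nonneg _).trans_lt hpar
  obtain ⟨x1, x2, x3⟩ := hx.umbilic_first_order hK hH hq ha hb hc hw
  obtain ⟨y1, y2, y3⟩ := hy.umbilic_first_order hK hH hq ha' hb' hc' hw'
  set mx := √((a₁ - c₁) ^ 2 + 4 * b₁ ^ 2) / 2 with hmx
  set my := √((c₁' - b₁) ^ 2 + 4 * c₁ ^ 2) / 2 with hmy
  have hmx0 : 0 ≤ mx := by positivity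
  have hmy0 : 0 ≤ my := by positivity
  have hψ := (ha.axisPsi le_rfl hc).mono hl
  have hψ' := (ha'.axisPsi le_rfl hc').mono hl
  rw [add_self_div_two] at hψ hψ'
  have caseA : mx = 0 → my = 0 →
      d10 H (a₀, 0) * ((wxx + wyy) / 2) - d01 H (a₀, 0) * (|wxx - wyy| / 2) ≤ 0 := fun h1 h2 =>
    evolution_nonpos_umbilic_of_first_order_eq_zero hK hH hq hx hy ha hb hc ha' hb' hc' hw hw' hpar
      hI hA (by linarith) (by linarith)
  -- If `K₀₁ ≠ 0` the slopes `mx`, `my` vanish by differentiability of `w`. If `H₀₁ > 0` they vanish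
  -- because `|σ|`, growing on both sides, would push `H` above its maximum.
  by_cases hK01 : d01 K (a₀, 0) = 0
  swap
  · exact caseA ((mul_eq_zero.1 x1).resolve_left hK01) ((mul_eq_zero.1 y1).resolve_left hK01)
  have hH01nn : 0 ≤ d01 H (a₀, 0) := by
    rw [hK01] at hP
    nlinarith
  by_cases hH01 : d01 H (a₀, 0) = 0
  swap
  · have hpos : 0 < d01 H (a₀, 0) := lt_of_le_of_ne hH01nn (Ne.symm hH01)
    exact caseA (by nlinarith) (by nlinarith)
  by_cases hH10 : d10 H (a₀, 0) = 0
  · simp [hH10, hH01]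
  rw [hH01] at x2 x3 y2 y3
  have e1 : (a₁ + c₁) / 2 = 0 := (mul_eq_zero.1 (by linarith : d10 H (a₀, 0) * _ = 0)).resolve_left hH10
  have e2 : (c₁' + b₁) / 2 = 0 :=
    (mul_eq_zero.1 (by linarith : d10 H (a₀, 0) * _ = 0)).resolve_left hH10
  have e3 : a₁ = -c₁ := by linarith
  have e4 : c₁' = -b₁ := by linarith
  -- With `H₀₁ = 0` and `H₁₀ ≠ 0`, maximality makes `ψ` stationary along both axes. The shared third
  -- derivatives then force equal slopes of `|σ|`.
  have hmm : mx = my := by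
    rw [hmx, hmy, e3, e4]
    ring_nf
  by_cases hm : mx = 0
  · exact caseA hm (by rw [← hmm, hm])
  have hmpos : 0 < mx := lt_of_le_of_ne hmx0 (Ne.symm hm)
  rw [e1] at hψ
  rw [e2] at hψ'
  have hs : Peano1 (𝓝[>] 0) (axisSigma a b c) 0 mx :=
    Peano1.axisSigma_of_umbilic ((ha.peano1 le_rfl).mono hl) ((hb.peano1 le_rfl).mono hl)
      ((hc.peano1 le_rfl).mono hl)
  have hs' : Peano1 (𝓝[>] 0) (axisSigma a' b' c') 0 my :=
    Peano1.axisSigma_of_umbilic ((ha'.peano1 le_rfl).mono hl) ((hb'.peano1 le_rfl).mono hl)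
      ((hc'.peano1 le_rfl).mono hl)
  have hKx := Peano2.comp_roc_of_d01_eq_zero hl hK hq hK01 hψ hs (hl hx.region)
  have hHx := Peano2.comp_roc_of_d01_eq_zero hl hH hq hH01 hψ hs (hl hx.region)
  have hKy := Peano2.comp_roc_of_d01_eq_zero hl hK hq hK01 hψ' hs' (hl hy.region)
  have hHy := Peano2.comp_roc_of_d01_eq_zero hl hH hq hH01 hψ' hs' (hl hy.region)
  obtain ⟨u1, u2⟩ := (hx.mono hl).second_order hKx hHx (hw.mono hl)
  obtain ⟨v1, v2⟩ := (hy.mono hl).second_order hKy hHy (hw'.mono hl)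
  have hcond := hess_condition_of_umbilic hK hH hmpos hq (hψ.peano1 hl) hs (hl hx.region)
    (hl hx.coeffA_nonneg) hH01 hK01 hH10
  rw [hH01, zero_mul, sub_zero, u1, v1]
  rw [← hmm] at v2 ⊢
  have t1 := mul_nonneg hK10.le (neg_nonneg.2 (add_nonpos u2 v2))
  have t2 := mul_nonneg hcond (sq_nonneg mx)
  linarith

end MaxAxis

/-! ### First order change of `H` at a fixed normal. -/

section TimeExpansion

open Filter Asymptotics Topology

variable {H : ℝ × ℝ → ℝ} {a b c : ℝ → ℝ} {a₀ a₁ a₂ b₁ b₂ c₀ c₁ c₂ : ℝ}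

theorem peano1_time_nonumbilic (hH : ContDiffOn ℝ 2 H rocRegion) (hac : c₀ < a₀)
    (ha : Peano2 (𝓝[>] 0) a a₀ a₁ a₂) (hb : Peano2 (𝓝[>] 0) b 0 b₁ b₂)
    (hc : Peano2 (𝓝[>] 0) c c₀ c₁ c₂)
    (hq : ((a₀ + c₀) / 2, (a₀ - c₀) / 2) ∈ rocRegion)
    (hR : ∀ᶠ x in 𝓝[>] 0,
      ((a x + c x) / 2, √((a x - c x) ^ 2 + 4 * b x ^ 2) / 2) ∈ rocRegion) :
    Peano1 (𝓝[>] 0) (fun x => H ((a x + c x) / 2, √((a x - c x) ^ 2 + 4 * b x ^ 2) / 2))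
      (H ((a₀ + c₀) / 2, (a₀ - c₀) / 2))
      (d10 H ((a₀ + c₀) / 2, (a₀ - c₀) / 2) * ((a₁ + c₁) / 2)
        + d01 H ((a₀ + c₀) / 2, (a₀ - c₀) / 2) * ((a₁ - c₁) / 2)) := by
  have hl := nhdsGT_le_nhds_zero
  have hac' : a₀ - c₀ ≠ 0 := by linarith
  have hψ := ((ha.add hc).const_mul (1 / 2)).congr (k := fun x => (a x + c x) / 2)
    (by filter_upwards with x; ring)
  have hs : Peano2 (𝓝[>] 0) (fun x => √((a x - c x) ^ 2 + 4 * b x ^ 2) / 2)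
      ((a₀ - c₀) / 2) ((a₁ - c₁) / 2) ((a₂ - c₂) / 2 + 2 * b₁ ^ 2 / (a₀ - c₀)) := by
    refine Peano2.sqrt hl (by linarith) (by filter_upwards with x; positivity) ?_
    have hd := ha.sub hc
    have := (((hd.mul hl hd).add ((hb.mul hl hb).const_mul 4)).const_mul (1 / 4)).congr
      (k := fun x => (√((a x - c x) ^ 2 + 4 * b x ^ 2) / 2) ^ 2) (by
        filter_upwards with x
        rw [div_pow, Real.sq_sqrt (by positivity)]; ring)
    convert this using 1
    · ring
    · ring
    · field_simp; ring
  rw [show (1 / 2 : ℝ) * (a₀ + c₀) = (a₀ + c₀) / 2 by ring,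
    show (1 / 2 : ℝ) * (a₁ + c₁) = (a₁ + c₁) / 2 by ring] at hψ
  exact Peano1.comp_roc hl (hH.of_le one_le_two) hq (hψ.peano1 hl) (hs.peano1 hl) hR

/-- The vanishing slope of `b` is arranged by choosing a frame that diagonalizes the time derivative
of the Hessian; `|σ|` then opens with slope `|a₁ - c₁| / 2`. -/
theorem peano1_time_umbilic (hH : ContDiffOn ℝ 2 H rocRegion)
    (ha : Peano1 (𝓝[>] 0) a a₀ a₁) (hb : Peano1 (𝓝[>] 0) b 0 0) (hc : Peano1 (𝓝[>] 0) c a₀ c₁)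
    (hq : (a₀, 0) ∈ rocRegion)
    (hR : ∀ᶠ x in 𝓝[>] 0,
      ((a x + c x) / 2, √((a x - c x) ^ 2 + 4 * b x ^ 2) / 2) ∈ rocRegion) :
    Peano1 (𝓝[>] 0) (fun x => H ((a x + c x) / 2, √((a x - c x) ^ 2 + 4 * b x ^ 2) / 2))
      (H (a₀, 0)) (d10 H (a₀, 0) * ((a₁ + c₁) / 2) + d01 H (a₀, 0) * (|a₁ - c₁| / 2)) := by
  have hl := nhdsGT_le_nhds_zero
  have hψ := ((ha.add hc).const_mul (1 / 2)).congr (k := fun x => (a x + c x) / 2)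
    (by filter_upwards with x; ring)
  have hs : Peano1 (𝓝[>] 0) (fun x => √((a x - c x) ^ 2 + 4 * b x ^ 2) / 2) 0
      (|a₁ - c₁| / 2) := by
    refine Peano1.of_slope_tendsto ?_
    have h3 := ((((ha.slope_tendsto.sub hc.slope_tendsto).pow 2).add
      ((hb.slope_tendsto.pow 2).const_mul 4)).sqrt).div_const 2
    convert h3.congr' ?_ using 2
    · norm_num [Real.sqrt_sq_eq_abs]
    · filter_upwards [self_mem_nhdsWithin] with x hx
      have hx' : (0 : ℝ) < x := hx
      simp only [sub_zero]
      rw [div_right_comm]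
      congr 1
      rw [eq_div_iff hx'.ne', sqrt_mul_eq_sqrt_mul_sq hx'.le]
      congr 1
      field_simp
      ring
  rw [show (1 / 2 : ℝ) * (a₀ + a₀) = a₀ by ring,
    show (1 / 2 : ℝ) * (a₁ + c₁) = (a₁ + c₁) / 2 by ring] at hψ
  exact Peano1.comp_roc hl (hH.of_le one_le_two) hq hψ hs hR

end TimeExpansion

/-! ### Iterated directional derivatives and their symmetry. -/

section DirectionalDerivatives

open Filter Asymptotics Topology

variable {E : Type*} [NormedAddCommGroup E] [NormedSpace ℝ E]

/-- The derivative of `h` in the direction `e`, as a function. -/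
noncomputable def dirDeriv (e : E) (h : E → ℝ) (q : E) : ℝ := fderiv ℝ h q e

theorem contDiffAt_dirDeriv {h : E → ℝ} {q : E} {m n : ℕ} (hh : ContDiffAt ℝ n h q)
    (hmn : m + 1 ≤ n) (e : E) : ContDiffAt ℝ m (dirDeriv e h) q :=
  (hh.fderiv_right (m := m) (by exact_mod_cast hmn)).clm_apply contDiffAt_const

theorem dirDeriv_congr {h k : E → ℝ} {q : E} (hk : h =ᶠ[𝓝 q] k) (e : E) :
    dirDeriv e h =ᶠ[𝓝 q] dirDeriv e k := by
  filter_upwards [hk.fderiv (𝕜 := ℝ)] with x hx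
  rw [dirDeriv, dirDeriv, hx]

/-- An equality near `q`, not merely at `q`, so that it can be differentiated again. -/
theorem dirDeriv_comm {h : E → ℝ} {q : E} {n : ℕ} (hh : ContDiffAt ℝ n h q) (hn : 2 ≤ n)
    (v w : E) : dirDeriv v (dirDeriv w h) =ᶠ[𝓝 q] dirDeriv w (dirDeriv v h) := by
  filter_upwards [hh.eventually (by simp)] with x hx
  have hd : DifferentiableAt ℝ (fderiv ℝ h) x :=
    (hx.fderiv_right (m := 1) (by exact_mod_cast hn)).differentiableAt one_ne_zero
  have key : ∀ v w : E, dirDeriv v (dirDeriv w h) x = fderiv ℝ (fderiv ℝ h) x v w := by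
    intro v w
    have := hd.hasFDerivAt.clm_apply (hasFDerivAt_const w x)
    change fderiv ℝ (fun y => fderiv ℝ h y w) x v = _
    rw [this.fderiv]
    simp
  rw [key, key]
  exact hx.isSymmSndFDerivAt (by simpa using (by exact_mod_cast hn : (2 : WithTop ℕ∞) ≤ n)) v w

theorem peano2_line {f : E → ℝ} {q : E} (hf : ContDiffAt ℝ 2 f q) (v : E) :
    Peano2 (𝓝 0) (fun x : ℝ => f (q + x • v)) (f q) (dirDeriv v f q)
      (dirDeriv v (dirDeriv v f) q) := by
  have hline : ∀ x : ℝ, HasDerivAt (fun x : ℝ => q + x • v) v x := fun x => by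
    simpa using ((hasDerivAt_id x).smul_const v).const_add q
  have hcont : Tendsto (fun x : ℝ => q + x • v) (𝓝 0) (𝓝 q) := by
    have := (hline 0).continuousAt.tendsto
    simpa using this
  have h2 : ContDiffAt ℝ 1 (dirDeriv v f) q :=
    (hf.fderiv_right (m := 1) (by norm_num)).clm_apply contDiffAt_const
  have key := Peano2.of_hasDerivAt (g := fun x : ℝ => f (q + x • v))
    (g' := fun x : ℝ => dirDeriv v f (q + x • v)) (g₂ := dirDeriv v (dirDeriv v f) q) ?_ ?_
  · simpa using key
  · filter_upwards [hcont.eventually (hf.eventually (by simp))] with x hx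
    exact (hx.differentiableAt two_ne_zero).hasFDerivAt.comp_hasDerivAt x (hline x)
  · have h3 : DifferentiableAt ℝ (dirDeriv v f) (q + (0 : ℝ) • v) := by
      simpa using h2.differentiableAt one_ne_zero
    have := h3.hasFDerivAt.comp_hasDerivAt (0 : ℝ) (hline 0)
    rw [zero_smul, add_zero] at this
    exact this

end DirectionalDerivatives

/-! ### Support functions and adapted orthonormal frames. -/

section SupportFunction

open Filter Asymptotics Topology

/-- The point `((r₁ + r₂) / 2, (r₁ - r₂) / 2)` at `z = n + x e₁`, in terms of the Hessian entries
of a support function. -/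
noncomputable def gnomonicRoc (x a b c : ℝ) : ℝ × ℝ :=
  (√(1 + x ^ 2) / 2 * ((1 + x ^ 2) * a + c),
    √(1 + x ^ 2) / 2 * √(((1 + x ^ 2) * a - c) ^ 2 + 4 * (1 + x ^ 2) * b ^ 2))

/-- The second derivative of `h` in two spatial directions. -/
noncomputable def spaceHess (h : ℝ × E3 → ℝ) (e e' : E3) (q : ℝ × E3) : ℝ :=
  dirDeriv ((0, e) : ℝ × E3) (dirDeriv ((0, e') : ℝ × E3) h) q

/-- A support function `h` near `q₀ = (t₀, n₀)` of a curvature flow with radii of curvature `roc`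
(as a function of time and normal direction). -/
structure IsSupportFunction (K : ℝ × ℝ → ℝ) (q₀ : ℝ × E3) (h : ℝ × E3 → ℝ)
    (roc : ℝ × E3 → ℝ × ℝ) : Prop where
  norm_eq_one : ‖q₀.2‖ = 1
  contDiffAt : ContDiffAt ℝ (6 : ℕ) h q₀
  speed : ∀ᶠ q in 𝓝 q₀, dirDeriv ((1, 0) : ℝ × E3) h q = -(‖q.2‖ * K (roc q))
  roc_eq : ∀ᶠ q in 𝓝 q₀, ∀ (e₁ e₂ e₃ : E3) (x : ℝ), Orthonormal ℝ ![e₁, e₂, e₃] →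
    q.2 = e₃ + x • e₁ →
    roc q = gnomonicRoc x (spaceHess h e₁ e₁ q) (spaceHess h e₁ e₂ q) (spaceHess h e₂ e₂ q)

theorem orthonormal_triple_iff (u v w : E3) : Orthonormal ℝ ![u, v, w] ↔
    ‖u‖ = 1 ∧ ‖v‖ = 1 ∧ ‖w‖ = 1 ∧ inner ℝ u v = 0 ∧ inner ℝ u w = 0 ∧ inner ℝ v w = 0 := by
  constructor
  · rintro ⟨h1, h2⟩
    exact ⟨h1 0, h1 1, h1 2, h2 (i := 0) (j := 1) (by decide), h2 (i := 0) (j := 2) (by decide),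
      h2 (i := 1) (j := 2) (by decide)⟩
  · rintro ⟨h1, h2, h3, h4, h5, h6⟩
    refine ⟨fun i => by fin_cases i <;> assumption, fun i j hij => ?_⟩
    fin_cases i <;> fin_cases j <;> first | exact absurd rfl hij | skip
    all_goals first | assumption | (rw [real_inner_comm]; assumption)

theorem orthonormal_swap {u v w : E3} (h : Orthonormal ℝ ![u, v, w]) :
    Orthonormal ℝ ![v, u, w] := by
  rw [orthonormal_triple_iff] at h ⊢
  obtain ⟨h1, h2, h3, h4, h5, h6⟩ := h
  exact ⟨h2, h1, h3, by rwa [real_inner_comm], h6, h5⟩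

theorem exists_orthonormal_triple {n : E3} (hn : ‖n‖ = 1) :
    ∃ u v : E3, Orthonormal ℝ ![u, v, n] := by
  have h0 : Orthonormal ℝ (fun _ : ({0} : Set (Fin 3)) => n) := by
    refine ⟨fun _ => hn, fun i j hij => absurd (Subsingleton.elim i j) hij⟩
  obtain ⟨b, hb⟩ := Orthonormal.exists_orthonormalBasis_extension_of_card_eq
    (𝕜 := ℝ) (E := E3) (ι := Fin 3) (by simp) (v := fun _ => n) (s := {0}) h0
  have hb0 : b 0 = n := hb 0 rfl
  refine ⟨b 1, b 2, (orthonormal_triple_iff _ _ _).2 ?_⟩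
  rw [← hb0]
  refine ⟨b.orthonormal.1 1, b.orthonormal.1 2, b.orthonormal.1 0,
    b.orthonormal.2 (by decide), b.orthonormal.2 (by decide), b.orthonormal.2 (by decide)⟩

/-- A symmetric bilinear form can be diagonalized on the plane orthogonal to a unit vector. -/
theorem exists_orthonormal_triple_diag {n : E3} (hn : ‖n‖ = 1) (B : E3 →ₗ[ℝ] E3 →ₗ[ℝ] ℝ)
    (hB : ∀ v w, B v w = B w v) :
    ∃ u v : E3, Orthonormal ℝ ![u, v, n] ∧ B u v = 0 := by
  obtain ⟨u, v, huv⟩ := exists_orthonormal_triple hn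
  -- The off-diagonal entry in the frame rotated by `θ`. A quarter turn changes its sign, so it
  -- vanishes at some angle.
  set g : ℝ → ℝ := fun θ => B (Real.cos θ • u + Real.sin θ • v) (-(Real.sin θ) • u + Real.cos θ • v)
    with hg
  have hgc : Continuous g := by
    simp only [hg, map_add, map_smul, LinearMap.add_apply, LinearMap.smul_apply, smul_eq_mul]
    fun_prop
  have g0 : g 0 = B u v := by simp [hg]
  have g1 : g (Real.pi / 2) = -B u v := by simp [hg, hB v u]
  obtain ⟨θ, hθ⟩ : (0 : ℝ) ∈ range g := by
    rcases le_total (B u v) 0 with h | h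
    · exact mem_range_of_exists_le_of_exists_ge hgc ⟨0, by rw [g0]; exact h⟩
        ⟨Real.pi / 2, by rw [g1]; linarith⟩
    · exact mem_range_of_exists_le_of_exists_ge hgc ⟨Real.pi / 2, by rw [g1]; linarith⟩
        ⟨0, by rw [g0]; exact h⟩
  refine ⟨_, _, ?_, hθ⟩
  rw [orthonormal_triple_iff] at huv ⊢
  obtain ⟨h1, h2, h3, h4, h5, h6⟩ := huv
  have h4' : inner ℝ v u = 0 := by rw [real_inner_comm]; exact h4
  have i1 : inner ℝ u u = (1 : ℝ) := by rw [real_inner_self_eq_norm_sq, h1]; norm_num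
  have i2 : inner ℝ v v = (1 : ℝ) := by rw [real_inner_self_eq_norm_sq, h2]; norm_num
  have hcs := Real.cos_sq_add_sin_sq θ
  have nrm : ∀ y : E3, inner ℝ y y = (1 : ℝ) → ‖y‖ = 1 := fun y hy => by
    rw [real_inner_self_eq_norm_sq] at hy
    nlinarith [norm_nonneg y]
  refine ⟨nrm _ ?_, nrm _ ?_, h3, ?_, ?_, ?_⟩ <;>
    simp only [inner_add_left, inner_add_right, real_inner_smul_left, real_inner_smul_right,
      i1, i2, h4, h4', h5, h6] <;> linarith

end SupportFunction

/-! ### From the support function to the backward expansion of `H ∘ f`. -/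

section SupportFunctionEvolution

open Filter Asymptotics Topology

theorem poisson_conserved_eq {K H : ℝ × ℝ → ℝ} (hK : ContDiffOn ℝ 2 K rocRegion) {q : ℝ × ℝ}
    (hq : q ∈ rocRegion) : poisson H (conserved K) q
      = d10 H q * (K q + q.2 * d01 K q) - d01 H q * (q.2 * d10 K q) := by
  have h1 : HasFDerivWithinAt (fun p : ℝ × ℝ => p.2) (ContinuousLinearMap.snd ℝ ℝ ℝ) rocRegion q :=
    hasFDerivWithinAt_snd
  have h2 := h1.mul (hK.differentiableOn two_ne_zero q hq).hasFDerivWithinAt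
  have h3 : fderivWithin ℝ (conserved K) rocRegion q = _ :=
    h2.fderivWithin (uniqueDiffOn_rocRegion q hq)
  have e1 : d10 (conserved K) q = q.2 * d10 K q := by
    rw [d10, h3]; simp [d10]
  have e2 : d01 (conserved K) q = K q + q.2 * d01 K q := by
    rw [d01, h3]; simp [d01]; ring
  rw [poisson, e1, e2]

theorem gnomonicRoc_zero (a b c : ℝ) :
    gnomonicRoc 0 a b c = ((a + c) / 2, √((a - c) ^ 2 + 4 * b ^ 2) / 2) := by
  simp [gnomonicRoc]
  constructor <;> ring

variable {K H : ℝ × ℝ → ℝ} {q₀ : ℝ × E3} {h : ℝ × E3 → ℝ} {roc : ℝ × E3 → ℝ × ℝ}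

theorem tendsto_line {E : Type*} [NormedAddCommGroup E] [NormedSpace ℝ E] (q v : E) :
    Tendsto (fun x : ℝ => q + x • v) (𝓝 0) (𝓝 q) := by
  have : Continuous (fun x : ℝ => q + x • v) := by fun_prop
  simpa using this.tendsto 0

theorem spaceHess_contDiffAt {f : ℝ × E3 → ℝ} {n : ℕ} (hf : ContDiffAt ℝ (n + 2 : ℕ) f q₀)
    (u v : E3) : ContDiffAt ℝ n (spaceHess f u v) q₀ :=
  contDiffAt_dirDeriv (contDiffAt_dirDeriv hf (m := n + 1) (by omega) _) (by omega) _

theorem exists_frame {f : ℝ × E3 → ℝ} (hf : ContDiffAt ℝ (2 : ℕ) f q₀) (hn : ‖q₀.2‖ = 1) :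
    ∃ u v : E3, Orthonormal ℝ ![u, v, q₀.2] ∧ spaceHess f u v q₀ = 0 := by
  have key : ∀ u v : E3, spaceHess f u v q₀ = fderiv ℝ (fderiv ℝ f) q₀ (0, u) (0, v) := by
    intro u v
    have hd : DifferentiableAt ℝ (fderiv ℝ f) q₀ :=
      (hf.fderiv_right (m := 1) (by norm_num)).differentiableAt one_ne_zero
    have := hd.hasFDerivAt.clm_apply (hasFDerivAt_const ((0, v) : ℝ × E3) q₀)
    change fderiv ℝ (fun y => fderiv ℝ f y (0, v)) q₀ (0, u) = _
    rw [this.fderiv]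
    simp
  obtain ⟨u, v, h1, h2⟩ := exists_orthonormal_triple_diag hn
    (LinearMap.mk₂ ℝ (fun u v => fderiv ℝ (fderiv ℝ f) q₀ (0, u) (0, v))
      (fun u u' v => by
        rw [show ((0, u + u') : ℝ × E3) = (0, u) + (0, u') by simp, map_add]; simp)
      (fun c u v => by
        rw [show ((0, c • u) : ℝ × E3) = c • (0, u) by simp, map_smul]; simp)
      (fun u v v' => by
        rw [show ((0, v + v') : ℝ × E3) = (0, v) + (0, v') by simp, map_add])
      (fun c u v => by
        rw [show ((0, c • v) : ℝ × E3) = c • (0, v) by simp, map_smul]))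
    (fun u v => hf.isSymmSndFDerivAt (by simp) _ _)
  exact ⟨u, v, h1, by rw [key]; exact h2⟩

theorem IsSupportFunction.isMaxAxis (hh : IsSupportFunction K q₀ h roc)
    (hreg : ∀ᶠ q in 𝓝 q₀, roc q ∈ rocRegion)
    (hAB : ∀ᶠ q in 𝓝 q₀, |coeffB H K (roc q)| ≤ coeffA H K (roc q))
    (hmax : ∀ᶠ q in 𝓝 q₀, q.1 = q₀.1 → H (roc q) ≤ H (roc q₀))
    {u v : E3} (huv : Orthonormal ℝ ![u, v, q₀.2]) :
    IsMaxAxis K H (roc q₀) (𝓝 0) (fun x => spaceHess h u u (q₀ + x • ((0, u) : ℝ × E3)))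
      (fun x => spaceHess h u v (q₀ + x • ((0, u) : ℝ × E3)))
      (fun x => spaceHess h v v (q₀ + x • ((0, u) : ℝ × E3)))
      (fun x => dirDeriv ((1, 0) : ℝ × E3) h (q₀ + x • ((0, u) : ℝ × E3))) := by
  have ht := tendsto_line q₀ ((0, u) : ℝ × E3)
  have heq : ∀ᶠ x in 𝓝 (0 : ℝ), axisRoc
      (fun x => spaceHess h u u (q₀ + x • ((0, u) : ℝ × E3)))
      (fun x => spaceHess h u v (q₀ + x • ((0, u) : ℝ × E3)))
      (fun x => spaceHess h v v (q₀ + x • ((0, u) : ℝ × E3))) x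
        = roc (q₀ + x • ((0, u) : ℝ × E3)) := by
    filter_upwards [ht.eventually hh.roc_eq] with x hx
    rw [hx u v q₀.2 x huv (by simp)]
    rfl
  refine ⟨?_, ?_, ?_, ?_⟩
  · filter_upwards [heq, ht.eventually hreg] with x h1 h2
    rwa [h1]
  · filter_upwards [heq, ht.eventually hh.speed] with x h1 h2
    rw [h1, h2]
    congr 2
    obtain ⟨e1, e2, e3, e4, e5, e6⟩ := (orthonormal_triple_iff _ _ _).1 huv
    have : ‖q₀.2 + x • u‖ ^ 2 = 1 + x ^ 2 := by
      rw [norm_add_sq_real, real_inner_smul_right, real_inner_comm, e5, norm_smul, e3, e1]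
      simp
    rw [← this, Real.sqrt_sq (norm_nonneg _)]
    simp
  · filter_upwards [heq, ht.eventually hmax] with x h1 h2
    rw [h1]
    exact h2 (by simp)
  · filter_upwards [heq, ht.eventually hAB] with x h1 h2
    rw [h1]
    exact (abs_nonneg _).trans h2

/-- Peano expansions of the Hessian entries along the two axes and backwards in time, expressed
through a common set of derivatives. -/
theorem exists_expansions (hh : ContDiffAt ℝ (6 : ℕ) h q₀) (u v : E3) :
    ∃ a₁ b₁ c₁ c₁' a₂ b₂ c₂ b₂' a₂' wx wy ta tb tc : ℝ,
      Peano2 (𝓝 0) (fun x => spaceHess h u u (q₀ + x • ((0, u) : ℝ × E3)))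
        (spaceHess h u u q₀) a₁ a₂ ∧
      Peano2 (𝓝 0) (fun x => spaceHess h u v (q₀ + x • ((0, u) : ℝ × E3)))
        (spaceHess h u v q₀) b₁ b₂ ∧
      Peano2 (𝓝 0) (fun x => spaceHess h v v (q₀ + x • ((0, u) : ℝ × E3)))
        (spaceHess h v v q₀) c₁ c₂ ∧
      Peano2 (𝓝 0) (fun x => spaceHess h v v (q₀ + x • ((0, v) : ℝ × E3)))
        (spaceHess h v v q₀) c₁' a₂' ∧
      Peano2 (𝓝 0) (fun x => spaceHess h v u (q₀ + x • ((0, v) : ℝ × E3)))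
        (spaceHess h u v q₀) c₁ b₂' ∧
      Peano2 (𝓝 0) (fun x => spaceHess h u u (q₀ + x • ((0, v) : ℝ × E3)))
        (spaceHess h u u q₀) b₁ c₂ ∧
      Peano2 (𝓝 0) (fun x => dirDeriv ((1, 0) : ℝ × E3) h (q₀ + x • ((0, u) : ℝ × E3)))
        (dirDeriv ((1, 0) : ℝ × E3) h q₀) wx
        (spaceHess (dirDeriv ((1, 0) : ℝ × E3) h) u u q₀) ∧
      Peano2 (𝓝 0) (fun x => dirDeriv ((1, 0) : ℝ × E3) h (q₀ + x • ((0, v) : ℝ × E3)))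
        (dirDeriv ((1, 0) : ℝ × E3) h q₀) wy
        (spaceHess (dirDeriv ((1, 0) : ℝ × E3) h) v v q₀) ∧
      Peano2 (𝓝 0) (fun x => spaceHess h u u (q₀ + x • ((-1, 0) : ℝ × E3)))
        (spaceHess h u u q₀) (-spaceHess (dirDeriv ((1, 0) : ℝ × E3) h) u u q₀) ta ∧
      Peano2 (𝓝 0) (fun x => spaceHess h u v (q₀ + x • ((-1, 0) : ℝ × E3)))
        (spaceHess h u v q₀) (-spaceHess (dirDeriv ((1, 0) : ℝ × E3) h) u v q₀) tb ∧
      Peano2 (𝓝 0) (fun x => spaceHess h v v (q₀ + x • ((-1, 0) : ℝ × E3)))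
        (spaceHess h v v q₀) (-spaceHess (dirDeriv ((1, 0) : ℝ × E3) h) v v q₀) tc := by
  have h5 : ∀ e, ContDiffAt ℝ (5 : ℕ) (dirDeriv e h) q₀ := fun e =>
    contDiffAt_dirDeriv hh (by norm_num) e
  have hS : ∀ u v, ContDiffAt ℝ (2 : ℕ) (spaceHess h u v) q₀ := fun u v =>
    spaceHess_contDiffAt (n := 2) (hh.of_le (by norm_num)) u v
  have cm : ∀ e e', dirDeriv e (dirDeriv e' h) =ᶠ[𝓝 q₀] dirDeriv e' (dirDeriv e h) :=
    dirDeriv_comm hh (by norm_num)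
  have cm2 : ∀ e e' e'', dirDeriv e (dirDeriv e' (dirDeriv e'' h))
      =ᶠ[𝓝 q₀] dirDeriv e' (dirDeriv e (dirDeriv e'' h)) :=
    fun e e' e'' => dirDeriv_comm (h5 e'') (by norm_num) e e'
  -- moving a derivative inside
  have mv : ∀ e e' e'', dirDeriv e (dirDeriv e' (dirDeriv e'' h))
      =ᶠ[𝓝 q₀] dirDeriv e' (dirDeriv e'' (dirDeriv e h)) := fun e e' e'' =>
    (cm2 e e' e'').trans (dirDeriv_congr (cm e e'') e')
  have time : ∀ u v, dirDeriv ((-1, 0) : ℝ × E3) (spaceHess h u v) q₀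
      = -spaceHess (dirDeriv ((1, 0) : ℝ × E3) h) u v q₀ := by
    intro u v
    have := (mv (1, 0) (0, u) (0, v)).eq_of_nhds
    rw [show ((-1, 0) : ℝ × E3) = -(1, 0) by simp, dirDeriv, map_neg]
    exact congrArg Neg.neg this
  have p := fun u v e => peano2_line (hS u v) e
  have pt := fun u v => time u v ▸ p u v (-1, 0)
  have e1 : spaceHess h v u q₀ = spaceHess h u v q₀ := (cm _ _).eq_of_nhds
  have e2 : dirDeriv ((0, v) : ℝ × E3) (spaceHess h v u) q₀
      = dirDeriv ((0, u) : ℝ × E3) (spaceHess h v v) q₀ :=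
    (mv (0, u) (0, v) (0, v)).symm.eq_of_nhds
  have e3 : dirDeriv ((0, v) : ℝ × E3) (spaceHess h u u) q₀
      = dirDeriv ((0, u) : ℝ × E3) (spaceHess h u v) q₀ :=
    (mv (0, v) (0, u) (0, u)).eq_of_nhds
  -- `h_uuvv = h_vvuu`: this is why the same `c₂` appears along both axes.
  have e4 : dirDeriv ((0, v) : ℝ × E3) (dirDeriv ((0, v) : ℝ × E3) (spaceHess h u u)) q₀
      = dirDeriv ((0, u) : ℝ × E3) (dirDeriv ((0, u) : ℝ × E3) (spaceHess h v v)) q₀ := by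
    have s1 : dirDeriv ((0, v) : ℝ × E3) (spaceHess h u u)
        =ᶠ[𝓝 q₀] dirDeriv ((0, u) : ℝ × E3) (spaceHess h u v) := mv _ _ _
    have s2 : dirDeriv ((0, v) : ℝ × E3) (spaceHess h u v)
        =ᶠ[𝓝 q₀] dirDeriv ((0, u) : ℝ × E3) (spaceHess h v v) :=
      cm2 (0, v) (0, u) (0, v)
    have s3 : dirDeriv ((0, v) : ℝ × E3) (dirDeriv ((0, u) : ℝ × E3) (spaceHess h u v))
        =ᶠ[𝓝 q₀] dirDeriv ((0, u) : ℝ × E3) (dirDeriv ((0, v) : ℝ × E3) (spaceHess h u v)) :=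
      dirDeriv_comm (hS u v) le_rfl _ _
    exact ((dirDeriv_congr s1 _).trans (s3.trans (dirDeriv_congr s2 _))).eq_of_nhds
  have pb' := p v u (0, v)
  rw [e1, e2] at pb'
  have pc' := p u u (0, v)
  rw [e3, e4] at pc'
  have hW := fun e => peano2_line ((h5 ((1, 0) : ℝ × E3)).of_le (by norm_num)) e
  exact ⟨_, _, _, _, _, _, _, _, _, _, _, _, _, _, p u u (0, u), p u v (0, u), p v v (0, u),
    p v v (0, v), pb', pc', hW (0, u), hW (0, v), pt u u, pt u v, pt v v⟩

/-- At a spatial maximum, `H ∘ f` is nonincreasing in time to first order, for fixed normal. -/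
theorem IsSupportFunction.exists_backward_expansion (hK : ContDiffOn ℝ 2 K rocRegion)
    (hH : ContDiffOn ℝ 2 H rocRegion) (hh : IsSupportFunction K q₀ h roc)
    (hreg : ∀ᶠ q in 𝓝 q₀, roc q ∈ rocRegion)
    (hpar : |d01 K (roc q₀)| < -d10 K (roc q₀))
    (hI : 0 ≤ poisson H (conserved K) (roc q₀))
    (hAB : ∀ᶠ q in 𝓝 q₀, |coeffB H K (roc q)| ≤ coeffA H K (roc q))
    (hmax : ∀ᶠ q in 𝓝 q₀, q.1 = q₀.1 → H (roc q) ≤ H (roc q₀)) :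
    ∃ U : ℝ, 0 ≤ U ∧ Peano1 (𝓝[>] 0) (fun x => H (roc (q₀ + x • ((-1, 0) : ℝ × E3))))
      (H (roc q₀)) U := by
  have hl := nhdsGT_le_nhds_zero
  have hreg0 := hreg.self_of_nhds
  have hAB0 := hAB.self_of_nhds
  rw [poisson_conserved_eq hK hreg0] at hI
  have ht := (tendsto_line q₀ ((-1, 0) : ℝ × E3))
  -- the radii of curvature at fixed normal in terms of a frame
  have hval : ∀ {u v : E3}, Orthonormal ℝ ![u, v, q₀.2] → ∀ᶠ x in 𝓝[>] (0 : ℝ),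
      roc (q₀ + x • ((-1, 0) : ℝ × E3))
        = ((spaceHess h u u (q₀ + x • ((-1, 0) : ℝ × E3))
            + spaceHess h v v (q₀ + x • ((-1, 0) : ℝ × E3))) / 2,
          √((spaceHess h u u (q₀ + x • ((-1, 0) : ℝ × E3))
            - spaceHess h v v (q₀ + x • ((-1, 0) : ℝ × E3))) ^ 2
            + 4 * spaceHess h u v (q₀ + x • ((-1, 0) : ℝ × E3)) ^ 2) / 2) := by
    intro u v huv
    filter_upwards [hl (ht.eventually hh.roc_eq)] with x hx
    rw [hx u v q₀.2 0 huv (by simp), gnomonicRoc_zero]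
  have hval0 : ∀ {u v : E3}, Orthonormal ℝ ![u, v, q₀.2] → roc q₀
        = ((spaceHess h u u q₀ + spaceHess h v v q₀) / 2,
          √((spaceHess h u u q₀ - spaceHess h v v q₀) ^ 2 + 4 * spaceHess h u v q₀ ^ 2) / 2) := by
    intro u v huv
    rw [hh.roc_eq.self_of_nhds u v q₀.2 0 huv (by simp), gnomonicRoc_zero]
  by_cases hσ : (roc q₀).2 = 0
  -- At an umbilic every frame diagonalizes the Hessian of `h`, so the frame is chosen to
  -- diagonalize that of `h_t`.
  · obtain ⟨u, v, huv, hw0⟩ := exists_frame (f := dirDeriv ((1, 0) : ℝ × E3) h)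
      ((contDiffAt_dirDeriv hh.contDiffAt (m := 5) (by norm_num) _).of_le (by norm_num))
      hh.norm_eq_one
    obtain ⟨a₁, b₁, c₁, c₁', a₂, b₂, c₂, b₂', a₂', wx, wy, ta, tb, tc, pa, pb, pc, pa', pb', pc',
      pw, pw', qa, qb, qc⟩ := exists_expansions hh.contDiffAt u v
    have hx := hh.isMaxAxis hreg hAB hmax huv
    have hy := hh.isMaxAxis hreg hAB hmax (orthonormal_swap huv)
    have h0 := hval0 huv
    have hv := hval huv
    have hs0 : (spaceHess h u u q₀ - spaceHess h v v q₀) ^ 2 + 4 * spaceHess h u v q₀ ^ 2 = 0 := by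
      rw [h0] at hσ
      have h1 : √((spaceHess h u u q₀ - spaceHess h v v q₀) ^ 2 + 4 * spaceHess h u v q₀ ^ 2) = 0 := by
        simpa using hσ
      rwa [Real.sqrt_eq_zero (by positivity)] at h1
    have hac : spaceHess h v v q₀ = spaceHess h u u q₀ := by
      nlinarith [sq_nonneg (spaceHess h u u q₀ - spaceHess h v v q₀), sq_nonneg (spaceHess h u v q₀)]
    have hb0 : spaceHess h u v q₀ = 0 := by
      nlinarith [sq_nonneg (spaceHess h u u q₀ - spaceHess h v v q₀), sq_nonneg (spaceHess h u v q₀)]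
    have hr0 : roc q₀ = (spaceHess h u u q₀, 0) := by
      rw [h0, hac, hb0]; simp
    rw [hac] at pc pa' qc
    rw [hb0] at pb pb' qb
    rw [hw0, neg_zero] at qb
    rw [hr0] at hreg0 hpar hI hAB0 hx hy ⊢
    have key := evolution_nonpos_umbilic hK hH hreg0 hx hy pa pb pc pa' pb' pc' pw pw' hpar
      (by simpa using hI) ((abs_nonneg _).trans hAB0)
    have T := peano1_time_umbilic hH ((qa.peano1 le_rfl).mono hl) ((qb.peano1 le_rfl).mono hl)
      ((qc.peano1 le_rfl).mono hl) hreg0 (by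
        filter_upwards [hv, hl (ht.eventually hreg)] with x h1 h2
        rwa [h1] at h2)
    refine ⟨_, ?_, T.congr (by filter_upwards [hv] with x h1; rw [h1])⟩
    -- Going backwards negates the rates of the Hessian entries, but `|σ|` still grows from zero;
    -- this is why `evolution_nonpos_umbilic` has a minus sign before the `H₀₁` term.
    rw [← abs_neg, show ∀ s t : ℝ, -(-s - -t) = s - t by intros; ring]
    linarith
  · obtain ⟨u, v, huv, hb0, hlt⟩ : ∃ u v : E3, Orthonormal ℝ ![u, v, q₀.2] ∧
        spaceHess h u v q₀ = 0 ∧ spaceHess h v v q₀ < spaceHess h u u q₀ := by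
      obtain ⟨u, v, huv, hb0⟩ := exists_frame (hh.contDiffAt.of_le (by norm_num)) hh.norm_eq_one
      rcases lt_trichotomy (spaceHess h v v q₀) (spaceHess h u u q₀) with hlt | heq | hgt
      · exact ⟨u, v, huv, hb0, hlt⟩
      · refine absurd ?_ hσ
        rw [hval0 huv, heq, hb0]; simp
      · refine ⟨v, u, orthonormal_swap huv, ?_, hgt⟩
        rw [← hb0]
        exact (dirDeriv_comm hh.contDiffAt (by norm_num) _ _).eq_of_nhds
    obtain ⟨a₁, b₁, c₁, c₁', a₂, b₂, c₂, b₂', a₂', wx, wy, ta, tb, tc, pa, pb, pc, pa', pb', pc',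
      pw, pw', qa, qb, qc⟩ := exists_expansions hh.contDiffAt u v
    have hx := hh.isMaxAxis hreg hAB hmax huv
    have hy := hh.isMaxAxis hreg hAB hmax (orthonormal_swap huv)
    have hv := hval huv
    have hr0 : roc q₀ = ((spaceHess h u u q₀ + spaceHess h v v q₀) / 2,
        (spaceHess h u u q₀ - spaceHess h v v q₀) / 2) := by
      rw [hval0 huv, hb0, show ∀ s : ℝ, s ^ 2 + 4 * 0 ^ 2 = s ^ 2 by intros; ring,
        Real.sqrt_sq (by linarith)]
    rw [hb0] at pb pb' qb
    rw [hr0] at hreg0 hpar hI hAB0 hx hy ⊢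
    have key := evolution_nonpos_nonumbilic hK hH hlt hreg0 hx hy pa pb pc pa' pb' pc' pw pw' hpar
      hI hAB0
    have T := peano1_time_nonumbilic hH hlt (qa.mono hl) (qb.mono hl) (qc.mono hl) hreg0 (by
        filter_upwards [hv, hl (ht.eventually hreg)] with x h1 h2
        rwa [h1] at h2)
    refine ⟨_, ?_, T.congr (by filter_upwards [hv] with x h1; rw [h1])⟩
    linarith

end SupportFunctionEvolution

/-! ### Radii of curvature from the two fundamental forms. -/

section Pencil

theorem eq_zero_of_inner_eq_zero {ν x y z : E3} (hν : ν ≠ 0) (hx : inner ℝ ν x = 0)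
    (hy : inner ℝ ν y = 0) (hxy : ∀ c d : ℝ, c • x + d • y = 0 → c = 0 ∧ d = 0)
    (h0 : inner ℝ ν z = 0) (h1 : inner ℝ z x = 0) (h2 : inner ℝ z y = 0) : z = 0 := by
  have hli : LinearIndependent ℝ ![ν, x, y] := by
    rw [Fintype.linearIndependent_iff]
    intro g hg
    simp only [Fin.sum_univ_three, Matrix.cons_val_zero, Matrix.cons_val_one,
      Matrix.cons_val] at hg
    have e0 : g 0 = 0 := by
      have := congrArg (fun w => inner ℝ ν w) hg
      simp only [inner_add_right, real_inner_smul_right, hx, hy, inner_zero_right, mul_zero,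
        add_zero] at this
      exact (mul_eq_zero.1 this).resolve_right (inner_self_ne_zero.2 hν)
    rw [e0, zero_smul, zero_add] at hg
    obtain ⟨e1, e2⟩ := hxy _ _ hg
    intro i
    fin_cases i
    exacts [e0, e1, e2]
  have hsp := hli.span_eq_top_of_card_eq_finrank (by simp)
  have hz : z ∈ Submodule.span ℝ (range ![ν, x, y]) := hsp ▸ Submodule.mem_top
  refine (inner_self_eq_zero (𝕜 := ℝ)).1 ?_
  have : ∀ w ∈ Submodule.span ℝ (range ![ν, x, y]), inner ℝ z w = 0 := by
    intro w hw
    induction hw using Submodule.span_induction with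
    | mem w hw =>
      obtain ⟨i, rfl⟩ := hw
      fin_cases i
      · simpa [real_inner_comm] using h0
      · simpa using h1
      · simpa using h2
    | zero => simp
    | add u v _ _ hu hv => rw [inner_add_right, hu, hv, add_zero]
    | smul c u _ hu => rw [real_inner_smul_right, hu, mul_zero]
  exact this z hz

theorem exists_ne_zero_of_det_eq_zero {m₁ m₂ m₃ : ℝ} (h : m₁ * m₃ - m₂ * m₂ = 0) :
    ∃ c d : ℝ, (c ≠ 0 ∨ d ≠ 0) ∧ c * m₁ + d * m₂ = 0 ∧ c * m₂ + d * m₃ = 0 := by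
  by_cases h1 : m₁ = 0
  · have h2 : m₂ = 0 := by
      rw [h1] at h
      nlinarith
    exact ⟨1, 0, by simp, by simp [h1], by simp [h2]⟩
  · exact ⟨m₂, -m₁, Or.inr (neg_ne_zero.2 h1), by ring, by linarith⟩

variable {V : Type*} [AddCommGroup V] [Module ℝ V] {P N : V →ₗ[ℝ] E3} {ν : E3} {v₁ v₂ : V}

/-- The vector `N v - κ P v` is orthogonal to `ν`, so it vanishes as soon as it is orthogonal to `P
v₁` and `P v₂`. That is a homogeneous linear system in the coordinates of `v`, with determinant `det
(b - κ g)`. -/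
theorem exists_eigenvector_iff (hspan : ∀ w, ∃ c d : ℝ, w = c • v₁ + d • v₂)
    (hli : ∀ c d : ℝ, c • v₁ + d • v₂ = 0 → c = 0 ∧ d = 0)
    (hP : Function.Injective P) (hν : ν ≠ 0) (hνP : ∀ v, inner ℝ ν (P v) = 0)
    (hνN : ∀ v, inner ℝ ν (N v) = 0) (hsymm : inner ℝ (N v₁) (P v₂) = inner ℝ (N v₂) (P v₁))
    (κ : ℝ) : (∃ v, v ≠ 0 ∧ N v = κ • P v) ↔
      (inner ℝ (N v₁) (P v₁) - κ * inner ℝ (P v₁) (P v₁))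
        * (inner ℝ (N v₂) (P v₂) - κ * inner ℝ (P v₂) (P v₂))
      - (inner ℝ (N v₁) (P v₂) - κ * inner ℝ (P v₁) (P v₂))
        * (inner ℝ (N v₁) (P v₂) - κ * inner ℝ (P v₁) (P v₂)) = 0 := by
  have hcomm : inner ℝ (P v₂) (P v₁) = inner ℝ (P v₁) (P v₂) := real_inner_comm _ _
  constructor
  · rintro ⟨w, hw0, hw⟩
    obtain ⟨c, d, rfl⟩ := hspan w
    have e1 := congrArg (fun y => inner ℝ y (P v₁)) hw
    have e2 := congrArg (fun y => inner ℝ y (P v₂)) hw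
    simp only [map_add, map_smul, smul_add, inner_add_left, real_inner_smul_left, ← hsymm,
      hcomm] at e1 e2
    by_contra hdet
    refine hw0 ?_
    have hc : c = 0 := by
      refine (mul_eq_zero.1 ?_).resolve_right hdet
      linear_combination (inner ℝ (N v₂) (P v₂) - κ * inner ℝ (P v₂) (P v₂)) * e1
        - (inner ℝ (N v₁) (P v₂) - κ * inner ℝ (P v₁) (P v₂)) * e2
    have hd : d = 0 := by
      refine (mul_eq_zero.1 ?_).resolve_right hdet
      linear_combination (inner ℝ (N v₁) (P v₁) - κ * inner ℝ (P v₁) (P v₁)) * e2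
        - (inner ℝ (N v₁) (P v₂) - κ * inner ℝ (P v₁) (P v₂)) * e1
    simp [hc, hd]
  · intro hdet
    obtain ⟨c, d, hcd, e1, e2⟩ := exists_ne_zero_of_det_eq_zero hdet
    refine ⟨c • v₁ + d • v₂, fun h0 => ?_, ?_⟩
    · obtain ⟨h1, h2⟩ := hli c d h0
      simp [h1, h2] at hcd
    · refine sub_eq_zero.1 (eq_zero_of_inner_eq_zero hν (hνP v₁) (hνP v₂) ?_ ?_ ?_ ?_)
      · intro c d h
        rw [← map_smul, ← map_smul, ← map_add] at h
        exact hli c d (hP (by rw [h, map_zero]))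
      · rw [inner_sub_right, real_inner_smul_right, hνN, hνP, mul_zero, sub_zero]
      · simp only [map_add, map_smul, smul_add, inner_sub_left, inner_add_left,
          real_inner_smul_left, ← hsymm, hcomm]
        linear_combination e1
      · simp only [map_add, map_smul, smul_add, inner_sub_left, inner_add_left,
          real_inner_smul_left]
        linear_combination e2

theorem gram_pos (hli : ∀ c d : ℝ, c • v₁ + d • v₂ = 0 → c = 0 ∧ d = 0)
    (hP : Function.Injective P) : 0 < inner ℝ (P v₁) (P v₁) ∧
      0 < inner ℝ (P v₁) (P v₁) * inner ℝ (P v₂) (P v₂) - inner ℝ (P v₁) (P v₂) ^ 2 := by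
  have hcomm : inner ℝ (P v₂) (P v₁) = inner ℝ (P v₁) (P v₂) := real_inner_comm _ _
  have key : ∀ c d : ℝ, (c ≠ 0 ∨ d ≠ 0) → 0 < inner ℝ (P (c • v₁ + d • v₂)) (P (c • v₁ + d • v₂)) := by
    intro c d hcd
    refine real_inner_self_pos.2 fun h0 => ?_
    obtain ⟨h1, h2⟩ := hli c d (hP (by rw [h0, map_zero]))
    simp [h1, h2] at hcd
  have h1 : 0 < inner ℝ (P v₁) (P v₁) := by simpa using key 1 0 (by simp)
  refine ⟨h1, ?_⟩
  -- The Gram–Schmidt vector `g₁ v₂ - g₂ v₁`; the squared length of its image is `g₁ (g₁ g₃ - g₂²)`.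
  have h2 := key (-inner ℝ (P v₁) (P v₂)) (inner ℝ (P v₁) (P v₁)) (Or.inr h1.ne')
  simp only [map_add, map_smul, inner_add_left, inner_add_right, real_inner_smul_left,
    real_inner_smul_right, hcomm] at h2
  refine (mul_pos_iff_of_pos_left h1).1 ?_
  linarith

theorem discriminant_nonneg {g₁ g₂ g₃ b₁ b₂ b₃ : ℝ} (hg : 0 < g₁) (hG : 0 < g₁ * g₃ - g₂ ^ 2) :
    0 ≤ (b₁ * g₃ + b₃ * g₁ - 2 * b₂ * g₂) ^ 2
      - 4 * (g₁ * g₃ - g₂ ^ 2) * (b₁ * b₃ - b₂ ^ 2) := by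
  refine (mul_nonneg_iff_of_pos_left (pow_pos hg 2)).1 ?_
  have : 0 ≤ (b₁ * (g₁ * g₃ - g₂ ^ 2) - (g₁ ^ 2 * b₃ - 2 * g₁ * g₂ * b₂ + g₂ ^ 2 * b₁)) ^ 2
      + 4 * (g₁ * g₃ - g₂ ^ 2) * (g₁ * b₂ - g₂ * b₁) ^ 2 := by positivity
  linarith

/-- The radii of curvature in terms of the first fundamental form `g` and the second fundamental
form `b` in a basis. -/
theorem radii_of_fundamental_forms {R : Set ℝ}
    (hspan : ∀ w, ∃ c d : ℝ, w = c • v₁ + d • v₂)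
    (hli : ∀ c d : ℝ, c • v₁ + d • v₂ = 0 → c = 0 ∧ d = 0)
    (hP : Function.Injective P) (hν : ν ≠ 0) (hνP : ∀ v, inner ℝ ν (P v) = 0)
    (hνN : ∀ v, inner ℝ ν (N v) = 0) (hsymm : inner ℝ (N v₁) (P v₂) = inner ℝ (N v₂) (P v₁))
    (hpos : ∀ κ : ℝ, (∃ v, v ≠ 0 ∧ N v = κ • P v) → 0 < κ)
    (hR : R = {ρ | ∃ κ, (∃ v, v ≠ 0 ∧ N v = κ • P v) ∧ ρ = κ⁻¹})
    {g₁ g₂ g₃ b₁ b₂ b₃ T D : ℝ} (hg₁ : g₁ = inner ℝ (P v₁) (P v₁))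
    (hg₂ : g₂ = inner ℝ (P v₁) (P v₂)) (hg₃ : g₃ = inner ℝ (P v₂) (P v₂))
    (hb₁ : b₁ = inner ℝ (N v₁) (P v₁)) (hb₂ : b₂ = inner ℝ (N v₁) (P v₂))
    (hb₃ : b₃ = inner ℝ (N v₂) (P v₂))
    (hT : T = (b₁ * g₃ + b₃ * g₁ - 2 * b₂ * g₂) / (b₁ * b₃ - b₂ ^ 2))
    (hD : D = (g₁ * g₃ - g₂ ^ 2) / (b₁ * b₃ - b₂ ^ 2)) :
    b₁ * b₃ - b₂ ^ 2 ≠ 0 ∧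
    ((sSup R + sInf R) / 2, (sSup R - sInf R) / 2) = (T / 2, √(T ^ 2 / 4 - D)) ∧
    (T / 2, √(T ^ 2 / 4 - D)) ∈ rocRegion := by
  have hiff := exists_eigenvector_iff hspan hli hP hν hνP hνN hsymm
  obtain ⟨hg, hG⟩ := gram_pos hli hP
  rw [← hg₁, ← hg₂, ← hg₃] at hG
  rw [← hg₁] at hg
  simp only [← hg₁, ← hg₂, ← hg₃, ← hb₁, ← hb₂, ← hb₃] at hiff
  have hdet : b₁ * b₃ - b₂ ^ 2 ≠ 0 := fun h0 =>
    lt_irrefl _ (hpos 0 ((hiff 0).2 (by linear_combination h0)))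
  have hdisc : 0 ≤ T ^ 2 / 4 - D := by
    have := div_nonneg (discriminant_nonneg (b₁ := b₁) (b₂ := b₂) (b₃ := b₃) hg hG)
      (show 0 ≤ 4 * (b₁ * b₃ - b₂ ^ 2) ^ 2 by positivity)
    refine this.trans (le_of_eq ?_)
    rw [hT, hD]
    field_simp
  set δ := √(T ^ 2 / 4 - D) with hδ
  have hδ0 : 0 ≤ δ := Real.sqrt_nonneg _
  have hδ2 : δ ^ 2 = T ^ 2 / 4 - D := Real.sq_sqrt hdisc
  have hmem : ∀ ρ, ρ ∈ R ↔ ρ = T / 2 + δ ∨ ρ = T / 2 - δ := by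
    intro ρ
    -- The radii are reciprocals of the roots of `det (b - κ g)`, so they are the roots of the
    -- reversed polynomial; `T` and `D` are their sum and product.
    have hquad : (ρ = T / 2 + δ ∨ ρ = T / 2 - δ) ↔
        (b₁ * b₃ - b₂ ^ 2) * ρ ^ 2 - (b₁ * g₃ + b₃ * g₁ - 2 * b₂ * g₂) * ρ
          + (g₁ * g₃ - g₂ ^ 2) = 0 := by
      have hS : b₁ * g₃ + b₃ * g₁ - 2 * b₂ * g₂ = T * (b₁ * b₃ - b₂ ^ 2) := by
        rw [hT]; field_simp
      have hGD : g₁ * g₃ - g₂ ^ 2 = D * (b₁ * b₃ - b₂ ^ 2) := by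
        rw [hD]; field_simp
      rw [hS, hGD, show (b₁ * b₃ - b₂ ^ 2) * ρ ^ 2 - T * (b₁ * b₃ - b₂ ^ 2) * ρ
        + D * (b₁ * b₃ - b₂ ^ 2) = (b₁ * b₃ - b₂ ^ 2) * ((ρ - (T / 2 + δ)) * (ρ - (T / 2 - δ))) by
          linear_combination (b₁ * b₃ - b₂ ^ 2) * hδ2]
      simp [hdet, sub_eq_zero]
    rw [hquad, hR]
    constructor
    · rintro ⟨κ, hκ, rfl⟩
      have hκ0 : κ ≠ 0 := (hpos κ hκ).ne'
      have := (hiff κ).1 hκ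
      field_simp
      linear_combination this
    · intro h
      have hρ : ρ ≠ 0 := by
        rintro rfl
        simp only [ne_eq, OfNat.ofNat_ne_zero, not_false_eq_true, zero_pow, mul_zero, sub_zero,
          zero_add] at h
        exact hG.ne' h
      refine ⟨ρ⁻¹, (hiff ρ⁻¹).2 ?_, (inv_inv ρ).symm⟩
      field_simp
      linear_combination h
  have hRp : R = {T / 2 + δ, T / 2 - δ} := by
    ext ρ; simp [hmem]
  have hsup : sSup R = T / 2 + δ := by
    rw [hRp, csSup_pair]; exact max_eq_left (by linarith)
  have hinf : sInf R = T / 2 - δ := by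
    rw [hRp, csInf_pair]; exact min_eq_right (by linarith)
  refine ⟨hdet, ?_, hδ0, ?_⟩
  · rw [hsup, hinf]
    ext <;> simp
  · have h2 : T / 2 - δ ∈ R := (hmem _).2 (Or.inr rfl)
    rw [hR] at h2
    obtain ⟨κ, hκ, h3⟩ := h2
    have : 0 < T / 2 - δ := by rw [h3]; exact inv_pos.2 (hpos κ hκ)
    simp only
    linarith

end Pencil

/-! ### The surface read in a chart of the sphere. -/

section Charts

open Filter Topology

/-- The model space of the charts of the sphere. -/
abbrev E2 : Type := EuclideanSpace ℝ (Fin 2)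

/-- A time-dependent map on the sphere read in the chart at `p₀`. -/
noncomputable def chartRep (p₀ : S2) (X : ℝ → S2 → E3) (q : ℝ × E2) : E3 :=
  X q.1 ((extChartAt (𝓡 2) p₀).symm q.2)

theorem contDiffOn_chartRep {X : ℝ → S2 → E3} {I : Set ℝ} (p₀ : S2)
    (hX : ContMDiffOn (𝓘(ℝ, ℝ).prod (𝓡 2)) 𝓘(ℝ, E3) ∞ (fun q : ℝ × S2 => X q.1 q.2)
      (I ×ˢ univ)) :
    ContDiffOn ℝ ∞ (chartRep p₀ X) (I ×ˢ (extChartAt (𝓡 2) p₀).target) := by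
  rw [← contMDiffOn_iff_contDiffOn]
  have h1 : ContMDiffOn 𝓘(ℝ, ℝ × E2) (𝓡 2) ∞ (fun q : ℝ × E2 => (extChartAt (𝓡 2) p₀).symm q.2)
      (I ×ˢ (extChartAt (𝓡 2) p₀).target) :=
    (contMDiffOn_extChartAt_symm (n := ∞) p₀).comp contDiff_snd.contMDiff.contMDiffOn
      (fun q hq => hq.2)
  have h2 : ContMDiffOn 𝓘(ℝ, ℝ × E2) 𝓘(ℝ, ℝ) ∞ (fun q : ℝ × E2 => q.1)
      (I ×ˢ (extChartAt (𝓡 2) p₀).target) := contDiff_fst.contMDiff.contMDiffOn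
  exact hX.comp (h2.prodMk h1) (fun q hq => ⟨hq.1, mem_univ _⟩)

theorem contMDiff_slice {X : ℝ → S2 → E3} {I : Set ℝ}
    (hX : ContMDiffOn (𝓘(ℝ, ℝ).prod (𝓡 2)) 𝓘(ℝ, E3) ∞ (fun q : ℝ × S2 => X q.1 q.2)
      (I ×ˢ univ)) {t : ℝ} (ht : t ∈ I) : ContMDiff (𝓡 2) 𝓘(ℝ, E3) ∞ (X t) := by
  rw [← contMDiffOn_univ]
  exact hX.comp ((contMDiff_const.prodMk contMDiff_id).contMDiffOn (s := univ))
    (fun p _ => ⟨ht, mem_univ _⟩)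

variable {Y ν : S2 → E3} {p₀ : S2} {x : E2}

theorem contDiffAt_comp_chart (hY : ContMDiff (𝓡 2) 𝓘(ℝ, E3) ∞ Y)
    (hx : x ∈ (extChartAt (𝓡 2) p₀).target) :
    ContDiffAt ℝ ∞ (fun y => Y ((extChartAt (𝓡 2) p₀).symm y)) x := by
  have h : ContMDiffOn 𝓘(ℝ, E2) 𝓘(ℝ, E3) ∞ (fun y => Y ((extChartAt (𝓡 2) p₀).symm y))
      (extChartAt (𝓡 2) p₀).target := hY.comp_contMDiffOn (contMDiffOn_extChartAt_symm p₀)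
  exact (contMDiffOn_iff_contDiffOn.1 h).contDiffAt ((isOpen_extChartAt_target p₀).mem_nhds hx)

/-- The differential of the inverse of the chart at `p₀`. -/
noncomputable def dChartSymm (p₀ : S2) (x : E2) :
    E2 →L[ℝ] TangentSpace (𝓡 2) ((extChartAt (𝓡 2) p₀).symm x) :=
  mfderiv 𝓘(ℝ, E2) (𝓡 2) (extChartAt (𝓡 2) p₀).symm x

theorem dChartSymm_bijective (hx : x ∈ (extChartAt (𝓡 2) p₀).target) :
    Function.Bijective (dChartSymm p₀ x) := by
  have h := isInvertible_mfderivWithin_extChartAt_symm (I := 𝓡 2) (x := p₀) hx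
  rw [ModelWithCorners.range_eq_univ, mfderivWithin_univ] at h
  exact h.bijective

theorem dAt_dChartSymm (hY : ContMDiff (𝓡 2) 𝓘(ℝ, E3) ∞ Y)
    (hx : x ∈ (extChartAt (𝓡 2) p₀).target) (v : E2) :
    dAt Y ((extChartAt (𝓡 2) p₀).symm x) (dChartSymm p₀ x v)
      = fderiv ℝ (fun y => Y ((extChartAt (𝓡 2) p₀).symm y)) x v := by
  have h1 : MDifferentiableAt (𝓡 2) 𝓘(ℝ, E3) Y ((extChartAt (𝓡 2) p₀).symm x) :=
    (hY _).mdifferentiableAt (by simp)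
  have h2 : MDifferentiableAt 𝓘(ℝ, E2) (𝓡 2) (extChartAt (𝓡 2) p₀).symm x :=
    ((contMDiffOn_extChartAt_symm (n := ∞) p₀).contMDiffAt
      ((isOpen_extChartAt_target p₀).mem_nhds hx)).mdifferentiableAt (by simp)
  rw [← mfderiv_eq_fderiv]
  have := mfderiv_comp x h1 h2
  change _ = mfderiv 𝓘(ℝ, E2) 𝓘(ℝ, E3) (Y ∘ (extChartAt (𝓡 2) p₀).symm) x v
  rw [this]
  rfl

/-- Differentiating `⟨ν, dY w⟩ = 0` expresses the second fundamental form through the second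
derivative of `Y`, which is symmetric. -/
theorem inner_fderiv_symm (hY : ContMDiff (𝓡 2) 𝓘(ℝ, E3) ∞ Y)
    (hν : ContMDiff (𝓡 2) 𝓘(ℝ, E3) ∞ ν) (hc : IsConvexEmbedding Y ν)
    (hx : x ∈ (extChartAt (𝓡 2) p₀).target) (v w : E2) :
    inner ℝ (fderiv ℝ (fun y => ν ((extChartAt (𝓡 2) p₀).symm y)) x v)
        (fderiv ℝ (fun y => Y ((extChartAt (𝓡 2) p₀).symm y)) x w)
      = inner ℝ (fderiv ℝ (fun y => ν ((extChartAt (𝓡 2) p₀).symm y)) x w)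
        (fderiv ℝ (fun y => Y ((extChartAt (𝓡 2) p₀).symm y)) x v) := by
  set Yc := fun y => Y ((extChartAt (𝓡 2) p₀).symm y) with hYc
  set νc := fun y => ν ((extChartAt (𝓡 2) p₀).symm y) with hνc
  have hY1 := contDiffAt_comp_chart hY hx
  have hν1 := contDiffAt_comp_chart hν hx
  have hY2 : ContDiffAt ℝ 2 Yc x := contDiffAt_infty.1 hY1 2
  have hν2 : ContDiffAt ℝ 1 νc x := contDiffAt_infty.1 hν1 1
  have hd : DifferentiableAt ℝ (fderiv ℝ Yc) x :=
    (hY2.fderiv_right (m := 1) (by norm_num)).differentiableAt one_ne_zero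
  have hzero : ∀ w, (fun y => inner ℝ (νc y) (fderiv ℝ Yc y w)) =ᶠ[𝓝 x] fun _ => (0 : ℝ) := by
    intro w
    filter_upwards [(isOpen_extChartAt_target p₀).mem_nhds hx] with y hy
    rw [hYc, ← dAt_dChartSymm hY hy]
    exact hc.normal _ _
  have key : ∀ v w, inner ℝ (fderiv ℝ νc x v) (fderiv ℝ Yc x w)
      = -inner ℝ (νc x) (fderiv ℝ (fderiv ℝ Yc) x v w) := by
    intro v w
    have e1 : HasFDerivAt (fun y => fderiv ℝ Yc y w) _ x :=
      hd.hasFDerivAt.clm_apply (hasFDerivAt_const w x)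
    have e2 := fderiv_inner_apply ℝ (hν2.differentiableAt one_ne_zero) e1.differentiableAt v
    rw [(hzero w).fderiv_eq, e1.fderiv] at e2
    simp at e2
    linarith
  rw [key, key, hY2.isSymmSndFDerivAt (by simp) v w]

theorem inner_normal_fderiv (hν : ContMDiff (𝓡 2) 𝓘(ℝ, E3) ∞ ν) (hc : IsConvexEmbedding Y ν)
    (hx : x ∈ (extChartAt (𝓡 2) p₀).target) (v : E2) :
    inner ℝ (ν ((extChartAt (𝓡 2) p₀).symm x))
      (fderiv ℝ (fun y => ν ((extChartAt (𝓡 2) p₀).symm y)) x v) = 0 := by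
  set νc := fun y => ν ((extChartAt (𝓡 2) p₀).symm y) with hνc
  have hν1 := contDiffAt_comp_chart hν hx
  have hν2 : ContDiffAt ℝ 1 νc x := contDiffAt_infty.1 hν1 1
  have e1 := hν2.differentiableAt one_ne_zero
  have e2 := fderiv_inner_apply ℝ e1 e1 v
  have e3 : (fun y => inner ℝ (νc y) (νc y)) = fun _ => (1 : ℝ) := by
    funext y
    rw [real_inner_self_eq_norm_sq, hνc, hc.unit, one_pow]
  rw [e3, real_inner_comm (νc x) (fderiv ℝ νc x v)] at e2
  simp at e2
  change inner ℝ (νc x) (fderiv ℝ νc x v) = 0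
  linarith

theorem radiiOfCurvature_eq_chart (hY : ContMDiff (𝓡 2) 𝓘(ℝ, E3) ∞ Y)
    (hν : ContMDiff (𝓡 2) 𝓘(ℝ, E3) ∞ ν) (hx : x ∈ (extChartAt (𝓡 2) p₀).target) (κ : ℝ) :
    IsPrincipalCurvature Y ν ((extChartAt (𝓡 2) p₀).symm x) κ ↔ ∃ v : E2, v ≠ 0 ∧
      fderiv ℝ (fun y => ν ((extChartAt (𝓡 2) p₀).symm y)) x v
        = κ • fderiv ℝ (fun y => Y ((extChartAt (𝓡 2) p₀).symm y)) x v := by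
  obtain ⟨hinj, hsurj⟩ := dChartSymm_bijective (p₀ := p₀) hx
  constructor
  · rintro ⟨v, hv0, hv⟩
    obtain ⟨w, rfl⟩ := hsurj v
    rw [dAt_dChartSymm hY hx, dAt_dChartSymm hν hx] at hv
    exact ⟨w, fun h => hv0 (by rw [h, map_zero]), hv⟩
  · rintro ⟨v, hv0, hv⟩
    refine ⟨dChartSymm p₀ x v, fun h => hv0 (hinj (by rw [h, map_zero])), ?_⟩
    rwa [dAt_dChartSymm hY hx, dAt_dChartSymm hν hx]

/-- The radii of curvature map computed from the fundamental forms in a chart, for any basis of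
the model space. -/
theorem rocMap_eq_of_chart (hY : ContMDiff (𝓡 2) 𝓘(ℝ, E3) ∞ Y)
    (hν : ContMDiff (𝓡 2) 𝓘(ℝ, E3) ∞ ν) (hc : IsConvexEmbedding Y ν)
    (hx : x ∈ (extChartAt (𝓡 2) p₀).target) {v₁ v₂ : E2}
    (hli : LinearIndependent ℝ ![v₁, v₂]) {P N : E2 →L[ℝ] E3}
    (hP : P = fderiv ℝ (fun y => Y ((extChartAt (𝓡 2) p₀).symm y)) x)
    (hN : N = fderiv ℝ (fun y => ν ((extChartAt (𝓡 2) p₀).symm y)) x)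
    {g₁ g₂ g₃ b₁ b₂ b₃ T D : ℝ} (hg₁ : g₁ = inner ℝ (P v₁) (P v₁))
    (hg₂ : g₂ = inner ℝ (P v₁) (P v₂)) (hg₃ : g₃ = inner ℝ (P v₂) (P v₂))
    (hb₁ : b₁ = inner ℝ (N v₁) (P v₁)) (hb₂ : b₂ = inner ℝ (N v₁) (P v₂))
    (hb₃ : b₃ = inner ℝ (N v₂) (P v₂))
    (hT : T = (b₁ * g₃ + b₃ * g₁ - 2 * b₂ * g₂) / (b₁ * b₃ - b₂ ^ 2))
    (hD : D = (g₁ * g₃ - g₂ ^ 2) / (b₁ * b₃ - b₂ ^ 2)) :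
    b₁ * b₃ - b₂ ^ 2 ≠ 0 ∧
    rocMap Y ν ((extChartAt (𝓡 2) p₀).symm x) = (T / 2, √(T ^ 2 / 4 - D)) ∧
    (T / 2, √(T ^ 2 / 4 - D)) ∈ rocRegion := by
  have hspan : ∀ w : E2, ∃ c d : ℝ, w = c • v₁ + d • v₂ := by
    intro w
    have h1 := hli.span_eq_top_of_card_eq_finrank (by simp)
    have h2 : w ∈ Submodule.span ℝ (range ![v₁, v₂]) := h1 ▸ Submodule.mem_top
    simp only [Matrix.range_cons, Matrix.range_empty, union_empty, singleton_union] at h2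
    obtain ⟨c, d, h⟩ := Submodule.mem_span_pair.1 h2
    exact ⟨c, d, h.symm⟩
  obtain ⟨hinj, hsurj⟩ := dChartSymm_bijective (p₀ := p₀) hx
  have hiff := radiiOfCurvature_eq_chart (p₀ := p₀) hY hν hx
  simp only [← hP, ← hN] at hiff
  refine radii_of_fundamental_forms (P := P.toLinearMap) (N := N.toLinearMap)
    (ν := ν ((extChartAt (𝓡 2) p₀).symm x))
    (R := radiiOfCurvature Y ν ((extChartAt (𝓡 2) p₀).symm x)) hspan
    (fun c d h => LinearIndependent.pair_iff.1 hli c d h) ?_ ?_ ?_ ?_ ?_ ?_ ?_ hg₁ hg₂ hg₃ hb₁ hb₂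
    hb₃ hT hD
  · intro v w hvw
    have hvw' : P v = P w := hvw
    rw [hP, ← dAt_dChartSymm hY hx, ← dAt_dChartSymm hY hx] at hvw'
    exact hinj (hc.immersion _ hvw')
  · intro h0
    have := hc.unit ((extChartAt (𝓡 2) p₀).symm x)
    rw [h0, norm_zero] at this
    exact zero_ne_one this
  · intro v
    change inner ℝ _ (P v) = 0
    rw [hP, ← dAt_dChartSymm hY hx]
    exact hc.normal _ _
  · intro v
    change inner ℝ _ (N v) = 0
    rw [hN]
    exact inner_normal_fderiv hν hc hx v
  · change inner ℝ (N v₁) (P v₂) = inner ℝ (N v₂) (P v₁)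
    rw [hP, hN]
    exact inner_fderiv_symm hY hν hc hx v₁ v₂
  · intro κ hκ
    exact hc.pos_curvature _ κ ((hiff κ).2 hκ)
  · ext ρ
    simp only [radiiOfCurvature, hiff]
    rfl

end Charts

/-! ### Joint continuity of the radii of curvature map, up to `t = 0`. -/

section Continuity

open Filter Topology

variable {K : ℝ × ℝ → ℝ} {t₁ : ℝ} {X n : ℝ → S2 → E3}

theorem linearIndependent_single :
    LinearIndependent ℝ ![(EuclideanSpace.single 0 1 : E2), EuclideanSpace.single 1 1] := by
  rw [LinearIndependent.pair_iff]
  intro s t h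
  have h0 := congrArg (fun w : E2 => w 0) h
  have h1 := congrArg (fun w : E2 => w 1) h
  simp at h0 h1
  exact ⟨h0, h1⟩

theorem IsClassicalCurvatureFlow.rocMap_mem (hflow : IsClassicalCurvatureFlow K t₁ X n) {t : ℝ}
    (ht : t ∈ Ico 0 t₁) (p : S2) : rocMap (X t) (n t) p ∈ rocRegion := by
  have hx := mem_extChartAt_target (I := 𝓡 2) p
  have h := rocMap_eq_of_chart (p₀ := p) (contMDiff_slice hflow.smooth ht)
    (contMDiff_slice hflow.smooth_normal ht) (hflow.convex t ht) hx linearIndependent_single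
    rfl rfl rfl rfl rfl rfl rfl rfl rfl rfl
  rw [extChartAt_to_inv] at h
  rw [h.2.1]
  exact h.2.2

/-- At `t = 0` the flow is smooth only from one side, so spatial derivatives are extracted from the
joint derivative within the domain, which is continuous there. -/
theorem fderiv_chart_slice {I : Set ℝ} {Z : ℝ → S2 → E3}
    (hZ : ContMDiffOn (𝓘(ℝ, ℝ).prod (𝓡 2)) 𝓘(ℝ, E3) ∞ (fun q : ℝ × S2 => Z q.1 q.2)
      (I ×ˢ univ)) (p₀ : S2) {q : ℝ × E2} (hq : q ∈ I ×ˢ (extChartAt (𝓡 2) p₀).target) :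
    fderiv ℝ (fun y => Z q.1 ((extChartAt (𝓡 2) p₀).symm y)) q.2
      = (fderivWithin ℝ (chartRep p₀ Z) (I ×ˢ (extChartAt (𝓡 2) p₀).target) q).comp
        (ContinuousLinearMap.inr ℝ ℝ E2) := by
  have h1 := ((contDiffOn_chartRep p₀ hZ).differentiableOn (by simp) q hq).hasFDerivWithinAt
  have h2 : HasFDerivAt (fun y : E2 => (q.1, y)) (ContinuousLinearMap.inr ℝ ℝ E2) q.2 :=
    hasFDerivAt_prodMk_right q.1 q.2
  have hm : MapsTo (fun y : E2 => (q.1, y)) (extChartAt (𝓡 2) p₀).target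
      (I ×ˢ (extChartAt (𝓡 2) p₀).target) := fun y hy => ⟨hq.1, hy⟩
  have h3 := h1.comp q.2 (h2.hasFDerivWithinAt (s := (extChartAt (𝓡 2) p₀).target)) hm
  exact (h3.hasFDerivAt ((isOpen_extChartAt_target p₀).mem_nhds hq.2)).fderiv

theorem IsClassicalCurvatureFlow.continuousOn_rocMap (hflow : IsClassicalCurvatureFlow K t₁ X n) :
    ContinuousOn (fun q : ℝ × S2 => rocMap (X q.1) (n q.1) q.2) (Ico 0 t₁ ×ˢ univ) := by
  rintro ⟨t, p⟩ ⟨ht, -⟩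
  set φ := extChartAt (𝓡 2) p with hφ
  set S : Set (ℝ × E2) := Ico 0 t₁ ×ˢ φ.target with hS
  have huS : UniqueDiffOn ℝ S := (uniqueDiffOn_Ico 0 t₁).prod (isOpen_extChartAt_target p).uniqueDiffOn
  set P : E2 → ℝ × E2 → E3 := fun v q => fderivWithin ℝ (chartRep p X) S q (0, v) with hP
  set N : E2 → ℝ × E2 → E3 := fun v q => fderivWithin ℝ (chartRep p n) S q (0, v) with hN
  have cP : ∀ v, ContinuousOn (P v) S := fun v =>
    ((contDiffOn_chartRep p hflow.smooth).continuousOn_fderivWithin huS (by simp)).clm_apply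
      continuousOn_const
  have cN : ∀ v, ContinuousOn (N v) S := fun v =>
    ((contDiffOn_chartRep p hflow.smooth_normal).continuousOn_fderivWithin huS (by simp)).clm_apply
      continuousOn_const
  set e : E2 := EuclideanSpace.single 0 1
  set e' : E2 := EuclideanSpace.single 1 1
  set T : ℝ × E2 → ℝ := fun q => (inner ℝ (N e q) (P e q) * inner ℝ (P e' q) (P e' q)
      + inner ℝ (N e' q) (P e' q) * inner ℝ (P e q) (P e q)
      - 2 * inner ℝ (N e q) (P e' q) * inner ℝ (P e q) (P e' q))
    / (inner ℝ (N e q) (P e q) * inner ℝ (N e' q) (P e' q) - inner ℝ (N e q) (P e' q) ^ 2) with hT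
  set D : ℝ × E2 → ℝ := fun q => (inner ℝ (P e q) (P e q) * inner ℝ (P e' q) (P e' q)
      - inner ℝ (P e q) (P e' q) ^ 2)
    / (inner ℝ (N e q) (P e q) * inner ℝ (N e' q) (P e' q) - inner ℝ (N e q) (P e' q) ^ 2) with hD
  have key : ∀ q ∈ S,
      inner ℝ (N e q) (P e q) * inner ℝ (N e' q) (P e' q) - inner ℝ (N e q) (P e' q) ^ 2 ≠ 0 ∧
      rocMap (X q.1) (n q.1) (φ.symm q.2) = (T q / 2, √(T q ^ 2 / 4 - D q)) := by
    intro q hq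
    have h := rocMap_eq_of_chart (p₀ := p) (contMDiff_slice hflow.smooth hq.1)
      (contMDiff_slice hflow.smooth_normal hq.1) (hflow.convex q.1 hq.1) hq.2
      linearIndependent_single rfl rfl rfl rfl rfl rfl rfl rfl rfl rfl
    rw [fderiv_chart_slice hflow.smooth p hq, fderiv_chart_slice hflow.smooth_normal p hq] at h
    exact ⟨h.1, h.2.1⟩
  have cb : ∀ v w, ContinuousOn (fun q => inner ℝ (N v q) (P w q)) S := fun v w =>
    (cN v).inner (𝕜 := ℝ) (cP w)
  have cg : ∀ v w, ContinuousOn (fun q => inner ℝ (P v q) (P w q)) S := fun v w =>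
    (cP v).inner (𝕜 := ℝ) (cP w)
  have cdet : ContinuousOn (fun q => inner ℝ (N e q) (P e q) * inner ℝ (N e' q) (P e' q)
      - inner ℝ (N e q) (P e' q) ^ 2) S := ((cb e e).mul (cb e' e')).sub ((cb e e').pow 2)
  have cT : ContinuousOn T S :=
    ((((cb e e).mul (cg e' e')).add ((cb e' e').mul (cg e e))).sub
      ((continuousOn_const.mul (cb e e')).mul (cg e e'))).div cdet (fun q hq => (key q hq).1)
  have cD : ContinuousOn D S :=
    (((cg e e).mul (cg e' e')).sub ((cg e e').pow 2)).div cdet (fun q hq => (key q hq).1)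
  have cG : ContinuousOn (fun q => (T q / 2, √(T q ^ 2 / 4 - D q))) S :=
    (cT.div_const 2).prodMk (((cT.pow 2).div_const 4).sub cD).sqrt
  have hc : ContinuousOn (fun q : ℝ × S2 => (q.1, φ q.2)) (Ico 0 t₁ ×ˢ φ.source) :=
    continuousOn_fst.prodMk ((continuousOn_extChartAt p).comp continuousOn_snd (fun q hq => hq.2))
  have hfin : ContinuousOn (fun q : ℝ × S2 => rocMap (X q.1) (n q.1) q.2)
      (Ico 0 t₁ ×ˢ φ.source) := by
    refine (cG.comp hc (fun q hq => ⟨hq.1, φ.map_source hq.2⟩)).congr ?_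
    intro q hq
    have := (key (q.1, φ q.2) ⟨hq.1, φ.map_source hq.2⟩).2
    simp only [φ.left_inv hq.2] at this
    exact this
  refine (hfin (t, p) ⟨ht, mem_extChartAt_source p⟩).mono_of_mem_nhdsWithin ?_
  rw [nhdsWithin_prod_eq, nhdsWithin_univ]
  exact prod_mem_prod self_mem_nhdsWithin (extChartAt_source_mem_nhds p)

end Continuity

/-! ### Inverting the Gauss map smoothly in time. -/

section GaussParametrization

open Filter Topology

variable {K : ℝ × ℝ → ℝ} {t₁ : ℝ} {X n : ℝ → S2 → E3} {p₀ : S2}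

theorem interior_mem_nhds {q : ℝ × E2} (hq : q ∈ Ioo 0 t₁ ×ˢ (extChartAt (𝓡 2) p₀).target) :
    Ico 0 t₁ ×ˢ (extChartAt (𝓡 2) p₀).target ∈ 𝓝 q :=
  prod_mem_nhds (Ico_mem_nhds hq.1.1 hq.1.2) ((isOpen_extChartAt_target p₀).mem_nhds hq.2)

theorem contDiffAt_chartRep {Z : ℝ → S2 → E3}
    (hZ : ContMDiffOn (𝓘(ℝ, ℝ).prod (𝓡 2)) 𝓘(ℝ, E3) ∞ (fun q : ℝ × S2 => Z q.1 q.2)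
      (Ico 0 t₁ ×ˢ univ)) {q : ℝ × E2}
    (hq : q ∈ Ioo 0 t₁ ×ˢ (extChartAt (𝓡 2) p₀).target) (m : ℕ) :
    ContDiffAt ℝ m (chartRep p₀ Z) q :=
  contDiffAt_infty.1 ((contDiffOn_chartRep p₀ hZ).contDiffAt (interior_mem_nhds hq)) m

theorem fderiv_chartRep_space {Z : ℝ → S2 → E3}
    (hZ : ContMDiffOn (𝓘(ℝ, ℝ).prod (𝓡 2)) 𝓘(ℝ, E3) ∞ (fun q : ℝ × S2 => Z q.1 q.2)
      (Ico 0 t₁ ×ˢ univ)) {q : ℝ × E2}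
    (hq : q ∈ Ioo 0 t₁ ×ˢ (extChartAt (𝓡 2) p₀).target) (v : E2) :
    fderiv ℝ (chartRep p₀ Z) q (0, v)
      = fderiv ℝ (fun y => Z q.1 ((extChartAt (𝓡 2) p₀).symm y)) q.2 v := by
  rw [fderiv_chart_slice hZ p₀ ⟨Ioo_subset_Ico_self hq.1, hq.2⟩,
    fderivWithin_of_mem_nhds (interior_mem_nhds hq)]
  rfl

theorem IsClassicalCurvatureFlow.inner_normal_fderiv_time
    (hflow : IsClassicalCurvatureFlow K t₁ X n) {q : ℝ × E2}
    (hq : q ∈ Ioo 0 t₁ ×ˢ (extChartAt (𝓡 2) p₀).target) :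
    inner ℝ (fderiv ℝ (chartRep p₀ X) q (1, 0)) (chartRep p₀ n q)
      = -K (rocMap (X q.1) (n q.1) ((extChartAt (𝓡 2) p₀).symm q.2)) := by
  have ht : q.1 ∈ Ico 0 t₁ := Ioo_subset_Ico_self hq.1
  have h1 : HasFDerivAt (chartRep p₀ X) (fderiv ℝ (chartRep p₀ X) q) q :=
    ((contDiffAt_chartRep hflow.smooth hq 1).differentiableAt one_ne_zero).hasFDerivAt
  have h2 : HasDerivAt (fun τ : ℝ => (τ, q.2)) ((1, 0) : ℝ × E2) q.1 :=
    (hasDerivAt_id q.1).prodMk (hasDerivAt_const _ _)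
  have h3 : HasDerivAt (fun τ => X τ ((extChartAt (𝓡 2) p₀).symm q.2))
      (fderiv ℝ (chartRep p₀ X) q (1, 0)) q.1 :=
    HasFDerivAt.comp_hasDerivAt (l := chartRep p₀ X) (f := fun τ : ℝ => (τ, q.2)) q.1 h1 h2
  have h4 := hflow.evolution q.1 ht ((extChartAt (𝓡 2) p₀).symm q.2)
  rw [h3.hasDerivWithinAt.derivWithin (uniqueDiffOn_Ico 0 t₁ q.1 ht)] at h4
  have h5 : n q.1 ((extChartAt (𝓡 2) p₀).symm q.2) ≠ 0 := by
    intro h0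
    have := (hflow.convex q.1 ht).unit ((extChartAt (𝓡 2) p₀).symm q.2)
    rw [h0, norm_zero] at this
    exact zero_ne_one this
  exact smul_left_injective ℝ h5 h4

theorem IsClassicalCurvatureFlow.inner_fderiv_normal
    (hflow : IsClassicalCurvatureFlow K t₁ X n) {q : ℝ × E2}
    (hq : q ∈ Ioo 0 t₁ ×ˢ (extChartAt (𝓡 2) p₀).target) (v : E2) :
    inner ℝ (chartRep p₀ n q) (fderiv ℝ (chartRep p₀ X) q (0, v)) = 0 := by
  have ht : q.1 ∈ Ico 0 t₁ := Ioo_subset_Ico_self hq.1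
  rw [fderiv_chartRep_space hflow.smooth hq, ← dAt_dChartSymm (contMDiff_slice hflow.smooth ht) hq.2]
  exact (hflow.convex q.1 ht).normal _ _

/-- The inverse of the Gauss map, as a smooth function of time and normal direction. -/
theorem IsClassicalCurvatureFlow.exists_gauss_inverse
    (hflow : IsClassicalCurvatureFlow K t₁ X n) {t₀ : ℝ} (ht₀ : t₀ ∈ Ioo 0 t₁) (p₀ : S2) :
    ∃ Ψ : ℝ × E3 → E2, ContDiffAt ℝ (7 : ℕ) Ψ (t₀, n t₀ p₀) ∧
      Ψ (t₀, n t₀ p₀) = extChartAt (𝓡 2) p₀ p₀ ∧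
      ∀ᶠ q in 𝓝 (t₀, n t₀ p₀), ‖q.2‖ • chartRep p₀ n (q.1, Ψ q) = q.2 := by
  set x₀ := extChartAt (𝓡 2) p₀ p₀ with hx₀
  have hq₀ : (t₀, x₀) ∈ Ioo 0 t₁ ×ˢ (extChartAt (𝓡 2) p₀).target :=
    ⟨ht₀, mem_extChartAt_target p₀⟩
  have ht : t₀ ∈ Ico 0 t₁ := Ioo_subset_Ico_self ht₀
  have hn0 : chartRep p₀ n (t₀, x₀) = n t₀ p₀ := by
    rw [chartRep, hx₀, extChartAt_to_inv]
  have hunit : ‖n t₀ p₀‖ = 1 := (hflow.convex t₀ ht).unit p₀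
  -- A radial variable extends the Gauss map to a map between spaces of equal dimension, to which
  -- the inverse function theorem applies. A kernel vector of its differential would have to be
  -- tangential and would give a zero principal curvature.
  set Φ : (ℝ × E2) × ℝ → ℝ × E3 := fun w => (w.1.1, w.2 • chartRep p₀ n w.1) with hΦ
  have hΦc : ContDiffAt ℝ (7 : ℕ) Φ ((t₀, x₀), 1) := by
    have h1 := contDiffAt_chartRep hflow.smooth_normal hq₀ 7
    have h2 : ContDiffAt ℝ (7 : ℕ) (fun w : (ℝ × E2) × ℝ => chartRep p₀ n w.1) ((t₀, x₀), 1) :=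
      ContDiffAt.comp (g := chartRep p₀ n) ((t₀, x₀), (1 : ℝ)) h1 contDiffAt_fst
    exact (contDiffAt_fst.fst).prodMk (contDiffAt_snd.smul h2)
  have hd1 : HasFDerivAt (chartRep p₀ n) (fderiv ℝ (chartRep p₀ n) (t₀, x₀)) (t₀, x₀) :=
    ((contDiffAt_chartRep hflow.smooth_normal hq₀ 1).differentiableAt one_ne_zero).hasFDerivAt
  have hd2 : HasFDerivAt (fun w : (ℝ × E2) × ℝ => chartRep p₀ n w.1)
      ((fderiv ℝ (chartRep p₀ n) (t₀, x₀)).comp (ContinuousLinearMap.fst ℝ (ℝ × E2) ℝ))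
      ((t₀, x₀), 1) :=
    HasFDerivAt.comp (g := chartRep p₀ n) ((t₀, x₀), (1 : ℝ)) hd1 hasFDerivAt_fst
  have hd := ((hasFDerivAt_fst (𝕜 := ℝ) (p := (((t₀, x₀), 1) : (ℝ × E2) × ℝ))).fst).prodMk
    ((hasFDerivAt_snd (𝕜 := ℝ) (p := (((t₀, x₀), 1) : (ℝ × E2) × ℝ))).smul hd2)
  set L := fderiv ℝ Φ ((t₀, x₀), 1) with hL
  have hLap : ∀ (a : ℝ) (v : E2) (s : ℝ), L ((a, v), s)
      = (a, fderiv ℝ (chartRep p₀ n) (t₀, x₀) (a, v) + s • n t₀ p₀) := by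
    intro a v s
    have hd' : HasFDerivAt Φ _ ((t₀, x₀), 1) := hd
    rw [hL, hd'.fderiv]
    simp [hn0]
  have hinj : Function.Injective L := by
    rw [injective_iff_map_eq_zero]
    rintro ⟨⟨a, v⟩, s⟩ h
    rw [hLap, Prod.mk_eq_zero] at h
    obtain ⟨rfl, h⟩ := h
    rw [fderiv_chartRep_space hflow.smooth_normal hq₀] at h
    have hperp := inner_normal_fderiv (contMDiff_slice hflow.smooth_normal ht) (hflow.convex t₀ ht)
      hq₀.2 v
    rw [show (extChartAt (𝓡 2) p₀).symm x₀ = p₀ from extChartAt_to_inv p₀] at hperp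
    have hs : s = 0 := by
      have := congrArg (fun y => inner ℝ (n t₀ p₀) y) h
      simp only [inner_add_right, hperp, real_inner_smul_right, inner_zero_right, zero_add,
        real_inner_self_eq_norm_sq, hunit] at this
      simpa using this
    rw [hs, zero_smul, add_zero] at h
    have hv : v = 0 := by
      by_contra hv
      have := (radiiOfCurvature_eq_chart (contMDiff_slice hflow.smooth ht)
        (contMDiff_slice hflow.smooth_normal ht) hq₀.2 0).2 ⟨v, hv, by rw [zero_smul]; exact h⟩
      exact lt_irrefl _ ((hflow.convex t₀ ht).pos_curvature _ _ this)
    simp [hs, hv]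
  set Le : ((ℝ × E2) × ℝ) ≃L[ℝ] ℝ × E3 :=
    (LinearMap.linearEquivOfInjective L.toLinearMap hinj (by simp)).toContinuousLinearEquiv
  have hLe : HasFDerivAt Φ (Le : ((ℝ × E2) × ℝ) →L[ℝ] ℝ × E3) ((t₀, x₀), 1) := by
    have h := (hΦc.differentiableAt (by norm_num)).hasFDerivAt
    refine h.congr_fderiv ?_
    ext1 <;> rfl
  have hΦ0 : Φ ((t₀, x₀), 1) = (t₀, n t₀ p₀) := by simp [hΦ, hn0]
  set Λ := hΦc.localInverse hLe (by norm_num) with hΛ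
  have hΛc : ContDiffAt ℝ (7 : ℕ) Λ (t₀, n t₀ p₀) := hΦ0 ▸ hΦc.to_localInverse hLe (by norm_num)
  have hΛ0 : Λ (t₀, n t₀ p₀) = ((t₀, x₀), 1) := by
    rw [← hΦ0]
    exact hΦc.localInverse_apply_image hLe (by norm_num)
  have hright : ∀ᶠ q in 𝓝 (t₀, n t₀ p₀), Φ (Λ q) = q := by
    rw [← hΦ0]
    exact (hΦc.hasStrictFDerivAt' hLe (by norm_num)).eventually_right_inverse
  have hpos : ∀ᶠ q in 𝓝 (t₀, n t₀ p₀), 0 < (Λ q).2 := by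
    have : Tendsto (fun q => (Λ q).2) (𝓝 (t₀, n t₀ p₀)) (𝓝 (Λ (t₀, n t₀ p₀)).2) :=
      (continuous_snd.tendsto _).comp hΛc.continuousAt
    rw [hΛ0] at this
    exact this.eventually (lt_mem_nhds one_pos)
  have hdom : ∀ᶠ q in 𝓝 (t₀, n t₀ p₀), (Λ q).1 ∈ Ioo 0 t₁ ×ˢ (extChartAt (𝓡 2) p₀).target := by
    have : Tendsto (fun q => (Λ q).1) (𝓝 (t₀, n t₀ p₀)) (𝓝 (Λ (t₀, n t₀ p₀)).1) :=
      (continuous_fst.tendsto _).comp hΛc.continuousAt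
    rw [hΛ0] at this
    exact this.eventually ((isOpen_Ioo.prod (isOpen_extChartAt_target p₀)).mem_nhds hq₀)
  refine ⟨fun q => (Λ q).1.2, hΛc.fst.snd, by simp only [hΛ0], ?_⟩
  filter_upwards [hright, hpos, hdom] with q h1 h2 h3
  have e1 : (Λ q).1.1 = q.1 := congrArg Prod.fst h1
  have e2 : (Λ q).2 • chartRep p₀ n (Λ q).1 = q.2 := congrArg Prod.snd h1
  have e3 : ‖chartRep p₀ n (Λ q).1‖ = 1 :=
    (hflow.convex _ (Ioo_subset_Ico_self h3.1)).unit _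
  have e4 : ‖q.2‖ = (Λ q).2 := by
    rw [← e2, norm_smul, e3, mul_one, Real.norm_of_nonneg h2.le]
  rw [e4, ← e1, Prod.mk.eta, e2]

end GaussParametrization

/-! ### Construction of the support function. -/

section ExistsSupportFunction

open Filter Topology

theorem inner_eq_sum_of_orthonormal {e₁ e₂ e₃ : E3} (h : Orthonormal ℝ ![e₁, e₂, e₃]) (y z : E3) :
    inner ℝ y z = inner ℝ y e₁ * inner ℝ z e₁ + inner ℝ y e₂ * inner ℝ z e₂
      + inner ℝ y e₃ * inner ℝ z e₃ := by
  have hsp := h.linearIndependent.span_eq_top_of_card_eq_finrank (by simp)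
  have key := (OrthonormalBasis.mk h hsp.ge).sum_inner_mul_inner y z
  simp only [OrthonormalBasis.coe_mk, Fin.sum_univ_three, Matrix.cons_val_zero,
    Matrix.cons_val_one, Matrix.cons_val] at key
  rw [← key, real_inner_comm z e₁, real_inner_comm z e₂, real_inner_comm z e₃]

/-- With `S` the Hessian matrix and `M = diag(1 + x², 1)`, the forms are `g = S M S` and `b = S /
ρ`. Hence the radii are the eigenvalues of `ρ M S`, with trace `ρ ((1 + x²) a + c)` and determinant
`ρ² (1 + x²) (a c - b²)`. -/
theorem gnomonicRoc_eq {ρ x a b c b₁ b₂ b₃ g₁ g₂ g₃ : ℝ} (hρ : 0 < ρ) (hρx : ρ ^ 2 = 1 + x ^ 2)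
    (hb₁ : b₁ = a / ρ) (hb₂ : b₂ = b / ρ) (hb₃ : b₃ = c / ρ)
    (hg₁ : g₁ = (1 + x ^ 2) * a ^ 2 + b ^ 2) (hg₂ : g₂ = (1 + x ^ 2) * (a * b) + b * c)
    (hg₃ : g₃ = (1 + x ^ 2) * b ^ 2 + c ^ 2) (hdet : b₁ * b₃ - b₂ ^ 2 ≠ 0) :
    (((b₁ * g₃ + b₃ * g₁ - 2 * b₂ * g₂) / (b₁ * b₃ - b₂ ^ 2)) / 2,
      √(((b₁ * g₃ + b₃ * g₁ - 2 * b₂ * g₂) / (b₁ * b₃ - b₂ ^ 2)) ^ 2 / 4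
        - (g₁ * g₃ - g₂ ^ 2) / (b₁ * b₃ - b₂ ^ 2))) = gnomonicRoc x a b c := by
  have hd : b₁ * b₃ - b₂ ^ 2 = (a * c - b ^ 2) / ρ ^ 2 := by
    rw [hb₁, hb₂, hb₃]; field_simp
  have hac : a * c - b ^ 2 ≠ 0 := by
    intro h0
    rw [hd, h0, zero_div] at hdet
    exact hdet rfl
  have hT : (b₁ * g₃ + b₃ * g₁ - 2 * b₂ * g₂) / (b₁ * b₃ - b₂ ^ 2)
      = ρ * ((1 + x ^ 2) * a + c) := by
    rw [hd, hb₁, hb₂, hb₃, hg₁, hg₂, hg₃]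
    field_simp
    ring
  have hD : (g₁ * g₃ - g₂ ^ 2) / (b₁ * b₃ - b₂ ^ 2) = ρ ^ 2 * ((1 + x ^ 2) * (a * c - b ^ 2)) := by
    rw [hd, hg₁, hg₂, hg₃]
    field_simp
    ring
  have hρs : √(1 + x ^ 2) = ρ := by rw [← hρx, Real.sqrt_sq hρ.le]
  rw [hT, hD, gnomonicRoc, hρs]
  ext
  · simp only; ring
  · simp only
    rw [mul_comm (ρ / 2), sqrt_mul_eq_sqrt_mul_sq (by positivity)]
    congr 1
    ring

variable {K : ℝ × ℝ → ℝ} {t₁ : ℝ} {X n : ℝ → S2 → E3}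

/-- Near any point, a curvature flow of convex surfaces is described by a support function. -/
theorem IsClassicalCurvatureFlow.exists_supportFunction
    (hflow : IsClassicalCurvatureFlow K t₁ X n) {t₀ : ℝ} (ht₀ : t₀ ∈ Ioo 0 t₁) (p₀ : S2) :
    ∃ (h : ℝ × E3 → ℝ) (π : ℝ × E3 → S2), π (t₀, n t₀ p₀) = p₀ ∧
      IsSupportFunction K (t₀, n t₀ p₀) h (fun q => rocMap (X q.1) (n q.1) (π q)) := by
  obtain ⟨Ψ, hΨc, hΨ0, hΨ⟩ := hflow.exists_gauss_inverse ht₀ p₀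
  set q₀ : ℝ × E3 := (t₀, n t₀ p₀) with hq₀
  have ht : t₀ ∈ Ico 0 t₁ := Ioo_subset_Ico_self ht₀
  have hunit : ‖q₀.2‖ = 1 := (hflow.convex t₀ ht).unit p₀
  set W : ℝ × E3 → ℝ × E2 := fun q => (q.1, Ψ q) with hW
  have hWc : ContDiffAt ℝ (7 : ℕ) W q₀ := contDiffAt_fst.prodMk hΨc
  have hdom0 : W q₀ ∈ Ioo 0 t₁ ×ˢ (extChartAt (𝓡 2) p₀).target := by
    refine ⟨ht₀, ?_⟩
    simp only [hW, hΨ0]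
    exact mem_extChartAt_target p₀
  have hdom : ∀ᶠ q in 𝓝 q₀, W q ∈ Ioo 0 t₁ ×ˢ (extChartAt (𝓡 2) p₀).target :=
    hWc.continuousAt.eventually
      ((isOpen_Ioo.prod (isOpen_extChartAt_target p₀)).mem_nhds hdom0)
  have hXc : ContDiffAt ℝ (7 : ℕ) (fun q => chartRep p₀ X (W q)) q₀ :=
    ContDiffAt.comp (g := chartRep p₀ X) q₀ (contDiffAt_chartRep hflow.smooth hdom0 7) hWc
  set Xh : ℝ × E3 → E3 := fun q => chartRep p₀ X (W q) with hXh
  set h : ℝ × E3 → ℝ := fun q => inner ℝ (Xh q) q.2 with hh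
  have hhc : ContDiffAt ℝ (6 : ℕ) h q₀ :=
    (hXc.inner ℝ contDiffAt_snd).of_le (by norm_num)
  have hWd : ∀ᶠ q in 𝓝 q₀, DifferentiableAt ℝ W q := by
    filter_upwards [hWc.eventually (by simp)] with q hq using hq.differentiableAt (by norm_num)
  have hne : ∀ᶠ q in 𝓝 q₀, q.2 ≠ 0 := by
    have : Tendsto (fun q : ℝ × E3 => q.2) (𝓝 q₀) (𝓝 q₀.2) := continuous_snd.tendsto _
    have hn0 : q₀.2 ≠ 0 := norm_ne_zero_iff.1 (by rw [hunit]; exact one_ne_zero)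
    exact this.eventually (isOpen_ne.mem_nhds hn0)
  -- the derivatives of the two position vectors
  have hcomp : ∀ {Z : ℝ → S2 → E3}, ContMDiffOn (𝓘(ℝ, ℝ).prod (𝓡 2)) 𝓘(ℝ, E3) ∞
      (fun q : ℝ × S2 => Z q.1 q.2) (Ico 0 t₁ ×ˢ univ) → ∀ᶠ q in 𝓝 q₀,
      HasFDerivAt (fun q => chartRep p₀ Z (W q))
        ((fderiv ℝ (chartRep p₀ Z) (W q)).comp (fderiv ℝ W q)) q := by
    intro Z hZ
    filter_upwards [hdom, hWd] with q h1 h2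
    exact HasFDerivAt.comp (g := chartRep p₀ Z) q
      ((contDiffAt_chartRep hZ h1 1).differentiableAt one_ne_zero).hasFDerivAt h2.hasFDerivAt
  have hWap : ∀ᶠ q in 𝓝 q₀, ∀ s ζ, fderiv ℝ W q (s, ζ) = (s, (fderiv ℝ W q (s, ζ)).2) := by
    filter_upwards [hWd] with q hq s ζ
    have h1 := hq.hasFDerivAt.fst
    have h2 : HasFDerivAt (fun q : ℝ × E3 => (W q).1) (ContinuousLinearMap.fst ℝ ℝ E3) q :=
      hasFDerivAt_fst
    have h3 := congrArg (fun L : ℝ × E3 →L[ℝ] ℝ => L (s, ζ)) (h1.unique h2)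
    have h4 : (fderiv ℝ W q (s, ζ)).1 = s := h3
    exact Prod.ext h4 rfl
  have hXd := hcomp hflow.smooth
  have hnd := hcomp hflow.smooth_normal
  have hXperp : ∀ᶠ q in 𝓝 q₀, ∀ ζ : E3, inner ℝ (fderiv ℝ Xh q (0, ζ)) q.2 = 0 := by
    filter_upwards [hdom, hXd, hWap, hΨ] with q h1 h2 h3 h4 ζ
    rw [h2.fderiv, ContinuousLinearMap.comp_apply, h3, ← h4, real_inner_smul_right,
      real_inner_comm, hflow.inner_fderiv_normal h1, mul_zero]
  have hXt : ∀ᶠ q in 𝓝 q₀, inner ℝ (fderiv ℝ Xh q (1, 0)) q.2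
      = -(‖q.2‖ * K (rocMap (X q.1) (n q.1) ((extChartAt (𝓡 2) p₀).symm (Ψ q)))) := by
    filter_upwards [hdom, hXd, hWap, hΨ] with q h1 h2 h3 h4
    have e1 := hflow.inner_normal_fderiv_time h1
    have e2 := hflow.inner_fderiv_normal h1 (fderiv ℝ W q (1, 0)).2
    rw [h2.fderiv, ContinuousLinearMap.comp_apply, h3]
    conv_lhs => rw [← h4]
    rw [show ((1 : ℝ), (fderiv ℝ W q (1, 0)).2) = (1, 0) + (0, (fderiv ℝ W q (1, 0)).2) by simp,
      map_add, real_inner_smul_right, inner_add_left, e1, real_inner_comm, e2]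
    simp only [hW]
    ring
  -- the first derivatives of the support function
  have hhd : ∀ᶠ q in 𝓝 q₀, ∀ v, fderiv ℝ h q v
      = inner ℝ (Xh q) v.2 + inner ℝ (fderiv ℝ Xh q v) q.2 := by
    filter_upwards [hXd] with q h1 v
    have := fderiv_inner_apply ℝ h1.differentiableAt
      (differentiableAt_snd (𝕜 := ℝ) (p := q)) v
    rw [fderiv_snd] at this
    exact this
  -- Spatial derivatives of the position vector are tangent to the surface, hence orthogonal to `z`;
  -- so the gradient of `h` is the position vector.
  have hgrad : ∀ e : E3, dirDeriv ((0, e) : ℝ × E3) h =ᶠ[𝓝 q₀] fun q => inner ℝ (Xh q) e := by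
    intro e
    filter_upwards [hhd, hXperp] with q h1 h2
    rw [dirDeriv, h1, h2, add_zero]
  have hgrad' : ∀ᶠ q in 𝓝 q₀, ∀ e e' : E3, spaceHess h e e' q
      = inner ℝ (fderiv ℝ Xh q (0, e)) e' := by
    filter_upwards [(hhd.and hXperp).eventually_nhds, hXd] with q h1 h2 e e'
    have h3 : dirDeriv ((0, e') : ℝ × E3) h =ᶠ[𝓝 q] fun q => inner ℝ (Xh q) e' := by
      filter_upwards [h1] with q h1
      rw [dirDeriv, h1.1, h1.2, add_zero]
    have h4 := (dirDeriv_congr h3 ((0, e) : ℝ × E3)).eq_of_nhds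
    rw [spaceHess, h4, dirDeriv]
    have := fderiv_inner_apply ℝ h2.differentiableAt
      (differentiableAt_const (𝕜 := ℝ) e') ((0, e) : ℝ × E3)
    rw [this]
    simp
    rfl
  -- the derivative of the unit normal
  have hnormal : ∀ᶠ q in 𝓝 q₀, ∀ ζ : E3, ∃ c : ℝ,
      ζ = ‖q.2‖ • fderiv ℝ (chartRep p₀ n) (W q) (0, (fderiv ℝ W q (0, ζ)).2) + c • q.2 := by
    filter_upwards [hΨ.eventually_nhds, hnd, hne, hWap] with q h1 h2 h3 h4 ζ
    have e1 : HasFDerivAt (fun q : ℝ × E3 => ‖q.2‖) (fderiv ℝ (fun q : ℝ × E3 => ‖q.2‖) q) q :=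
      (differentiableAt_snd.norm ℝ h3).hasFDerivAt
    have e2 := (e1.smul h2).congr_of_eventuallyEq (f₁ := fun q : ℝ × E3 => q.2)
      (by filter_upwards [h1] with q h using h.symm)
    have e3 := congrArg (fun L : ℝ × E3 →L[ℝ] E3 => L (0, ζ))
      (hasFDerivAt_snd.unique e2)
    simp only [ContinuousLinearMap.coe_snd', add_apply, smul_apply,
      ContinuousLinearMap.comp_apply, ContinuousLinearMap.smulRight_apply] at e3
    rw [h4] at e3
    have h5 := h1.self_of_nhds
    refine ⟨fderiv ℝ (fun q : ℝ × E3 => ‖q.2‖) q (0, ζ) * ‖q.2‖⁻¹, ?_⟩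
    conv_lhs => rw [e3]
    congr 1
    conv_rhs => rw [← h5]
    rw [smul_smul, norm_smul, norm_norm]
    have h6 : ‖chartRep p₀ n (W q)‖ = 1 := by
      have := congrArg norm h5
      rw [norm_smul, norm_norm] at this
      exact mul_left_cancel₀ (norm_ne_zero_iff.2 h3) (by rw [mul_one]; exact this)
    rw [show chartRep p₀ n (q.1, Ψ q) = chartRep p₀ n (W q) from rfl, h6]
    have h7 := norm_ne_zero_iff.2 h3
    congr 1
    field_simp
  refine ⟨h, fun q => (extChartAt (𝓡 2) p₀).symm (Ψ q), ?_, hunit, hhc, ?_, ?_⟩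
  · simp only [hΨ0, extChartAt_to_inv]
  · filter_upwards [hhd, hXt] with q h1 h2
    rw [dirDeriv, h1, h2]
    simp
  · filter_upwards [hdom, hXperp, hXd, hgrad', hnormal, hWap, hne, hΨ] with q hq hperp hX hS hN hWq
      hq0 hΨq e₁ e₂ e₃ x horth hz
    obtain ⟨n1, n2, n3, o12, o13, o23⟩ := (orthonormal_triple_iff _ _ _).1 horth
    have o21 : inner ℝ e₂ e₁ = 0 := by rw [real_inner_comm]; exact o12
    have o31 : inner ℝ e₃ e₁ = 0 := by rw [real_inner_comm]; exact o13
    have o32 : inner ℝ e₃ e₂ = 0 := by rw [real_inner_comm]; exact o23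
    have i1 : inner ℝ e₁ e₁ = (1 : ℝ) := by rw [real_inner_self_eq_norm_sq, n1]; norm_num
    have i2 : inner ℝ e₂ e₂ = (1 : ℝ) := by rw [real_inner_self_eq_norm_sq, n2]; norm_num
    have i3 : inner ℝ e₃ e₃ = (1 : ℝ) := by rw [real_inner_self_eq_norm_sq, n3]; norm_num
    have htq : q.1 ∈ Ico 0 t₁ := Ioo_subset_Ico_self hq.1
    set ρ := ‖q.2‖ with hρ
    have hρ0 : 0 < ρ := norm_pos_iff.2 hq0
    have hρx : ρ ^ 2 = 1 + x ^ 2 := by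
      rw [hρ, hz, norm_add_sq_real, real_inner_smul_right, o31, norm_smul, n3, n1]
      simp
    set P := fderiv ℝ (fun y => X q.1 ((extChartAt (𝓡 2) p₀).symm y)) (Ψ q) with hPdef
    set N := fderiv ℝ (fun y => n q.1 ((extChartAt (𝓡 2) p₀).symm y)) (Ψ q) with hNdef
    set V : E3 → E2 := fun ζ => (fderiv ℝ W q (0, ζ)).2 with hV
    have hPV : ∀ ζ, P (V ζ) = fderiv ℝ Xh q (0, ζ) := by
      intro ζ
      rw [hX.fderiv, ContinuousLinearMap.comp_apply, hWq,
        fderiv_chartRep_space hflow.smooth hq]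
    have hPperp : ∀ ζ, inner ℝ (P (V ζ)) q.2 = 0 := fun ζ => by rw [hPV, hperp]
    have hNV : ∀ ζ, ∃ c : ℝ, ζ = ρ • N (V ζ) + c • q.2 := by
      intro ζ
      obtain ⟨c, hc⟩ := hN ζ
      rw [fderiv_chartRep_space hflow.smooth_normal hq] at hc
      exact ⟨c, hc⟩
    -- Differentiating `z = ‖z‖ n` gives `ζ = ρ N (V ζ) + c z`, and the `z` component is invisible
    -- to tangent vectors.
    have hb : ∀ ζ η, inner ℝ (N (V ζ)) (P (V η)) = spaceHess h η ζ q / ρ := by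
      intro ζ η
      obtain ⟨c, hc⟩ := hNV ζ
      rw [hS, ← hPV, eq_div_iff hρ0.ne', real_inner_comm]
      conv_rhs => rw [hc]
      rw [inner_add_right, real_inner_smul_right, real_inner_smul_right, hPperp]
      ring
    have hsymm : spaceHess h e₂ e₁ q = spaceHess h e₁ e₂ q := by
      have e := inner_fderiv_symm (contMDiff_slice hflow.smooth htq)
        (contMDiff_slice hflow.smooth_normal htq) (hflow.convex q.1 htq) hq.2 (V e₁) (V e₂)
      have e' : inner ℝ (N (V e₁)) (P (V e₂)) = inner ℝ (N (V e₂)) (P (V e₁)) := e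
      rw [hb, hb] at e'
      exact (div_left_inj' hρ0.ne').1 e'
    -- Tangency to the surface, that is orthogonality to `z = e₃ + x e₁`, determines the `e₃`
    -- component. It contributes the `x²` in the first fundamental form.
    have hP3 : ∀ ζ, inner ℝ (P (V ζ)) e₃ = -(x * spaceHess h ζ e₁ q) := by
      intro ζ
      have := hPperp ζ
      rw [hz, inner_add_right, real_inner_smul_right] at this
      rw [hS, ← hPV]
      linarith
    have hg : ∀ ζ η, inner ℝ (P (V ζ)) (P (V η))
        = (1 + x ^ 2) * (spaceHess h ζ e₁ q * spaceHess h η e₁ q)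
          + spaceHess h ζ e₂ q * spaceHess h η e₂ q := by
      intro ζ η
      rw [inner_eq_sum_of_orthonormal horth, hP3, hP3, hS ζ e₁, hS ζ e₂, hS η e₁, hS η e₂, hPV, hPV]
      ring
    have hVlin : ∀ c d : ℝ, c • V e₁ + d • V e₂ = V (c • e₁ + d • e₂) := by
      intro c d
      simp only [hV]
      rw [show ((0 : ℝ), c • e₁ + d • e₂) = c • ((0 : ℝ), e₁) + d • ((0 : ℝ), e₂) by simp,
        map_add, map_smul, map_smul]
      rfl
    have hli : LinearIndependent ℝ ![V e₁, V e₂] := by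
      rw [LinearIndependent.pair_iff]
      intro c d hcd
      rw [hVlin] at hcd
      obtain ⟨k, hk⟩ := hNV (c • e₁ + d • e₂)
      rw [hcd, map_zero, smul_zero, zero_add, hz] at hk
      have k3 := congrArg (fun y => inner ℝ y e₃) hk
      simp only [inner_add_left, real_inner_smul_left, o13, o23, i3] at k3
      have hk0 : k = 0 := by linarith
      rw [hk0, zero_smul] at hk
      have k1 := congrArg (fun y => inner ℝ y e₁) hk
      have k2 := congrArg (fun y => inner ℝ y e₂) hk
      simp only [inner_add_left, real_inner_smul_left, o12, o21, i1, i2, inner_zero_left] at k1 k2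
      exact ⟨by linarith, by linarith⟩
    obtain ⟨hdet, hroc, -⟩ := rocMap_eq_of_chart (contMDiff_slice hflow.smooth htq)
      (contMDiff_slice hflow.smooth_normal htq) (hflow.convex q.1 htq) hq.2 hli hPdef hNdef
      rfl rfl rfl rfl rfl rfl rfl rfl
    rw [hroc]
    refine gnomonicRoc_eq hρ0 hρx (hb _ _) ?_ (hb _ _) ?_ ?_ ?_ hdet
    · rw [hb, hsymm]
    · rw [hg]; ring
    · rw [hg, hsymm]
    · rw [hg, hsymm]; ring

end ExistsSupportFunction

/-! ### Oddness in `H` and the maximum principle. -/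

section MaximumPrinciple

open Filter Topology

theorem d10_neg (F : ℝ × ℝ → ℝ) (q : ℝ × ℝ) (hq : q ∈ rocRegion) :
    d10 (fun p => -F p) q = -d10 F q := by
  rw [d10, fderivWithin_fun_neg (uniqueDiffOn_rocRegion q hq)]
  rfl

theorem d01_neg (F : ℝ × ℝ → ℝ) (q : ℝ × ℝ) (hq : q ∈ rocRegion) :
    d01 (fun p => -F p) q = -d01 F q := by
  rw [d01, fderivWithin_fun_neg (uniqueDiffOn_rocRegion q hq)]
  rfl

theorem d10_congr {F G : ℝ × ℝ → ℝ} (h : EqOn F G rocRegion) {q : ℝ × ℝ} (hq : q ∈ rocRegion) :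
    d10 F q = d10 G q := by
  rw [d10, d10, fderivWithin_congr h (h hq)]

theorem d01_congr {F G : ℝ × ℝ → ℝ} (h : EqOn F G rocRegion) {q : ℝ × ℝ} (hq : q ∈ rocRegion) :
    d01 F q = d01 G q := by
  rw [d01, d01, fderivWithin_congr h (h hq)]

theorem poisson_neg (H G : ℝ × ℝ → ℝ) {q : ℝ × ℝ} (hq : q ∈ rocRegion) :
    poisson (fun p => -H p) G q = -poisson H G q := by
  rw [poisson, poisson, d10_neg H q hq, d01_neg H q hq]; ring

theorem hessOn_neg_right (F H : ℝ × ℝ → ℝ) {q : ℝ × ℝ} (hq : q ∈ rocRegion) :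
    hessOn F (fun p => -H p) q = hessOn F H q := by
  rw [hessOn, hessOn, d10_neg H q hq, d01_neg H q hq]; ring

theorem hessOn_neg_left (F H : ℝ × ℝ → ℝ) {q : ℝ × ℝ} (hq : q ∈ rocRegion) :
    hessOn (fun p => -F p) H q = -hessOn F H q := by
  have h1 : d20 (fun p => -F p) q = -d20 F q := by
    rw [d20, d10_congr (d10_neg F) hq, d10_neg _ q hq, d20]
  have h2 : d11 (fun p => -F p) q = -d11 F q := by
    rw [d11, d10_congr (d01_neg F) hq, d10_neg _ q hq, d11]
  have h3 : d02 (fun p => -F p) q = -d02 F q := by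
    rw [d02, d01_congr (d01_neg F) hq, d01_neg _ q hq, d02]
  rw [hessOn, hessOn, h1, h2, h3]; ring

/-- `Hess_H(dH)` and `{H, K}` are odd in `H`, `Hess_K(dH)` is even. Oddness of `A` and `B` reduces
minima to maxima. -/
theorem coeffA_neg (H K : ℝ × ℝ → ℝ) {q : ℝ × ℝ} (hq : q ∈ rocRegion) :
    coeffA (fun p => -H p) K q = -coeffA H K q := by
  rw [coeffA, coeffA, hessOn_neg_left _ _ hq, hessOn_neg_right _ _ hq, hessOn_neg_right _ _ hq,
    poisson_neg _ _ hq, d10_neg H q hq, d01_neg H q hq]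
  ring

theorem coeffB_neg (H K : ℝ × ℝ → ℝ) {q : ℝ × ℝ} (hq : q ∈ rocRegion) :
    coeffB (fun p => -H p) K q = -coeffB H K q := by
  rw [coeffB, coeffB, hessOn_neg_left _ _ hq, hessOn_neg_right _ _ hq, hessOn_neg_right _ _ hq,
    poisson_neg _ _ hq, d10_neg H q hq, d01_neg H q hq]
  ring

instance : Nonempty S2 := ⟨⟨EuclideanSpace.single 0 1, by simp⟩⟩

variable {K H : ℝ × ℝ → ℝ} {t₁ : ℝ} {X n : ℝ → S2 → E3}

/-- If at every spatial maximum a continuous function on a compact space is nonincreasing in time to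
first order along some curve, then it is bounded by its initial maximum. -/
theorem le_initial_max {M : Type*} [TopologicalSpace M] [CompactSpace M] [Nonempty M]
    {u : ℝ × M → ℝ} {t₁ : ℝ} (ht₁ : 0 < t₁) (hu : ContinuousOn u (Ico 0 t₁ ×ˢ univ))
    (hmaxu : ∀ s ∈ Ioo 0 t₁, ∀ p', (∀ p, u (s, p) ≤ u (s, p')) → ∃ (γ : ℝ → M) (U : ℝ), 0 ≤ U ∧
      Peano1 (𝓝[>] 0) (fun x => u (s - x, γ x)) (u (s, p')) U) :
    ∃ q, (∀ p, u (0, p) ≤ u (0, q)) ∧ ∀ t ∈ Ico 0 t₁, ∀ p, u (t, p) ≤ u (0, q) := by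
  have hcont0 : ContinuousOn (fun p => u (0, p)) univ := by
    have h1 : ContinuousOn (fun p : M => ((0 : ℝ), p)) univ := by fun_prop
    exact ContinuousOn.comp hu h1 (fun p _ => ⟨⟨le_rfl, ht₁⟩, mem_univ _⟩)
  obtain ⟨q, -, hq⟩ := isCompact_univ.exists_isMaxOn univ_nonempty hcont0
  have hq' : ∀ p, u (0, p) ≤ u (0, q) := fun p => hq (mem_univ p)
  refine ⟨q, hq', fun T hT p => ?_⟩
  by_contra! hlt
  -- Dividing by `T + 1` rather than `T` makes `ε T` strictly smaller than the excess, also when `T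
  -- = 0`; so the maximum of `u - ε t` on `[0, T]` is not attained at time `0`.
  set ε := (u (T, p) - u (0, q)) / (T + 1) with hε
  have hT1 : 0 < T + 1 := by linarith [hT.1]
  have hε0 : 0 < ε := div_pos (by linarith) hT1
  have hεT : ε * T < u (T, p) - u (0, q) := by
    have : ε * (T + 1) = u (T, p) - u (0, q) := by
      rw [hε]; field_simp
    linarith
  have hsub : Icc 0 T ×ˢ (univ : Set M) ⊆ Ico 0 t₁ ×ˢ univ :=
    prod_mono (fun t ht => ⟨ht.1, ht.2.trans_lt hT.2⟩) subset_rfl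
  have hv : ContinuousOn (fun q : ℝ × M => u q - ε * q.1) (Icc 0 T ×ˢ univ) :=
    (hu.mono hsub).sub (by fun_prop)
  obtain ⟨⟨s, p'⟩, ⟨hs, -⟩, hmax⟩ := (isCompact_Icc.prod isCompact_univ).exists_isMaxOn
    ⟨(0, p), ⟨le_rfl, hT.1⟩, mem_univ _⟩ hv
  have hmax' : ∀ t ∈ Icc 0 T, ∀ p, u (t, p) - ε * t ≤ u (s, p') - ε * s :=
    fun t ht p => hmax ⟨ht, mem_univ p⟩
  have hs0 : 0 < s := by
    rcases hs.1.eq_or_lt with h0 | h0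
    · exfalso
      have h1 := hmax' T ⟨hT.1, le_rfl⟩ p
      replace h0 : 0 = s := h0
      rw [← h0] at h1
      have h2 := hq' p'
      linarith
    · exact h0
  obtain ⟨γ, U, hU, η, hη, hexp⟩ := hmaxu s ⟨hs0, hs.2.trans_lt hT.2⟩ p'
    (fun p => by linarith [hmax' s hs p])
  have hη' : ∀ᶠ x in 𝓝[>] (0 : ℝ), -ε < η x := hη.eventually (lt_mem_nhds (by linarith))
  have hxs : ∀ᶠ x in 𝓝[>] (0 : ℝ), x ∈ Ioo 0 s := Ioo_mem_nhdsGT hs0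
  -- Slightly before `s`, the function `u - ε t` has gained `(U + η x + ε) x > 0`, contradicting
  -- maximality.
  obtain ⟨x, h1, h2, h3⟩ := (hexp.and (hη'.and hxs)).exists
  have h4 := hmax' (s - x) ⟨by linarith [h3.2], by linarith [h3.1, hs.2]⟩ (γ x)
  have h5 : 0 < (η x + ε) * x := mul_pos (by linarith) h3.1
  have h6 : 0 ≤ U * x := mul_nonneg hU h3.1.le
  replace h1 : u (s - x, γ x) = u (s, p') + U * x + η x * x := h1
  rw [h1] at h4
  linarith

/-- The maximum principle for functions of the radii of curvature along a curvature flow. -/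
theorem max_principle (hK : ContDiffOn ℝ 2 K rocRegion) (hH : ContDiffOn ℝ 2 H rocRegion)
    (ht₁ : 0 < t₁) (hflow : IsClassicalCurvatureFlow K t₁ X n) (hpar : IsParabolicFlow K t₁ X n)
    (hI : ∀ t ∈ Ico 0 t₁, ∀ p, 0 ≤ poisson H (conserved K) (rocMap (X t) (n t) p))
    (hAB : ∀ t ∈ Ico 0 t₁, ∀ p,
      |coeffB H K (rocMap (X t) (n t) p)| ≤ coeffA H K (rocMap (X t) (n t) p)) :
    ∃ q, (∀ p, H (rocMap (X 0) (n 0) p) ≤ H (rocMap (X 0) (n 0) q)) ∧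
      ∀ t ∈ Ico 0 t₁, ∀ p, H (rocMap (X t) (n t) p) ≤ H (rocMap (X 0) (n 0) q) := by
  refine le_initial_max (u := fun q : ℝ × S2 => H (rocMap (X q.1) (n q.1) q.2)) ht₁
    (hH.continuousOn.comp hflow.continuousOn_rocMap (fun q hq => hflow.rocMap_mem hq.1 q.2)) ?_
  intro s hst p' hmax
  have hst' : s ∈ Ico 0 t₁ := Ioo_subset_Ico_self hst
  obtain ⟨h, π, hπ, hsupp⟩ := hflow.exists_supportFunction hst p'
  have htime : ∀ᶠ q in 𝓝 (s, n s p'), q.1 ∈ Ico 0 t₁ :=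
    continuous_fst.continuousAt.eventually (Ico_mem_nhds hst.1 hst.2)
  obtain ⟨U, hU, hexp⟩ := hsupp.exists_backward_expansion hK hH
    (htime.mono fun q hq => hflow.rocMap_mem hq _) (hpar s hst' _) (hI s hst' _)
    (htime.mono fun q hq => hAB _ hq _)
    (Eventually.of_forall fun q hq => by
      have h1 := hmax (π q)
      simp only at hq
      simp only [hπ, hq]
      exact h1)
  -- The comparison curve follows the points whose normal stays equal to that at the maximum.
  refine ⟨fun x => π ((s, n s p') + x • ((-1, 0) : ℝ × E3)), U, hU, ?_⟩
  simp only [hπ] at hexp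
  refine hexp.congr (Eventually.of_forall fun x => ?_)
  have : ((s, n s p') + x • ((-1, 0) : ℝ × E3)).1 = s - x := by simp [sub_eq_add_neg]
  rw [this]

end MaximumPrinciple

end CurvatureFlow

theorem mainTheorem1 (K H : ℝ × ℝ → ℝ)
    (hK : ContDiffOn ℝ 2 K CurvatureFlow.rocRegion)
    (hH : ContDiffOn ℝ 2 H CurvatureFlow.rocRegion)
    (t₁ : ℝ) (ht₁ : 0 < t₁)
    (X n : ℝ → CurvatureFlow.S2 → CurvatureFlow.E3)
    (hflow : CurvatureFlow.IsClassicalCurvatureFlow K t₁ X n)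
    (hpar : CurvatureFlow.IsParabolicFlow K t₁ X n)
    (f : ℝ → CurvatureFlow.S2 → ℝ × ℝ)
    (hf : ∀ t p, f t p = CurvatureFlow.rocMap (X t) (n t) p) :
    ((∀ t ∈ Set.Ico 0 t₁, ∀ p,
          0 ≤ CurvatureFlow.poisson H (CurvatureFlow.conserved K) (f t p)) →
      (∀ t ∈ Set.Ico 0 t₁, ∀ p,
          |CurvatureFlow.coeffB H K (f t p)| ≤ CurvatureFlow.coeffA H K (f t p)) →
      ∃ q, (∀ p, H (f 0 p) ≤ H (f 0 q)) ∧
        ∀ t ∈ Set.Ico 0 t₁, ∀ p, H (f t p) ≤ H (f 0 q)) ∧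
    ((∀ t ∈ Set.Ico 0 t₁, ∀ p,
          CurvatureFlow.poisson H (CurvatureFlow.conserved K) (f t p) ≤ 0) →
      (∀ t ∈ Set.Ico 0 t₁, ∀ p,
          CurvatureFlow.coeffA H K (f t p) ≤ -|CurvatureFlow.coeffB H K (f t p)|) →
      ∃ q, (∀ p, H (f 0 q) ≤ H (f 0 p)) ∧
        ∀ t ∈ Set.Ico 0 t₁, ∀ p, H (f 0 q) ≤ H (f t p)) := by
  simp only [hf]
  refine ⟨CurvatureFlow.max_principle hK hH ht₁ hflow hpar, fun hI hAB => ?_⟩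
  obtain ⟨q, h1, h2⟩ := CurvatureFlow.max_principle hK hH.neg ht₁ hflow hpar
    (fun t ht p => by
      rw [CurvatureFlow.poisson_neg _ _ (hflow.rocMap_mem ht p)]
      exact neg_nonneg.2 (hI t ht p))
    (fun t ht p => by
      rw [CurvatureFlow.coeffA_neg _ _ (hflow.rocMap_mem ht p),
        CurvatureFlow.coeffB_neg _ _ (hflow.rocMap_mem ht p), abs_neg]
      exact le_neg.1 (hAB t ht p))
  exact ⟨q, fun p => neg_le_neg_iff.1 (h1 p), fun t ht p => neg_le_neg_iff.1 (h2 t ht p)⟩
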